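/- Let $V_0$ be a finite-dimensional real vector space, let $R\subset V_0$ be a reduced, not necessarily crystallographic and not necessarily spanning, finite root system with coroots $\alpha^\vee\in V_0^\vee=\mathrm{Hom}_{\mathbb R}(V_0,\mathbb R)$, simple roots $\Pi$, finite reflection group $W$ with longest element $w_0$ and sign character $\mathrm{sgn}=\det$. Let $V=\mathbb C\otimes_{\mathbb R}V_0$ and $n=\dim_{\mathbb C} V$, and let $k:\Pi\to\mathbb C$, $\alpha\mapsto k_\alpha$, be constant on $W$-orbits. The graded affine Hecke algebra $\mathbb H$ is the associative unital $\mathbb C$-algebra generated by $t_w$ ($w\in W$) and $v\in V$ such that $w\mapsto t_w$ extends to an algebra homomorphism $\mathbb C[W]\to\mathbb H$, $v\mapsto v$ extends to an algebra homomorphism $S(V)\to\mathbb H$ (both are injective), and $t_{s_\alpha}v-s_\alpha(v)t_{s_\alpha}=k_\alpha\langle v,\alpha^\vee\rangle$ for $\alpha\in\Pi$, $v\in V$. Let $*$ and $\bullet$ be the linear anti-involutions of $\mathbb H$ with $t_w^*=t_w^\bullet=t_w^{-1}$, $v^\bullet=v$ and $v^*=t_{w_0}(-w_0(v))t_{w_0}^{-1}$,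 and let $\iota$ be the (Iwahori–Matsumoto) involution with $\iota(v)=-v$ and $\iota(t_w)=\mathrm{sgn}(w)t_w$. For an $\mathbb H$-module $X$ let $X^*$ (resp. $X^\bullet$) be the space of linear functionals on $X$ with $(hf)(x)=f(h^*x)$ (resp. $f(h^\bullet x)$), and let $\iota(X)$ be $X$ with the action twisted by $\iota$. Ext groups are taken in the category of all $\mathbb H$-modules. Then for all finite-dimensional $\mathbb H$-modules $X,Y$ and all $i$ there is a non-degenerate $\mathbb C$-bilinear pairing \[ \mathrm{Ext}^i_{\mathbb H}(X,Y)\times\mathrm{Ext}^{n-i}_{\mathbb H}(X^*,\iota(Y)^\bullet)\to\mathbb C \] (for $i>n$ this means $\mathrm{Ext}^i_{\mathbb H}(X,Y)=0$), and these pairings are natural (functorial) in $X$ and in $Y$. More precisely, every finite-dimensional $\mathbb H$-module $X$ has a projective resolution with terms $\mathbb H\otimes_{\mathbb C[W]}(X\otimes\wedge^iV)$, augmentation $h\otimes x\mapsto hx$ and differentials \[ h\otimes (x\otimes v_0\wedge\dots\wedge v_i)\mapsto\sum_{j=0}^i(-1)^j(hv_j\otimes x-h\otimes v_jx)\otimes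 v_0\wedge\dots\widehat{v_j}\dots\wedge v_i, \] and, for a fixed basis $e_1,\dots,e_n$ of $V$, the pairings can be chosen so that the pairing of the classes of cocycles $\eta\in\mathrm{Hom}_W(X\otimes\wedge^iV,Y)$ and $\eta'\in\mathrm{Hom}_W(X^*\otimes\wedge^{n-i}V,\iota(Y)^\bullet)$ in the resulting complexes is \[ \sum_r\sum_{I}\varepsilon_I\,\eta'(b_r^*\otimes e_{I^c})\bigl(\eta(b_r\otimes e_I)\bigr), \] where $(b_r)$ is any basis of $X$ with dual basis $(b_r^*)$, $I$ runs over the $i$-element subsets of $\{1,\dots,n\}$ with complement $I^c$, and $e_I\wedge e_{I^c}=\varepsilon_I\,e_1\wedge\dots\wedge e_n$. -/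

import Mathlib

open CategoryTheory
open scoped TensorProduct

universe u

set_option linter.unusedSectionVars false

noncomputable section

namespace GradedHecke

section RootData

variable {ι V₀ N : Type u} [Fintype ι] [AddCommGroup V₀] [Module ℝ V₀]
  [AddCommGroup N] [Module ℝ N] {P : RootPairing ι ℝ V₀ N}

/-- A choice `Π` of simple roots in a (not necessarily crystallographic) root system: a linearly
independent set of roots such that every root is a linear combination of simple roots with all
coefficients `≥ 0` or with all coefficients `≤ 0`. -/
structure SimpleSystem (P : RootPairing ι ℝ V₀ N) where
  simple : Set ι
  linearIndepOn : LinearIndepOn ℝ P.root simple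
  pos_or_neg : ∀ i, ∃ c : ι → ℝ, (∀ j ∉ simple, c j = 0) ∧ P.root i = ∑ j, c j • P.root j ∧
    ((∀ j, 0 ≤ c j) ∨ (∀ j, c j ≤ 0))

/-- The root with index `i` is positive: it is a nonnegative combination of simple roots. -/
def SimpleSystem.IsPos (S : SimpleSystem P) (i : ι) : Prop :=
  ∃ c : ι → ℝ, (∀ j ∉ S.simple, c j = 0) ∧ P.root i = ∑ j, c j • P.root j ∧ ∀ j, 0 ≤ c j

/-- The simple reflection (or any reflection) `s_α`, as an element of the finite reflection
group `W`. -/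
def refl (P : RootPairing ι ℝ V₀ N) (i : ι) : P.weylGroup := RootPairing.weylGroup.ofIdx P i

/-- The permutation of (the indices of) the roots given by `w ∈ W`. -/
def perm (P : RootPairing ι ℝ V₀ N) (w : P.weylGroup) : Equiv.Perm ι := P.weylGroupToPerm w

/-- A parameter function `k : Π → ℂ`, constant on `W`-orbits. -/
structure Parameter (S : SimpleSystem P) where
  val : S.simple → ℂ
  invariant : ∀ (α β : S.simple) (w : P.weylGroup), perm P w α = β → val α = val β

/-- The number of positive roots made negative by `w`, i.e. the length of `w`. -/
def SimpleSystem.length (S : SimpleSystem P) (w : P.weylGroup) : ℕ :=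
  Set.ncard {i | S.IsPos i ∧ ¬ S.IsPos (perm P w i)}

lemma SimpleSystem.length_le (S : SimpleSystem P) (w : P.weylGroup) :
    S.length w ≤ Fintype.card ι := by
  rw [← Nat.card_eq_fintype_card, ← Set.ncard_univ]
  exact Set.ncard_le_ncard (Set.subset_univ _) Set.finite_univ

lemma SimpleSystem.exists_longest (S : SimpleSystem P) :
    ∃ w : P.weylGroup, ∀ w', S.length w' ≤ S.length w := by
  obtain ⟨m, ⟨w, rfl⟩, hm⟩ := (Nat.sSup_mem (s := Set.range S.length) ⟨_, 1, rfl⟩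
    ⟨Fintype.card ι, by rintro _ ⟨w, rfl⟩; exact S.length_le w⟩ |> fun h => (⟨_, h, rfl⟩ :
      ∃ m, m ∈ Set.range S.length ∧ m = sSup (Set.range S.length)))
  refine ⟨w, fun w' => ?_⟩
  rw [hm]
  exact le_csSup ⟨Fintype.card ι, by rintro _ ⟨w, rfl⟩; exact S.length_le w⟩ ⟨w', rfl⟩

/-- The longest element `w₀` of `W`. -/
def SimpleSystem.longest (S : SimpleSystem P) : P.weylGroup := S.exists_longest.choose

lemma SimpleSystem.length_le_longest (S : SimpleSystem P) (w : P.weylGroup) :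
    S.length w ≤ S.length S.longest := S.exists_longest.choose_spec w

/-! Combinatorics of positive roots. -/

lemma root_perm (w : P.weylGroup) (i : ι) : P.root (perm P w i) = w • P.root i :=
  (P.weylGroup_apply_root w i).symm

lemma perm_mul (w w' : P.weylGroup) (i : ι) : perm P (w * w') i = perm P w (perm P w' i) := by
  apply P.root.injective
  simp only [root_perm, mul_smul]

lemma perm_one (i : ι) : perm P 1 i = i := by
  apply P.root.injective
  simp only [root_perm, one_smul]

lemma perm_refl (i j : ι) : perm P (refl P i) j = P.reflectionPerm i j := rfl

lemma smul_lin (w : P.weylGroup) (c : ℝ) (v : V₀) : w • (c • v) = c • (w • v) :=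
  smul_comm _ _ _

lemma smul_sum_roots (w : P.weylGroup) (c : ι → ℝ) :
    w • (∑ j, c j • P.root j) = ∑ j, c j • P.root (perm P w j) := by
  rw [Finset.smul_sum]
  exact Finset.sum_congr rfl fun j _ => by rw [smul_lin, root_perm]

/-- Coefficients with respect to the simple roots are unique. -/
lemma SimpleSystem.coeff_unique (S : SimpleSystem P) {c d : ι → ℝ} (hc : ∀ j ∉ S.simple, c j = 0)
    (hd : ∀ j ∉ S.simple, d j = 0) (h : ∑ j, c j • P.root j = ∑ j, d j • P.root j) : c = d := by
  classical
  have key := linearIndepOn_iff'.mp S.linearIndepOn (Finset.univ.filter (· ∈ S.simple))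
    (fun j => c j - d j) (by intro x; simp) (by
      rw [Finset.sum_filter]
      have h' : ∑ j, (c j • P.root j - d j • P.root j) = 0 := by
        rw [Finset.sum_sub_distrib, h, sub_self]
      refine Eq.trans (Finset.sum_congr rfl fun j _ => ?_) h'
      split_ifs with hj
      · rw [sub_smul]
      · simp [hc j hj, hd j hj])
  funext j
  by_cases hj : j ∈ S.simple
  · exact sub_eq_zero.mp (key j (by simpa using hj))
  · rw [hc j hj, hd j hj]

lemma SimpleSystem.isPos_simple (S : SimpleSystem P) {α : ι} (hα : α ∈ S.simple) :
    S.IsPos α := by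
  classical
  refine ⟨Pi.single α 1, fun j hj => ?_, ?_, fun j => ?_⟩
  · exact Pi.single_eq_of_ne (by rintro rfl; exact hj hα) _
  · simp [Pi.single_apply, ite_smul]
  · by_cases h : j = α
    · subst h; simp
    · simp [h]

lemma SimpleSystem.not_isPos_of_neg (S : SimpleSystem P) {i j : ι} (hi : S.IsPos i)
    (hij : P.root j = - P.root i) : ¬ S.IsPos j := by
  rintro ⟨d, hd, hjd, hd0⟩
  obtain ⟨c, hc, hic, hc0⟩ := hi
  have : d = fun l => - c l := S.coeff_unique hd (fun l hl => by simp [hc l hl]) (by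
    rw [← hjd, hij, hic]; simp)
  have hz : ∀ l, c l = 0 := fun l => by
    have h1 := hd0 l
    have h2 := hc0 l
    have h3 := congrFun this l
    linarith
  exact P.ne_zero i (by rw [hic]; simp [hz])

lemma SimpleSystem.isPos_of_not (S : SimpleSystem P) {i j : ι} (hi : ¬ S.IsPos i)
    (hij : P.root j = - P.root i) : S.IsPos j := by
  obtain ⟨c, hc, hic, h | h⟩ := S.pos_or_neg i
  · exact absurd ⟨c, hc, hic, h⟩ hi
  · exact ⟨fun l => - c l, fun l hl => by simp [hc l hl], by rw [hij, hic]; simp,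
      fun l => by simpa using h l⟩

lemma root_reflectionPerm_self (i : ι) : P.root (P.reflectionPerm i i) = - P.root i := by
  rw [RootPairing.root_reflectionPerm, RootPairing.reflection_apply_self]

/-- If all simple coefficients of a positive root vanish except at one simple root, the positive
root is that simple root. -/
lemma SimpleSystem.eq_of_coeff [P.IsReduced] (S : SimpleSystem P) {α β : ι} (hα : α ∈ S.simple)
    (hβ : S.IsPos β) {t : ℝ} (h : P.root β = t • P.root α) : β = α := by
  rcases RootPairing.IsReduced.eq_or_eq_neg (P := P) β α (by
    intro hli
    have := LinearIndependent.pair_iff.mp hli 1 (-t) (by rw [h]; simp)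
    exact one_ne_zero this.1) with h' | h'
  · exact P.root.injective h'
  · exact absurd hβ (S.not_isPos_of_neg (S.isPos_simple hα) h')

/-- A simple reflection permutes the positive roots other than its own. -/
lemma SimpleSystem.isPos_reflectionPerm [P.IsReduced] (S : SimpleSystem P) {α β : ι}
    (hα : α ∈ S.simple) (hβ : S.IsPos β) (hne : β ≠ α) : S.IsPos (P.reflectionPerm α β) := by
  classical
  by_contra hneg
  obtain ⟨c, hc, hβc, hc0⟩ := id hβ
  obtain ⟨d, hd, hd', hd0⟩ : ∃ d : ι → ℝ, (∀ j ∉ S.simple, d j = 0) ∧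
      P.root (P.reflectionPerm α β) = ∑ j, d j • P.root j ∧ ∀ j, d j ≤ 0 := by
    obtain ⟨d, hd, hd', h | h⟩ := S.pos_or_neg (P.reflectionPerm α β)
    · exact absurd ⟨d, hd, hd', h⟩ hneg
    · exact ⟨d, hd, hd', h⟩
  have hcd : d = fun j => c j - (if j = α then P.pairing β α else 0) := by
    refine S.coeff_unique hd (fun j hj => ?_) ?_
    · have : j ≠ α := by rintro rfl; exact hj hα
      simp [hc j hj, this]
    · rw [← hd', RootPairing.root_reflectionPerm, RootPairing.reflection_apply_root]
      simp only [sub_smul, Finset.sum_sub_distrib, ← hβc, ite_smul, zero_smul,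
        Finset.sum_ite_eq', Finset.mem_univ, if_true]
  have hz : ∀ j, j ≠ α → c j = 0 := fun j hj => by
    have h1 := hd0 j
    have h2 := hc0 j
    have h3 := congrFun hcd j
    simp only [hj, if_false] at h3
    linarith
  refine hne (S.eq_of_coeff hα hβ (t := c α) ?_)
  rw [hβc]
  exact Finset.sum_eq_single α (fun j _ hj => by rw [hz j hj, zero_smul]) (by simp)

lemma SimpleSystem.not_isPos_longest_simple [P.IsReduced] (S : SimpleSystem P) {α : ι}
    (hα : α ∈ S.simple) : ¬ S.IsPos (perm P S.longest α) := by
  intro hpos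
  have hlt : S.length S.longest < S.length (S.longest * refl P α) := by
    have hinj := (P.reflectionPerm α).injective
    have hself := root_reflectionPerm_self (P := P) α
    unfold SimpleSystem.length
    rw [← Set.ncard_image_of_injective _ hinj]
    refine Set.ncard_lt_ncard ?_ (Set.toFinite _)
    rw [Set.ssubset_iff_of_subset]
    · refine ⟨α, ⟨S.isPos_simple hα, ?_⟩, ?_⟩
      · rw [perm_mul, perm_refl]
        refine S.not_isPos_of_neg hpos ?_
        rw [root_perm, hself, smul_neg, root_perm]
      · rintro ⟨β, ⟨hβ, -⟩, hβα⟩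
        refine S.not_isPos_of_neg (S.isPos_simple hα) (j := β) ?_ hβ
        have : β = P.reflectionPerm α α := by
          have h2 := congrArg (P.reflectionPerm α) hβα
          rwa [RootPairing.reflectionPerm_self] at h2
        rw [this, hself]
    · rintro _ ⟨β, ⟨hβ, hβ'⟩, rfl⟩
      have hne : β ≠ α := by rintro rfl; exact hβ' hpos
      refine ⟨S.isPos_reflectionPerm hα hβ hne, ?_⟩
      rwa [perm_mul, perm_refl, RootPairing.reflectionPerm_self]
  exact absurd (S.length_le_longest (S.longest * refl P α)) (not_le.mpr hlt)

lemma SimpleSystem.not_isPos_of_forall (S : SimpleSystem P) (w : P.weylGroup)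
    (hw : ∀ α ∈ S.simple, ¬ S.IsPos (perm P w α)) {β : ι} (hβ : S.IsPos β) :
    ¬ S.IsPos (perm P w β) := by
  classical
  obtain ⟨c, hc, hβc, hc0⟩ := hβ
  have hd : ∀ j, ∃ d : ι → ℝ, (∀ l ∉ S.simple, d l = 0) ∧
      (j ∈ S.simple → P.root (perm P w j) = - ∑ l, d l • P.root l) ∧ ∀ l, 0 ≤ d l := by
    intro j
    by_cases hj : j ∈ S.simple
    · obtain ⟨d, hd, hd', h⟩ := S.isPos_of_not (hw j hj) (root_reflectionPerm_self _)
      refine ⟨d, hd, fun _ => ?_, h⟩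
      rw [← hd', root_reflectionPerm_self, neg_neg]
    · exact ⟨0, by simp, fun h => absurd h hj, by simp⟩
  choose d hd hd' hd0 using hd
  refine S.not_isPos_of_neg (i := P.reflectionPerm (perm P w β) (perm P w β)) ?_
    (by rw [root_reflectionPerm_self, neg_neg])
  refine ⟨fun l => ∑ j, c j * d j l, fun l hl => ?_, ?_, fun l => ?_⟩
  · exact Finset.sum_eq_zero fun j _ => by rw [hd j l hl, mul_zero]
  · rw [root_reflectionPerm_self, root_perm, hβc, smul_sum_roots]
    simp only [Finset.sum_smul, mul_smul]
    rw [Finset.sum_comm, ← Finset.sum_neg_distrib]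
    refine Finset.sum_congr rfl fun j _ => ?_
    by_cases hj : j ∈ S.simple
    · rw [hd' j hj, ← Finset.smul_sum, smul_neg, neg_neg]
    · simp [hc j hj]
  · exact Finset.sum_nonneg fun j _ => mul_nonneg (hc0 j) (hd0 j l)

lemma SimpleSystem.not_isPos_longest [P.IsReduced] (S : SimpleSystem P) {β : ι}
    (hβ : S.IsPos β) : ¬ S.IsPos (perm P S.longest β) :=
  S.not_isPos_of_forall _ (fun _ h => S.not_isPos_longest_simple h) hβ

lemma SimpleSystem.isPos_longest [P.IsReduced] (S : SimpleSystem P) {β : ι}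
    (hβ : ¬ S.IsPos β) : S.IsPos (perm P S.longest β) := by
  have h1 : S.IsPos (P.reflectionPerm β β) := S.isPos_of_not hβ (root_reflectionPerm_self _)
  refine S.isPos_of_not (S.not_isPos_longest h1) ?_
  rw [root_perm, root_perm, root_reflectionPerm_self, smul_neg, neg_neg]

/-- The index of the root `- w₀⁻¹ α`. -/
def SimpleSystem.opp (S : SimpleSystem P) (α : ι) : ι :=
  perm P (S.longest⁻¹ * refl P α) α

lemma SimpleSystem.root_opp (S : SimpleSystem P) (α : ι) :
    P.root (S.opp α) = - (S.longest⁻¹ • P.root α) := by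
  rw [opp, root_perm, mul_smul, ← smul_neg, ← root_reflectionPerm_self, ← perm_refl, root_perm]

lemma SimpleSystem.isPos_opp_iff [P.IsReduced] (S : SimpleSystem P) (α : ι) :
    S.IsPos (S.opp α) ↔ S.IsPos α := by
  have h : P.root α = - P.root (perm P S.longest (S.opp α)) := by
    rw [root_perm, root_opp, smul_neg, neg_neg, smul_inv_smul]
  constructor
  · intro hp
    exact S.isPos_of_not (S.not_isPos_longest hp) h
  · intro hp
    by_contra hn
    exact S.not_isPos_of_neg (S.isPos_longest hn) h hp

/-- `α ↦ - w₀⁻¹ α` preserves the set of simple roots. -/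
lemma SimpleSystem.opp_mem [P.IsReduced] (S : SimpleSystem P) {α : ι} (hα : α ∈ S.simple) :
    S.opp α ∈ S.simple := by
  classical
  obtain ⟨c, hc, hβ, hc0⟩ := (S.isPos_opp_iff α).mpr (S.isPos_simple hα)
  -- `α = ∑ c j • (- w₀ j)`, where all `- w₀ j` are positive
  set r : ι → ι := fun j => P.reflectionPerm (perm P S.longest j) (perm P S.longest j) with hr
  have hrr : ∀ j, P.root (r j) = - (S.longest • P.root j) := fun j => by
    rw [hr, root_reflectionPerm_self, root_perm]
  have hsum : P.root α = ∑ j, c j • P.root (r j) := by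
    have h1 : P.root α = - (S.longest • P.root (S.opp α)) := by
      rw [root_opp, smul_neg, neg_neg, smul_inv_smul]
    rw [h1, hβ, smul_sum_roots, ← Finset.sum_neg_distrib]
    exact Finset.sum_congr rfl fun j _ => by rw [hrr, smul_neg, root_perm]
  have hd : ∀ j, ∃ d : ι → ℝ, (∀ l ∉ S.simple, d l = 0) ∧
      (j ∈ S.simple → P.root (r j) = ∑ l, d l • P.root l) ∧ ∀ l, 0 ≤ d l := by
    intro j
    by_cases hj : j ∈ S.simple
    · obtain ⟨d, hd, hd', h⟩ := S.isPos_of_not (S.not_isPos_longest_simple hj)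
        (j := r j) (root_reflectionPerm_self _)
      exact ⟨d, hd, fun _ => hd', h⟩
    · exact ⟨0, by simp, fun h => absurd h hj, by simp⟩
  choose d hd hd' hd0 using hd
  have hcoef : (Pi.single α 1 : ι → ℝ) = fun l => ∑ j, c j * d j l := by
    refine S.coeff_unique (fun j hj => Pi.single_eq_of_ne (by rintro rfl; exact hj hα) _)
      (fun l hl => Finset.sum_eq_zero fun j _ => by rw [hd j l hl, mul_zero]) ?_
    have h1 : ∑ j, (Pi.single α 1 : ι → ℝ) j • P.root j = P.root α := by
      simp [Pi.single_apply, ite_smul]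
    rw [h1, hsum]
    simp only [Finset.sum_smul, mul_smul]
    rw [Finset.sum_comm]
    refine Finset.sum_congr rfl fun j _ => ?_
    by_cases hj : j ∈ S.simple
    · rw [hd' j hj, ← Finset.smul_sum]
    · simp [hc j hj]
  obtain ⟨j, hj0⟩ : ∃ j, c j ≠ 0 := by
    by_contra! hall
    exact P.ne_zero (S.opp α) (by rw [hβ]; simp [hall])
  have hjS : j ∈ S.simple := by
    by_contra hj
    exact hj0 (hc j hj)
  have hdz : ∀ l, l ≠ α → d j l = 0 := fun l hl => by
    have h1 := congrFun hcoef l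
    rw [Pi.single_eq_of_ne hl] at h1
    have h2 := (Finset.sum_eq_zero_iff_of_nonneg
      (fun j' _ => mul_nonneg (hc0 j') (hd0 j' l))).mp h1.symm j (Finset.mem_univ _)
    exact (mul_eq_zero.mp h2).resolve_left hj0
  have hrj : r j = α := by
    refine S.eq_of_coeff hα (S.isPos_of_not (S.not_isPos_longest_simple hjS)
      (root_reflectionPerm_self _)) (t := d j α) ?_
    rw [hd' j hjS]
    exact Finset.sum_eq_single α (fun l _ hl => by rw [hdz l hl, zero_smul]) (by simp)
  have : S.opp α = j := by
    apply P.root.injective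
    rw [root_opp, ← hrj, hrr, smul_neg, inv_smul_smul, neg_neg]
  rwa [this]

lemma coroot_pairing_smul (w : P.weylGroup) (v : V₀) (i : ι) :
    P.toLinearMap (w • v) (P.coroot (perm P w i)) = P.toLinearMap v (P.coroot i) := by
  have h := RootPairing.Hom.weight_coweight_transpose_apply P P (P.coroot (perm P w i))
    (w : P.Aut).toHom
  have h2 := LinearMap.congr_fun h v
  rw [RootPairing.Hom.coroot_coweightMap_apply] at h2
  have h3 : (w : P.Aut).toHom.indexEquiv.symm (perm P w i) = i :=
    (w : P.Aut).toHom.indexEquiv.symm_apply_apply i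
  rw [h3] at h2
  exact h2

lemma refl_smul (i : ι) (v : V₀) :
    refl P i • v = v - P.toLinearMap v (P.coroot i) • P.root i := by
  change P.reflection i v = _
  rw [RootPairing.reflection_apply]
  rfl

lemma refl_inv (i : ι) : (refl P i)⁻¹ = refl P i :=
  Subtype.ext (RootPairing.Equiv.reflection_inv P i)

lemma weyl_ext {w w' : P.weylGroup} (h : ∀ v : V₀, w • v = w' • v) : w = w' :=
  Subtype.ext (RootPairing.Equiv.weightHom_injective P (LinearEquiv.ext h))

lemma coroot_pairing_neg {i j : ι} (h : P.root j = - P.root i) (v : V₀) :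
    P.toLinearMap v (P.coroot j) = - P.toLinearMap v (P.coroot i) := by
  have : j = P.reflectionPerm i i := P.root.injective (by rw [h, root_reflectionPerm_self])
  rw [this, RootPairing.coroot_reflectionPerm, RootPairing.coreflection_apply_self, map_neg]

lemma SimpleSystem.pairing_opp (S : SimpleSystem P) (α : ι) (v : V₀) :
    P.toLinearMap (S.longest⁻¹ • v) (P.coroot (S.opp α)) =
      - P.toLinearMap v (P.coroot α) := by
  rw [opp, perm_mul, coroot_pairing_smul, perm_refl]
  exact coroot_pairing_neg (root_reflectionPerm_self α) v

lemma SimpleSystem.refl_opp (S : SimpleSystem P) (α : ι) :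
    refl P (S.opp α) = S.longest⁻¹ * refl P α * S.longest := by
  refine weyl_ext fun v => ?_
  obtain ⟨v, rfl⟩ : ∃ v', v = S.longest⁻¹ • v' := ⟨S.longest • v, by rw [inv_smul_smul]⟩
  rw [mul_smul, mul_smul, smul_inv_smul, refl_smul, refl_smul, pairing_opp, root_opp, smul_sub,
    smul_lin]
  simp

lemma det_refl [FiniteDimensional ℝ V₀] (i : ι) :
    LinearMap.det (RootPairing.Equiv.weightHom P (refl P i : P.Aut)).toLinearMap = -1 := by
  have : (RootPairing.Equiv.weightHom P (refl P i : P.Aut)) = P.reflection i := by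
    exact RootPairing.Equiv.reflection_weightEquiv P i
  rw [this]
  have h2 : (P.reflection i).toLinearMap =
      LinearMap.transvection (P.toLinearMap.flip (P.coroot i)) (- P.root i) := by
    ext v
    simp [LinearMap.transvection, RootPairing.reflection_apply, sub_eq_add_neg]
  rw [h2, LinearMap.transvection.det, map_neg, LinearMap.flip_apply,
    RootPairing.root_coroot_two]
  norm_num

/-- The complexification `V = ℂ ⊗ V₀`. -/
abbrev Cplx (V₀ : Type u) [AddCommGroup V₀] [Module ℝ V₀] : Type u := ℂ ⊗[ℝ] V₀

/-- The `ℂ`-linear extension to `V` of the action of `w ∈ W` on `V₀`. -/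
def act (P : RootPairing ι ℝ V₀ N) (w : P.weylGroup) : Cplx V₀ →ₗ[ℂ] Cplx V₀ :=
  (RootPairing.Equiv.weightHom P (w : P.Aut)).toLinearMap.baseChange ℂ

/-- The `ℂ`-linear extension `v ↦ ⟨v, α^∨⟩` to `V` of the coroot `α^∨ : V₀ → ℝ`. -/
def pair (P : RootPairing ι ℝ V₀ N) (i : ι) : Cplx V₀ →ₗ[ℂ] ℂ :=
  (TensorProduct.AlgebraTensorModule.rid ℝ ℂ ℂ).toLinearMap ∘ₗ
    (P.toLinearMap.flip (P.coroot i)).baseChange ℂ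

lemma act_tmul (w : P.weylGroup) (c : ℂ) (v : V₀) : act P w (c ⊗ₜ v) = c ⊗ₜ (w • v) := rfl

lemma pair_tmul (i : ι) (c : ℂ) (v : V₀) :
    pair P i (c ⊗ₜ v) = (P.toLinearMap v (P.coroot i) : ℝ) • c := by
  simp [pair]

lemma act_mul (w w' : P.weylGroup) (v : Cplx V₀) : act P (w * w') v = act P w (act P w' v) := by
  induction v using TensorProduct.induction_on with
  | zero => simp
  | tmul c v => simp only [act_tmul, mul_smul]
  | add a b ha hb => simp only [map_add, ha, hb]

lemma act_one (v : Cplx V₀) : act P 1 v = v := by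
  induction v using TensorProduct.induction_on with
  | zero => simp
  | tmul c v => simp only [act_tmul, one_smul]
  | add a b ha hb => simp only [map_add, ha, hb]

lemma pair_act_refl (i : ι) (v : Cplx V₀) : pair P i (act P (refl P i) v) = - pair P i v := by
  induction v using TensorProduct.induction_on with
  | zero => simp
  | tmul c v =>
    simp only [act_tmul, pair_tmul, refl_smul, map_sub, map_smul, LinearMap.sub_apply,
      LinearMap.smul_apply, RootPairing.root_coroot_two, smul_eq_mul, ← neg_smul]
    congr 1
    ring
  | add a b ha hb => simp only [map_add, ha, hb, neg_add]

lemma act_refl_refl (i : ι) (v : Cplx V₀) : act P (refl P i) (act P (refl P i) v) = v := by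
  rw [← act_mul]
  nth_rewrite 1 [← refl_inv i]
  rw [inv_mul_cancel, act_one]

lemma SimpleSystem.pair_opp (S : SimpleSystem P) (α : ι) (v : Cplx V₀) :
    pair P (S.opp α) (act P S.longest⁻¹ v) = - pair P α v := by
  induction v using TensorProduct.induction_on with
  | zero => simp
  | tmul c v => rw [act_tmul, pair_tmul, pair_tmul, pairing_opp, neg_smul]
  | add a b ha hb => simp only [map_add, ha, hb, neg_add]

/-- The sign character `sgn : W → {±1}`, `w ↦ det w`. -/
def sgn (P : RootPairing ι ℝ V₀ N) : P.weylGroup →* ℂ where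
  toFun w := ((LinearMap.det
    (RootPairing.Equiv.weightHom P (w : P.Aut)).toLinearMap : ℝ) : ℂ)
  map_one' := by
    have : (RootPairing.Equiv.weightHom P ((1 : P.weylGroup) : P.Aut)).toLinearMap = 1 := rfl
    rw [this, map_one, Complex.ofReal_one]
  map_mul' w w' := by
    have : (RootPairing.Equiv.weightHom P ((w * w' : P.weylGroup) : P.Aut)).toLinearMap =
      (RootPairing.Equiv.weightHom P (w : P.Aut)).toLinearMap *
        (RootPairing.Equiv.weightHom P (w' : P.Aut)).toLinearMap := rfl
    rw [this, map_mul, Complex.ofReal_mul]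

lemma sgn_refl [FiniteDimensional ℝ V₀] (i : ι) : sgn P (refl P i) = -1 := by
  have h := det_refl (P := P) i
  change ((LinearMap.det _ : ℝ) : ℂ) = -1
  rw [h]
  norm_num

end RootData

section Algebra

variable {ι V₀ N : Type u} [Fintype ι] [AddCommGroup V₀] [Module ℝ V₀]
  [AddCommGroup N] [Module ℝ N] {P : RootPairing ι ℝ V₀ N} {S : SimpleSystem P}

/-- The free algebra on symbols `t_w` (`w ∈ W`) and `f_v` (`v ∈ V`). -/
abbrev Free (P : RootPairing ι ℝ V₀ N) : Type u := FreeAlgebra ℂ (P.weylGroup ⊕ Cplx V₀)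

/-- The generator `t_w` of the free algebra. -/
abbrev Free.t (w : P.weylGroup) : Free P := FreeAlgebra.ι ℂ (Sum.inl w)

/-- The generator `f_v` of the free algebra. -/
abbrev Free.f (P : RootPairing ι ℝ V₀ N) (v : Cplx V₀) : Free P := FreeAlgebra.ι ℂ (Sum.inr v)

/-- The defining relations of the graded affine Hecke algebra: `w ↦ t_w` is a homomorphism from
the group algebra `ℂ[W]`, `v ↦ f_v` is a homomorphism from the symmetric algebra `S(V)`, and
`t_{s_α} v - s_α(v) t_{s_α} = k_α ⟨v, α^∨⟩` for `α ∈ Π`. -/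
inductive Rel (k : Parameter S) : Free P → Free P → Prop
  | one : Rel k (Free.t 1) 1
  | mul (w w' : P.weylGroup) : Rel k (Free.t (w * w')) (Free.t w * Free.t w')
  | add (v v' : Cplx V₀) : Rel k (Free.f P (v + v')) (Free.f P v + Free.f P v')
  | smul (c : ℂ) (v : Cplx V₀) : Rel k (Free.f P (c • v)) (c • Free.f P v)
  | comm (v v' : Cplx V₀) : Rel k (Free.f P v * Free.f P v') (Free.f P v' * Free.f P v)
  | cross (α : S.simple) (v : Cplx V₀) :
      Rel k (Free.t (refl P α) * Free.f P v - Free.f P (act P (refl P α) v) * Free.t (refl P α))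
        (algebraMap ℂ _ (k.val α * pair P α v))

end Algebra

end GradedHecke

open GradedHecke in
/-- The graded affine Hecke algebra `ℍ(Π, k)`. -/
def GradedHeckeAlgebra {ι V₀ N : Type u} [Fintype ι] [AddCommGroup V₀] [Module ℝ V₀]
    [AddCommGroup N] [Module ℝ N] {P : RootPairing ι ℝ V₀ N} {S : SimpleSystem P}
    (k : Parameter S) : Type u := RingQuot (Rel k)

namespace GradedHecke

section Hecke

variable {ι V₀ N : Type u} [Fintype ι] [AddCommGroup V₀] [Module ℝ V₀]
  [AddCommGroup N] [Module ℝ N] {P : RootPairing ι ℝ V₀ N} {S : SimpleSystem P}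
  (k : Parameter S)

instance : Ring (GradedHeckeAlgebra k) := inferInstanceAs (Ring (RingQuot (Rel k)))

instance : Algebra ℂ (GradedHeckeAlgebra k) := inferInstanceAs (Algebra ℂ (RingQuot (Rel k)))

/-- The element `t_w ∈ ℍ`. -/
def t (w : P.weylGroup) : GradedHeckeAlgebra k := RingQuot.mkAlgHom ℂ (Rel k) (Free.t w)

/-- The element `v ∈ ℍ`, for `v ∈ V`. -/
def x (v : Cplx V₀) : GradedHeckeAlgebra k := RingQuot.mkAlgHom ℂ (Rel k) (Free.f P v)

lemma t_one : t k 1 = 1 := by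
  simpa [t] using! RingQuot.mkAlgHom_rel ℂ (Rel.one (k := k))

lemma t_mul (w w' : P.weylGroup) : t k (w * w') = t k w * t k w' := by
  simpa [t] using! RingQuot.mkAlgHom_rel ℂ (Rel.mul (k := k) w w')

lemma x_add (v v' : Cplx V₀) : x k (v + v') = x k v + x k v' := by
  simpa [x] using! RingQuot.mkAlgHom_rel ℂ (Rel.add (k := k) v v')

lemma x_smul (c : ℂ) (v : Cplx V₀) : x k (c • v) = c • x k v := by
  simpa [x] using! RingQuot.mkAlgHom_rel ℂ (Rel.smul (k := k) c v)

lemma x_comm (v v' : Cplx V₀) : x k v * x k v' = x k v' * x k v := by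
  simpa [x] using! RingQuot.mkAlgHom_rel ℂ (Rel.comm (k := k) v v')

lemma cross (α : S.simple) (v : Cplx V₀) :
    t k (refl P α) * x k v - x k (act P (refl P α) v) * t k (refl P α) =
      algebraMap ℂ _ (k.val α * pair P α v) := by
  have h := RingQuot.mkAlgHom_rel ℂ (Rel.cross (k := k) α v)
  rw [map_sub, map_mul, map_mul, AlgHom.commutes] at h
  exact h

lemma x_neg (v : Cplx V₀) : x k (-v) = - x k v := by
  rw [← neg_one_smul ℂ, x_smul, neg_one_smul]

/-- Homomorphisms out of `ℍ` from elements satisfying the defining relations. -/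
def lift {A : Type u} [Ring A] [Algebra ℂ A] (T : P.weylGroup → A) (F : Cplx V₀ → A)
    (h_one : T 1 = 1) (h_mul : ∀ w w', T (w * w') = T w * T w')
    (h_add : ∀ v v', F (v + v') = F v + F v') (h_smul : ∀ (c : ℂ) v, F (c • v) = c • F v)
    (h_comm : ∀ v v', F v * F v' = F v' * F v)
    (h_cross : ∀ (α : S.simple) v,
      T (refl P α) * F v - F (act P (refl P α) v) * T (refl P α) =
        algebraMap ℂ A (k.val α * pair P α v)) :
    GradedHeckeAlgebra k →ₐ[ℂ] A :=
  RingQuot.liftAlgHom ℂ ⟨FreeAlgebra.lift ℂ (Sum.elim T F), by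
    intro a b hab
    induction hab with
    | one => simpa using h_one
    | mul w w' => simpa using h_mul w w'
    | add v v' => simpa using h_add v v'
    | smul c v => simpa using h_smul c v
    | comm v v' => simpa using h_comm v v'
    | cross α v => simpa using h_cross α v⟩

section lift

variable {A : Type u} [Ring A] [Algebra ℂ A] (T : P.weylGroup → A) (F : Cplx V₀ → A)
    (h_one : T 1 = 1) (h_mul : ∀ w w', T (w * w') = T w * T w')
    (h_add : ∀ v v', F (v + v') = F v + F v') (h_smul : ∀ (c : ℂ) v, F (c • v) = c • F v)
    (h_comm : ∀ v v', F v * F v' = F v' * F v)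
    (h_cross : ∀ (α : S.simple) v,
      T (refl P α) * F v - F (act P (refl P α) v) * T (refl P α) =
        algebraMap ℂ A (k.val α * pair P α v))

lemma lift_t (w : P.weylGroup) :
    lift k T F h_one h_mul h_add h_smul h_comm h_cross (t k w) = T w := by
  unfold lift t
  erw [RingQuot.liftAlgHom_mkAlgHom_apply]
  simp

lemma lift_x (v : Cplx V₀) :
    lift k T F h_one h_mul h_add h_smul h_comm h_cross (x k v) = F v := by
  unfold lift x
  erw [RingQuot.liftAlgHom_mkAlgHom_apply]
  simp

end lift

/-- The Iwahori-Matsumoto involution `ι`: `ι(v) = -v`, `ι(t_w) = sgn(w) t_w`. -/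
def im [FiniteDimensional ℝ V₀] : GradedHeckeAlgebra k →ₐ[ℂ] GradedHeckeAlgebra k :=
  lift k (fun w => sgn P w • t k w) (fun v => - x k v)
    (by simp [t_one])
    (fun w w' => by rw [map_mul, t_mul, smul_mul_smul_comm])
    (fun v v' => by rw [x_add, neg_add])
    (fun c v => by rw [x_smul, smul_neg])
    (fun v v' => by rw [neg_mul_neg, neg_mul_neg, x_comm])
    (fun α v => by
      rw [sgn_refl, neg_one_smul, neg_mul_neg, neg_mul_neg]
      exact cross k α v)

/-- The linear anti-involution `•`: `v^• = v`, `t_w^• = t_w⁻¹`. -/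
def bullet : GradedHeckeAlgebra k →ₐ[ℂ] (GradedHeckeAlgebra k)ᵐᵒᵖ :=
  lift k (fun w => .op (t k w⁻¹)) (fun v => .op (x k v))
    (by rw [inv_one, t_one, MulOpposite.op_one])
    (fun w w' => by rw [mul_inv_rev, t_mul, MulOpposite.op_mul])
    (fun v v' => by rw [x_add, MulOpposite.op_add])
    (fun c v => by rw [x_smul, MulOpposite.op_smul])
    (fun v v' => by rw [← MulOpposite.op_mul, ← MulOpposite.op_mul, x_comm])
    (fun α v => by
      rw [refl_inv, ← MulOpposite.op_mul, ← MulOpposite.op_mul, ← MulOpposite.op_sub,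
        MulOpposite.algebraMap_apply]
      congr 1
      have h := cross k α (act P (refl P α) v)
      rw [act_refl_refl, pair_act_refl, mul_neg, map_neg] at h
      rw [← neg_sub, h, neg_neg])

/-- The linear anti-involution `*`: `v^* = t_{w₀} θ(v) t_{w₀}⁻¹` with `θ(v) = -w₀(v)`, and
`t_w^* = t_w⁻¹`. (Recall that `w₀ = w₀⁻¹`.) -/
def star [P.IsReduced] : GradedHeckeAlgebra k →ₐ[ℂ] (GradedHeckeAlgebra k)ᵐᵒᵖ :=
  lift k (fun w => .op (t k w⁻¹))
    (fun v => .op (t k S.longest * x k (- act P S.longest⁻¹ v) * t k S.longest⁻¹))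
    (by rw [inv_one, t_one, MulOpposite.op_one])
    (fun w w' => by rw [mul_inv_rev, t_mul, MulOpposite.op_mul])
    (fun v v' => by
      rw [map_add, neg_add, x_add, mul_add, add_mul, MulOpposite.op_add])
    (fun c v => by
      rw [map_smul, ← smul_neg, x_smul, mul_smul_comm, smul_mul_assoc, MulOpposite.op_smul])
    (fun v v' => by
      have h (a b : Cplx V₀) : (t k S.longest * x k a * t k S.longest⁻¹) *
          (t k S.longest * x k b * t k S.longest⁻¹) =
          t k S.longest * (x k a * x k b) * t k S.longest⁻¹ := by
        have h1 : t k S.longest⁻¹ * t k S.longest = 1 := by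
          rw [← t_mul, inv_mul_cancel, t_one]
        calc _ = t k S.longest * x k a * (t k S.longest⁻¹ * t k S.longest) * x k b *
              t k S.longest⁻¹ := by simp only [mul_assoc]
          _ = _ := by rw [h1, mul_one]; simp only [mul_assoc]
      rw [← MulOpposite.op_mul, ← MulOpposite.op_mul, h, h, x_comm])
    (fun α v => by
      rw [refl_inv, ← MulOpposite.op_mul, ← MulOpposite.op_mul, ← MulOpposite.op_sub,
        MulOpposite.algebraMap_apply]
      congr 1
      have hu : t k S.longest * t k S.longest⁻¹ = 1 := by rw [← t_mul, mul_inv_cancel, t_one]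
      have hr : refl P (S.opp α) = S.longest⁻¹ * refl P α * S.longest := S.refl_opp α
      have e1 : t k S.longest⁻¹ * t k (refl P α) = t k (refl P (S.opp α)) * t k S.longest⁻¹ := by
        rw [← t_mul, ← t_mul, hr, mul_assoc _ S.longest, mul_inv_cancel, mul_one]
      have e2 : t k (refl P α) * t k S.longest = t k S.longest * t k (refl P (S.opp α)) := by
        rw [← t_mul, ← t_mul, hr, ← mul_assoc, ← mul_assoc, mul_inv_cancel, one_mul]
      have hk : k.val ⟨S.opp α, S.opp_mem α.2⟩ = k.val α := (k.invariant _ _ _ rfl).symm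
      have hc := cross k ⟨S.opp α, S.opp_mem α.2⟩ (- act P S.longest⁻¹ (act P (refl P α) v))
      have e3 : act P (refl P (S.opp α)) (- act P S.longest⁻¹ (act P (refl P α) v)) =
          - act P S.longest⁻¹ v := by
        rw [map_neg, ← act_mul, hr, mul_assoc, mul_inv_cancel, mul_one, act_mul, act_refl_refl]
      simp only [hk, e3, map_neg, S.pair_opp, pair_act_refl, neg_neg] at hc
      rw [mul_neg, map_neg] at hc
      calc _ = t k S.longest * (x k (- act P S.longest⁻¹ v) * t k (refl P (S.opp α)) -
            t k (refl P (S.opp α)) * x k (- act P S.longest⁻¹ (act P (refl P α) v))) *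
              t k S.longest⁻¹ := by
            rw [mul_assoc _ (t k S.longest⁻¹), e1, ← mul_assoc (t k (refl P α)),
              ← mul_assoc (t k (refl P α)), e2]
            simp only [mul_sub, sub_mul, mul_assoc]
        _ = _ := by
            rw [← neg_sub, hc, neg_neg, mul_assoc, Algebra.commutes, ← mul_assoc, hu, one_mul])

end Hecke

section Dual

open ModuleCat

variable {A : Type u} [Ring A] [Algebra ℂ A] (σ : A →ₐ[ℂ] Aᵐᵒᵖ)

/-- The space of `ℂ`-linear functionals on an `A`-module `X`, as the carrier of the dual of `X`
with respect to a linear anti-endomorphism `σ` of `A`. -/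
def Dual (_ : A →ₐ[ℂ] Aᵐᵒᵖ) (X : ModuleCat.{u} A) : Type u := Module.Dual ℂ X

instance (X : ModuleCat.{u} A) : AddCommGroup (Dual σ X) :=
  inferInstanceAs (AddCommGroup (Module.Dual ℂ X))

instance (X : ModuleCat.{u} A) : FunLike (Dual σ X) X ℂ :=
  inferInstanceAs (FunLike (Module.Dual ℂ X) X ℂ)

/-- The action of `a ∈ A` on an `A`-module, as a `ℂ`-linear map. -/
def actBy (X : ModuleCat.{u} A) (a : A) : X →ₗ[ℂ] X where
  toFun y := a • y
  map_add' := smul_add a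
  map_smul' c y := by
    change a • (algebraMap ℂ A c • y) = algebraMap ℂ A c • (a • y)
    rw [smul_smul, smul_smul, Algebra.commutes]

/-- The action `(a • f)(y) = f(σ(a) • y)`. -/
instance (X : ModuleCat.{u} A) : Module A (Dual σ X) where
  smul a f := LinearMap.comp (M₂ := X) (show X →ₗ[ℂ] ℂ from f) (actBy X (σ a).unop)
  one_smul f := LinearMap.ext fun y => by
    change (show X →ₗ[ℂ] ℂ from f) ((σ 1).unop • y) = (show X →ₗ[ℂ] ℂ from f) y
    rw [map_one, MulOpposite.unop_one, one_smul]
  mul_smul a b f := LinearMap.ext fun y => by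
    change (show X →ₗ[ℂ] ℂ from f) ((σ (a * b)).unop • y) =
      (show X →ₗ[ℂ] ℂ from f) ((σ b).unop • (σ a).unop • y)
    rw [map_mul, MulOpposite.unop_mul, mul_smul]
  smul_zero a := LinearMap.ext fun y => rfl
  smul_add a f g := LinearMap.ext fun y => rfl
  add_smul a b f := LinearMap.ext fun y => by
    change (show X →ₗ[ℂ] ℂ from f) ((σ (a + b)).unop • y) =
      (show X →ₗ[ℂ] ℂ from f) ((σ a).unop • y) + (show X →ₗ[ℂ] ℂ from f) ((σ b).unop • y)
    rw [map_add, MulOpposite.unop_add, add_smul, map_add]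
  zero_smul f := LinearMap.ext fun y => by
    change (show X →ₗ[ℂ] ℂ from f) ((σ 0).unop • y) = 0
    rw [map_zero, MulOpposite.unop_zero, zero_smul, map_zero]

/-- A morphism of `A`-modules, as a `ℂ`-linear map. -/
def homC {X Y : ModuleCat.{u} A} (φ : X ⟶ Y) : X →ₗ[ℂ] Y where
  toFun y := φ.hom y
  map_add' := map_add φ.hom
  map_smul' c y := φ.hom.map_smul (algebraMap ℂ A c) y

/-- The contravariant functor sending an `A`-module to its dual with respect to `σ`. -/
def dualFunctor : (ModuleCat.{u} A)ᵒᵖ ⥤ ModuleCat.{u} A where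
  obj X := ModuleCat.of A (Dual σ X.unop)
  map {X Y} φ := ModuleCat.ofHom (X := Dual σ X.unop) (Y := Dual σ Y.unop)
    { toFun := fun f => LinearMap.comp (M₂ := X.unop) (show X.unop →ₗ[ℂ] ℂ from f) (homC φ.unop)
      map_add' := fun _ _ => rfl
      map_smul' := fun a f => LinearMap.ext fun y =>
        congrArg (show X.unop →ₗ[ℂ] ℂ from f) (φ.unop.hom.map_smul (σ a).unop y).symm }
  map_id _ := rfl
  map_comp _ _ := rfl

/-- A linear functional on `X`, as an element of the dual of `X`. -/
def toDual (X : ModuleCat.{u} A) (f : X →ₗ[ℂ] ℂ) : (dualFunctor σ).obj (.op X) := f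

/-- The value of an element of the dual of `X` at an element of `X`. -/
def evalDual {X : ModuleCat.{u} A} (f : (dualFunctor σ).obj (.op X)) (y : X) : ℂ :=
  (show X →ₗ[ℂ] ℂ from f) y

end Dual

section Modules

variable {ι V₀ N : Type u} [Fintype ι] [AddCommGroup V₀] [Module ℝ V₀] [FiniteDimensional ℝ V₀]
  [AddCommGroup N] [Module ℝ N] {P : RootPairing ι ℝ V₀ N} {S : SimpleSystem P}
  (k : Parameter S)

/-- The `*`-dual `X ↦ X^*`. -/
abbrev starDual [P.IsReduced] :
    (ModuleCat.{u} (GradedHeckeAlgebra k))ᵒᵖ ⥤ ModuleCat.{u} (GradedHeckeAlgebra k) :=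
  dualFunctor (star k)

/-- The `•`-dual `X ↦ X^•`. -/
abbrev bulletDual :
    (ModuleCat.{u} (GradedHeckeAlgebra k))ᵒᵖ ⥤ ModuleCat.{u} (GradedHeckeAlgebra k) :=
  dualFunctor (bullet k)

/-- The twist `Y ↦ ι(Y)` by the Iwahori-Matsumoto involution. -/
abbrev imTwist :
    ModuleCat.{u} (GradedHeckeAlgebra k) ⥤ ModuleCat.{u} (GradedHeckeAlgebra k) :=
  ModuleCat.restrictScalars (im k).toRingHom

/-- The functor `Y ↦ ι(Y)^•`. -/
abbrev imBulletDual :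
    (ModuleCat.{u} (GradedHeckeAlgebra k))ᵒᵖ ⥤ ModuleCat.{u} (GradedHeckeAlgebra k) :=
  (imTwist k).op ⋙ bulletDual k

variable {k}

/-- The natural bijection `κ : Y → ι(Y)`. -/
def kappa {Y : ModuleCat.{u} (GradedHeckeAlgebra k)} (y : Y) : (imTwist k).obj Y :=
  show Y from y

end Modules

section Koszul

open ModuleCat

variable {ι V₀ N : Type u} [Fintype ι] [AddCommGroup V₀] [Module ℝ V₀] [FiniteDimensional ℝ V₀]
  [AddCommGroup N] [Module ℝ N] {P : RootPairing ι ℝ V₀ N} {S : SimpleSystem P}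
  {k : Parameter S}

/-- The vector space `ℍ ⊗_ℂ (X ⊗_ℂ ⋀^i V)`. -/
abbrev KoszulPre (X : ModuleCat.{u} (GradedHeckeAlgebra k)) (i : ℕ) : Type u :=
  GradedHeckeAlgebra k ⊗[ℂ] (X ⊗[ℂ] ⋀[ℂ]^i (Cplx V₀))

/-- The `ℍ`-submodule spanned by the elements `t_w ⊗ (y ⊗ ω) - 1 ⊗ (t_w y ⊗ w ω)`. -/
def koszulRel (X : ModuleCat.{u} (GradedHeckeAlgebra k)) (i : ℕ) :
    Submodule (GradedHeckeAlgebra k) (KoszulPre X i) :=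
  Submodule.span _ {z | ∃ (w : P.weylGroup) (y : X) (ω : ⋀[ℂ]^i (Cplx V₀)),
    z = t k w ⊗ₜ[ℂ] (y ⊗ₜ[ℂ] ω) - 1 ⊗ₜ[ℂ] ((t k w • y) ⊗ₜ[ℂ] exteriorPower.map i (act P w) ω)}

/-- The `ℍ`-module `ℍ ⊗_{ℂ[W]} (Res_W X ⊗ ⋀^i V)`. -/
def koszul (X : ModuleCat.{u} (GradedHeckeAlgebra k)) (i : ℕ) :
    ModuleCat.{u} (GradedHeckeAlgebra k) :=
  ModuleCat.of _ (KoszulPre X i ⧸ koszulRel X i)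

/-- The element `h ⊗ (y ⊗ v₁ ∧ ⋯ ∧ v_i)` of `ℍ ⊗_{ℂ[W]} (Res_W X ⊗ ⋀^i V)`. -/
def koszulMk {X : ModuleCat.{u} (GradedHeckeAlgebra k)} {i : ℕ} (h : GradedHeckeAlgebra k)
    (y : X) (v : Fin i → Cplx V₀) : koszul X i :=
  (koszulRel X i).mkQ (h ⊗ₜ[ℂ] (y ⊗ₜ[ℂ] exteriorPower.ιMulti ℂ i v))

/-- The Koszul-type resolution of `X`: a projective resolution with terms
`ℍ ⊗_{ℂ[W]} (Res_W X ⊗ ⋀^i V)`, augmentation `h ⊗ y ↦ h y` and differential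
`h ⊗ (y ⊗ v₀ ∧ ⋯ ∧ v_i) ↦ ∑ⱼ (-1)^j (h vⱼ ⊗ y - h ⊗ vⱼ y) ⊗ v₀ ∧ ⋯ v̂ⱼ ⋯ ∧ v_i`. -/
structure KoszulResolution (X : ModuleCat.{u} (GradedHeckeAlgebra k)) where
  res : ProjectiveResolution X
  iso : ∀ i, res.complex.X i ≅ koszul X i
  augmentation : ∀ (h : GradedHeckeAlgebra k) (y : X) (v : Fin 0 → Cplx V₀),
    (res.π.f 0).hom ((iso 0).inv.hom (koszulMk h y v)) = h • y
  differential : ∀ (i : ℕ) (h : GradedHeckeAlgebra k) (y : X) (v : Fin (i + 1) → Cplx V₀),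
    (iso i).hom.hom ((res.complex.d (i + 1) i).hom ((iso (i + 1)).inv.hom (koszulMk h y v))) =
      ∑ j : Fin (i + 1), (-1 : ℤ) ^ (j : ℕ) •
        (koszulMk (h * x k (v j)) y (v ∘ j.succAbove) -
          koszulMk h (x k (v j) • y) (v ∘ j.succAbove))

/-- The `W`-equivariant cochain `(y, v₁ ∧ ⋯ ∧ v_i) ↦ ψ(1 ⊗ (y ⊗ v₁ ∧ ⋯ ∧ v_i))` that corresponds to
a morphism `ψ` out of the `i`-th term of the Koszul-type resolution (Frobenius reciprocity). -/
def cochain {X Y : ModuleCat.{u} (GradedHeckeAlgebra k)} (K : KoszulResolution X) {i : ℕ}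
    (ψ : K.res.complex.X i ⟶ Y) (y : X) (v : Fin i → Cplx V₀) : Y :=
  ψ.hom ((K.iso i).inv.hom (koszulMk 1 y v))

/-- The pairing of `η ∈ Hom_W(X ⊗ ⋀^i V, Y)` and `η' ∈ Hom_W(X^* ⊗ ⋀^j V, ι(Y)^•)`, `i + j = n`,
given by the pairings `X^* × X → ℂ`, `Y × ι(Y)^• → ℂ` and `⋀^i V × ⋀^j V → ⋀^n V ≅ ℂ`:
in terms of a basis `(b_r)` of `X` with dual basis `(b_r^*)` and of a basis `(e_l)` of `V`, it is
`∑_r ∑_I ± ⟨η(b_r ⊗ e_I), η'(b_r^* ⊗ e_J)⟩`, over all `I ⊆ {1, …, n}` with `i` elements, where `J`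
is the complement of `I` and `e_I ∧ e_J = ± e_1 ∧ ⋯ ∧ e_n`. (Each `I` is counted `i! j!` times in
the sum over permutations.) -/
def cochainPairing [P.IsReduced] {n r i j : ℕ} (hij : i + j = n)
    (e : Module.Basis (Fin n) ℂ (Cplx V₀)) {X Y : ModuleCat.{u} (GradedHeckeAlgebra k)}
    (b : Module.Basis (Fin r) ℂ X)
    (η : X → (Fin i → Cplx V₀) → Y)
    (η' : (starDual k).obj (.op X) → (Fin j → Cplx V₀) → (imBulletDual k).obj (.op Y)) : ℂ :=
  ((i.factorial * j.factorial : ℕ) : ℂ)⁻¹ *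
    ∑ τ : Equiv.Perm (Fin n), ∑ s : Fin r, ((Equiv.Perm.sign τ : ℤ) : ℂ) *
      evalDual (bullet k)
        (η' (toDual (star k) X (b.coord s)) fun m => e (τ (Fin.cast hij (Fin.natAdd i m))))
        (kappa (η (b s) fun m => e (τ (Fin.cast hij (Fin.castAdd j m)))))

end Koszul

end GradedHecke

end

/-!
# Ext duality for graded affine Hecke algebras

Multiplication gives an isomorphism `S(V) ⊗ ℂ[W] ≅ ℍ` (`pbwInv_pbw`, `pbw_polHom_mul`): the algebra
`ℍ` acts on `S(V) ⊗ ℂ[W]` by left multiplications, which are controlled by the commuting right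
multiplications. As a complex of vector spaces, the Koszul-type complex `ℍ ⊗_{ℂ[W]} (X ⊗ ⋀^i V)`
is therefore the Koszul complex of the operators `X_l ⊗ 1 - 1 ⊗ e_l` on `S(V) ⊗ X`. Together with
the de Rham differential these satisfy a Cartan formula (`polyD_polyH_succ`) whose right-hand side,
a deformation of the Euler operator, has positive generalized eigenvalues in positive total
degree; hence
the complex is exact (`koszulD_exact`, `koszulAug_exact`). Its terms are projective, because linear
lifts can be averaged over `W` (`projective_koszul`). So `Ext^i(X, Y)` is the cohomology of the
complex of `W`-equivariant maps `X ⊗ ⋀^i V → Y`, and it vanishes for `i > n`.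

The pairing of cochains (`cochPairing`) is the trace over `X` of the pairing of values
(`valuePairing`), which combines the evaluation pairing of `Y` and `ι(Y)^•` with the wedge product
`⋀^i V × ⋀^j V → ⋀^n V ≅ ℂ`. It is invariant under `W`, as the sign character in `ι` cancels the
determinant of the action on `⋀^n V`, so it stays perfect on equivariant cochains. Up to a sign the
differentials are adjoint to each other (`cochPairing_cochD`). Here `v ∈ V` acts on `X^*` by the
transpose of `-v` plus a combination of reflections `t_{s_γ}` with coefficients proportional to
`⟨v, γ^∨⟩` (`exists_star_x`); the reflection terms drop out, because the reflection `s_γ` fixes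
their contribution and also reverses its sign (`sum_valuePairing_refl`).

In finite dimensions, the coboundaries are then the annihilator of the cocycles of complementary
degree (`exists_cochD_eq_left`, `exists_cochD_eq_right`), so the pairing of cocycles descends to a
non-degenerate pairing of Ext groups (`extPairing`). Its naturality comes from the naturality of the
resolution and of the trace.
-/

noncomputable section

namespace GradedHecke

/-! ### Positive roots and simple reflections -/

section Roots

variable {ι V₀ N : Type u} [Fintype ι] [AddCommGroup V₀] [Module ℝ V₀]
  [AddCommGroup N] [Module ℝ N] {P : RootPairing ι ℝ V₀ N}

/-- A linear functional on `V₀` taking the value `1` on each simple root. -/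
lemma SimpleSystem.exists_height (S : SimpleSystem P) :
    ∃ f : V₀ →ₗ[ℝ] ℝ, ∀ α ∈ S.simple, f (P.root α) = 1 := by
  have hli : LinearIndependent ℝ (fun a : S.simple => P.root a) := S.linearIndepOn
  obtain ⟨g, hg⟩ := (Finsupp.linearCombination ℝ fun a : S.simple =>
    P.root a).exists_leftInverse_of_injective (LinearMap.ker_eq_bot.mpr hli)
  refine ⟨Finsupp.linearCombination ℝ (fun _ => (1 : ℝ)) ∘ₗ g, fun α hα => ?_⟩
  have h := LinearMap.congr_fun hg (Finsupp.single ⟨α, hα⟩ 1)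
  simp only [LinearMap.comp_apply, Finsupp.linearCombination_single, one_smul,
    LinearMap.id_apply] at h
  rw [LinearMap.comp_apply, h, Finsupp.linearCombination_single, one_smul]

/-- A positive root has a positive pairing with some simple coroot. -/
lemma SimpleSystem.exists_pairing_pos (S : SimpleSystem P) {β : ι} (hβ : S.IsPos β) :
    ∃ α ∈ S.simple, 0 < P.pairing β α := by
  obtain ⟨c, hc, hβc, hc0⟩ := hβ
  have hpos : 0 < P.RootForm (P.root β) (P.root β) :=
    P.rootForm_pos_of_ne_zero (Submodule.subset_span ⟨β, rfl⟩) (P.ne_zero β)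
  have hsum : P.RootForm (P.root β) (P.root β) =
      ∑ j, c j * P.RootForm (P.root β) (P.root j) := by
    have h := congrArg (P.RootForm (P.root β)) hβc
    rw [h, map_sum]
    simp only [map_smul, smul_eq_mul]
  rw [hsum] at hpos
  obtain ⟨j, -, hj⟩ := Finset.exists_lt_of_sum_lt (s := Finset.univ) (f := fun _ => (0 : ℝ))
    (by simpa using hpos)
  have hcj : 0 < c j := lt_of_le_of_ne (hc0 j) (by rintro h; rw [← h] at hj; simp at hj)
  refine ⟨j, by by_contra h; rw [hc j h] at hcj; exact lt_irrefl _ hcj, ?_⟩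
  have h1 : 0 < P.RootForm (P.root β) (P.root j) := pos_of_mul_pos_right hj hcj.le
  have h2 := P.toInvariantForm.two_mul_apply_root_root β j
  have h3 : 0 < P.RootForm (P.root j) (P.root j) :=
    P.rootForm_pos_of_ne_zero (Submodule.subset_span ⟨j, rfl⟩) (P.ne_zero j)
  change 2 * P.RootForm (P.root β) (P.root j) = P.pairing β j * P.RootForm (P.root j) (P.root j)
    at h2
  exact pos_of_mul_pos_left (h2 ▸ by positivity) h3.le

/-- The subgroup generated by the simple reflections. -/
def SimpleSystem.simpleSubgroup (S : SimpleSystem P) : Subgroup P.weylGroup :=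
  Subgroup.closure (refl P '' S.simple)

/-- Every positive root is conjugate to a simple root under the group generated by the simple
reflections: a positive root of minimal height in its orbit is simple. -/
lemma SimpleSystem.exists_conj_simple [P.IsReduced] (S : SimpleSystem P) {β : ι}
    (hβ : S.IsPos β) : ∃ w ∈ S.simpleSubgroup, ∃ α ∈ S.simple, perm P w β = α := by
  obtain ⟨f, hf⟩ := S.exists_height
  obtain ⟨γ, ⟨hγ, w, hw, hwγ⟩, hmin⟩ := Set.exists_min_image
    {γ | S.IsPos γ ∧ ∃ w ∈ S.simpleSubgroup, perm P w β = γ} (fun γ => f (P.root γ))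
    (Set.toFinite _) ⟨β, hβ, 1, one_mem _, perm_one β⟩
  refine ⟨w, hw, γ, ?_, hwγ⟩
  by_contra hns
  obtain ⟨α, hα, hpos⟩ := S.exists_pairing_pos hγ
  have hne : γ ≠ α := by rintro rfl; exact hns hα
  have h := hmin (P.reflectionPerm α γ) ⟨S.isPos_reflectionPerm hα hγ hne, refl P α * w,
    mul_mem (Subgroup.subset_closure ⟨α, hα, rfl⟩) hw, by rw [perm_mul, hwγ, perm_refl]⟩
  rw [RootPairing.root_reflectionPerm, RootPairing.reflection_apply_root, map_sub, map_smul,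
    hf α hα] at h
  simp only [smul_eq_mul, mul_one] at h
  linarith

lemma refl_perm (w : P.weylGroup) (i : ι) : refl P (perm P w i) = w * refl P i * w⁻¹ := by
  refine weyl_ext fun v => ?_
  obtain ⟨v, rfl⟩ : ∃ v', v = w • v' := ⟨w⁻¹ • v, by rw [smul_inv_smul]⟩
  rw [mul_smul, mul_smul, inv_smul_smul, refl_smul, refl_smul, coroot_pairing_smul, smul_sub,
    root_perm, smul_lin]

lemma refl_eq_of_neg {i j : ι} (h : P.root j = - P.root i) : refl P j = refl P i := by
  refine weyl_ext fun v => ?_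
  rw [refl_smul, refl_smul, coroot_pairing_neg h, h, neg_smul_neg]

lemma refl_mul_self (i : ι) : refl P i * refl P i = 1 := by
  nth_rewrite 1 [← refl_inv i]
  exact inv_mul_cancel _

lemma SimpleSystem.refl_mem [P.IsReduced] (S : SimpleSystem P) (β : ι) :
    refl P β ∈ S.simpleSubgroup := by
  have key : ∀ β, S.IsPos β → refl P β ∈ S.simpleSubgroup := by
    intro β hβ
    obtain ⟨w, hw, α, hα, h⟩ := S.exists_conj_simple hβ
    have h1 : refl P β = w⁻¹ * refl P α * w := by
      rw [← h, refl_perm]; group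
    rw [h1]
    exact mul_mem (mul_mem (inv_mem hw) (Subgroup.subset_closure ⟨α, hα, rfl⟩)) hw
  by_cases hβ : S.IsPos β
  · exact key β hβ
  · have h := root_reflectionPerm_self (P := P) β
    rw [← refl_eq_of_neg h]
    exact key _ (S.isPos_of_not hβ h)

lemma SimpleSystem.simpleSubgroup_eq_top [P.IsReduced] (S : SimpleSystem P) :
    S.simpleSubgroup = ⊤ := by
  rw [eq_top_iff]
  rintro ⟨w, hw⟩ -
  induction hw using RootPairing.weylGroup.induction with
  | mem i => exact S.refl_mem i
  | one => exact one_mem S.simpleSubgroup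
  | mul x y hx hy h1 h2 => exact mul_mem h1 h2

/-- Induction on elements of `W` as products of simple reflections. -/
lemma SimpleSystem.weyl_induction [P.IsReduced] (S : SimpleSystem P) {p : P.weylGroup → Prop}
    (one : p 1) (mul : ∀ α ∈ S.simple, ∀ w, p w → p (refl P α * w)) (w : P.weylGroup) : p w := by
  have hw : w ∈ Subgroup.closure (refl P '' S.simple) := by
    change w ∈ S.simpleSubgroup
    rw [S.simpleSubgroup_eq_top]; trivial
  induction hw using Subgroup.closure_induction_left with
  | one => exact one
  | mul_left x hx y hy h =>
    obtain ⟨α, hα, rfl⟩ := hx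
    exact mul α hα y h
  | inv_mul_cancel x hx y hy h =>
    obtain ⟨α, hα, rfl⟩ := hx
    rw [refl_inv]
    exact mul α hα y h

lemma smul_sub_mem_rootSpan (w : P.weylGroup) (v : V₀) : w • v - v ∈ P.rootSpan ℝ := by
  obtain ⟨w, hw⟩ := w
  induction hw using RootPairing.weylGroup.induction generalizing v with
  | mem i =>
    change refl P i • v - v ∈ _
    rw [refl_smul, sub_sub_cancel_left]
    exact neg_mem (Submodule.smul_mem _ _ (Submodule.subset_span ⟨i, rfl⟩))
  | one =>
    change (1 : P.weylGroup) • v - v ∈ _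
    rw [one_smul, sub_self]
    exact zero_mem _
  | mul x y hx hy h1 h2 =>
    have h := add_mem (h1 ((⟨y, hy⟩ : P.weylGroup) • v)) (h2 v)
    rw [sub_add_sub_cancel, ← mul_smul] at h
    exact h

/-- The action of `W` on the roots is faithful. -/
lemma perm_injective : Function.Injective (perm P) := by
  have key : ∀ w : P.weylGroup, perm P w = 1 → w = 1 := by
    intro w hw
    refine weyl_ext fun v => ?_
    rw [one_smul, ← sub_eq_zero]
    refine P.eq_zero_of_mem_rootSpan_of_rootForm_self_eq_zero (smul_sub_mem_rootSpan w v) ?_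
    rw [RootPairing.rootForm_apply_apply]
    refine Finset.sum_eq_zero fun i _ => ?_
    have h := coroot_pairing_smul (P := P) w v i
    rw [hw, Equiv.Perm.one_apply] at h
    have : P.coroot' i (w • v - v) = 0 := by
      rw [map_sub, sub_eq_zero]
      exact h
    rw [this, zero_mul]
  intro w w' h
  have := key (w'⁻¹ * w) (Equiv.ext fun i => by
    rw [perm_mul, h, ← perm_mul, inv_mul_cancel, perm_one, Equiv.Perm.one_apply])
  rwa [inv_mul_eq_one, eq_comm] at this

instance : Finite P.weylGroup := Finite.of_injective _ perm_injective

variable {S : SimpleSystem P} (k : Parameter S)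

open Classical in
/-- The `W`-invariant extension of the parameter function `k` to all roots. -/
def Parameter.ext (β : ι) : ℂ :=
  if h : ∃ α : S.simple, ∃ w : P.weylGroup, perm P w α = β then k.val h.choose else 0

lemma Parameter.ext_simple (α : S.simple) : k.ext α = k.val α := by
  have h : ∃ α' : S.simple, ∃ w : P.weylGroup, perm P w α' = α := ⟨α, 1, perm_one _⟩
  rw [Parameter.ext, dif_pos h]
  exact k.invariant _ _ _ h.choose_spec.choose_spec

lemma Parameter.ext_perm (w : P.weylGroup) (β : ι) : k.ext (perm P w β) = k.ext β := by
  unfold Parameter.ext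
  by_cases h : ∃ α : S.simple, ∃ w : P.weylGroup, perm P w α = β
  · have h' : ∃ α : S.simple, ∃ w' : P.weylGroup, perm P w' α = perm P w β := by
      obtain ⟨α, w', h⟩ := h
      exact ⟨α, w * w', by rw [perm_mul, h]⟩
    rw [dif_pos h, dif_pos h']
    obtain ⟨w1, h1⟩ := h.choose_spec
    obtain ⟨w2, h2⟩ := h'.choose_spec
    refine (k.invariant _ _ (w2⁻¹ * (w * w1)) ?_).symm
    rw [perm_mul, perm_mul, h1]
    exact (congrArg _ h2.symm).trans (by rw [← perm_mul, inv_mul_cancel, perm_one])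
  · rw [dif_neg h, dif_neg]
    rintro ⟨α, w', h'⟩
    exact h ⟨α, w⁻¹ * w', by rw [perm_mul, h', ← perm_mul, inv_mul_cancel, perm_one]⟩

lemma pair_act (w : P.weylGroup) (i : ι) (v : Cplx V₀) :
    pair P (perm P w i) (act P w v) = pair P i v := by
  induction v using TensorProduct.induction_on with
  | zero => simp
  | tmul c v => rw [act_tmul, pair_tmul, pair_tmul, coroot_pairing_smul]
  | add a b ha hb => simp only [map_add, ha, hb]

lemma act_refl (i : ι) (v : Cplx V₀) :
    act P (refl P i) v = v - pair P i v • ((1 : ℂ) ⊗ₜ[ℝ] P.root i) := by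
  induction v using TensorProduct.induction_on with
  | zero => simp
  | tmul c v =>
    rw [act_tmul, pair_tmul, refl_smul, TensorProduct.tmul_sub, TensorProduct.tmul_smul,
      TensorProduct.smul_tmul', TensorProduct.smul_tmul', smul_eq_mul, mul_one]
  | add a b ha hb => simp only [map_add, ha, hb, add_smul]; abel

lemma pair_neg {i j : ι} (h : P.root j = - P.root i) (v : Cplx V₀) :
    pair P j v = - pair P i v := by
  induction v using TensorProduct.induction_on with
  | zero => simp
  | tmul c v => rw [pair_tmul, pair_tmul, coroot_pairing_neg h, neg_smul]
  | add a b ha hb => simp only [map_add, ha, hb, neg_add]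

/-- Conjugating `v ∈ V` by `t_w`: the result differs from `w(v)` by a combination of reflections
whose coefficients are multiples of the values of the coroots at `w(v)`. -/
lemma exists_t_mul_x [P.IsReduced] (w : P.weylGroup) : ∃ c : ι → ℂ, ∀ v : Cplx V₀,
    t k w * x k v = (x k (act P w v) +
      ∑ γ, (c γ * pair P γ (act P w v)) • t k (refl P γ)) * t k w := by
  classical
  induction w using S.weyl_induction with
  | one => exact ⟨0, fun v => by simp [t_one, act_one]⟩
  | mul α hα w ih =>
    obtain ⟨c, hc⟩ := ih
    refine ⟨fun γ => c (P.reflectionPerm α γ) - if γ = α then k.val ⟨α, hα⟩ else 0, fun v => ?_⟩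
    have hx : ∀ u, t k (refl P α) * x k u = (x k (act P (refl P α) u) +
        (k.val ⟨α, hα⟩ * pair P α u) • t k (refl P α)) * t k (refl P α) := by
      intro u
      have h := cross k ⟨α, hα⟩ u
      rw [sub_eq_iff_eq_add] at h
      rw [h, add_mul, smul_mul_assoc, ← t_mul, refl_mul_self, t_one, Algebra.algebraMap_eq_smul_one,
        add_comm]
    have ht : ∀ γ, t k (refl P α) * t k (refl P γ) =
        t k (refl P (P.reflectionPerm α γ)) * t k (refl P α) := by
      intro γ
      rw [← t_mul, ← t_mul, ← perm_refl, refl_perm, inv_mul_cancel_right]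
    rw [t_mul, mul_assoc, hc, ← mul_assoc, mul_add, hx, Finset.mul_sum, ← mul_assoc]
    congr 1
    simp only [mul_smul_comm, ht]
    rw [add_mul, add_mul, Finset.sum_mul, add_assoc]
    congr 1
    · rw [act_mul]
    · simp only [sub_mul, sub_smul, Finset.sum_sub_distrib, ite_mul, zero_mul, ite_smul, zero_smul,
        Finset.sum_ite_eq', Finset.mem_univ, if_true, act_mul, pair_act_refl]
      rw [mul_neg, neg_smul, neg_mul, sub_neg_eq_add, add_comm]
      congr 1
      refine Fintype.sum_equiv (P.reflectionPerm α) _ _ fun γ => ?_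
      rw [← perm_refl, pair_act, perm_refl, RootPairing.reflectionPerm_self, smul_mul_assoc]

end Roots

/-! ### The Poincaré–Birkhoff–Witt theorem -/

section Polynomial

variable {ι V₀ N : Type u} [Fintype ι] [AddCommGroup V₀] [Module ℝ V₀]
  [AddCommGroup N] [Module ℝ N] {P : RootPairing ι ℝ V₀ N}
  {n : ℕ} (e : Module.Basis (Fin n) ℂ (Cplx V₀))

/-- The inclusion of `V` into `S(V)`, where `S(V)` is the polynomial ring on a basis of `V`. -/
def lin : Cplx V₀ →ₗ[ℂ] MvPolynomial (Fin n) ℂ := e.constr ℂ MvPolynomial.X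

@[simp] lemma lin_basis (l : Fin n) : lin e (e l) = MvPolynomial.X l := e.constr_basis _ _ _

/-- The action of `w ∈ W` on `S(V)`. -/
def actPol (w : P.weylGroup) : MvPolynomial (Fin n) ℂ →ₐ[ℂ] MvPolynomial (Fin n) ℂ :=
  MvPolynomial.aeval fun l => lin e (act P w (e l))

lemma actPol_lin (w : P.weylGroup) (v : Cplx V₀) :
    actPol e w (lin e v) = lin e (act P w v) := by
  have : (actPol e w).toLinearMap ∘ₗ lin e = lin e ∘ₗ act P w :=
    e.ext fun l => by simp [actPol]
  exact LinearMap.congr_fun this v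

lemma lin_injective : Function.Injective (lin e) := by
  have : LinearIndependent ℂ (MvPolynomial.X : Fin n → MvPolynomial (Fin n) ℂ) :=
    MvPolynomial.linearIndependent_X _ _
  intro v v' h
  refine e.repr.injective (this ?_)
  simpa only [lin, Module.Basis.constr_apply, Finsupp.linearCombination_apply] using h

lemma lin_root_ne_zero (α : ι) : lin e ((1 : ℂ) ⊗ₜ[ℝ] P.root α) ≠ 0 := by
  intro h
  have h1 : (1 : ℂ) ⊗ₜ[ℝ] P.root α = 0 := lin_injective e (h.trans (map_zero _).symm)
  have h2 := pair_tmul (P := P) α 1 (P.root α)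
  rw [h1, map_zero, RootPairing.root_coroot_two] at h2
  norm_num at h2

/-- `s_α` is trivial modulo `α` on `V`, hence on `S(V)`. -/
lemma exists_demazure (α : ι) (p : MvPolynomial (Fin n) ℂ) :
    ∃ q, p - actPol e (refl P α) p = lin e ((1 : ℂ) ⊗ₜ[ℝ] P.root α) * q := by
  induction p using MvPolynomial.induction_on with
  | C a => exact ⟨0, by rw [← MvPolynomial.algebraMap_eq, AlgHom.commutes]; simp⟩
  | add p q hp hq =>
    obtain ⟨p', hp⟩ := hp
    obtain ⟨q', hq⟩ := hq
    exact ⟨p' + q', by rw [map_add, mul_add, ← hp, ← hq]; ring⟩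
  | mul_X p l hp =>
    obtain ⟨p', hp⟩ := hp
    refine ⟨p' * MvPolynomial.X l + actPol e (refl P α) p * MvPolynomial.C (pair P α (e l)), ?_⟩
    have hX : actPol e (refl P α) (MvPolynomial.X l) = MvPolynomial.X l -
        MvPolynomial.C (pair P α (e l)) * lin e ((1 : ℂ) ⊗ₜ[ℝ] P.root α) := by
      rw [← lin_basis e l, actPol_lin, act_refl, map_sub, map_smul, MvPolynomial.smul_eq_C_mul]
    rw [map_mul, hX, mul_add, ← mul_assoc, ← hp]
    ring

/-- The Demazure operator `p ↦ (p - s_α(p)) / α` on `S(V)`. -/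
def demazure (P : RootPairing ι ℝ V₀ N) (α : ι) :
    MvPolynomial (Fin n) ℂ →ₗ[ℂ] MvPolynomial (Fin n) ℂ where
  toFun p := (exists_demazure (P := P) e α p).choose
  map_add' p q := mul_left_cancel₀ (lin_root_ne_zero (P := P) e α) (by
    rw [mul_add, ← (exists_demazure e α p).choose_spec, ← (exists_demazure e α q).choose_spec,
      ← (exists_demazure e α (p + q)).choose_spec, map_add]
    ring)
  map_smul' c p := mul_left_cancel₀ (lin_root_ne_zero (P := P) e α) (by
    rw [RingHom.id_apply, mul_smul_comm, ← (exists_demazure e α (c • p)).choose_spec,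
      ← (exists_demazure e α p).choose_spec, map_smul, smul_sub])

lemma demazure_spec (α : ι) (p : MvPolynomial (Fin n) ℂ) :
    p - actPol e (refl P α) p = lin e ((1 : ℂ) ⊗ₜ[ℝ] P.root α) * demazure e P α p :=
  (exists_demazure (P := P) e α p).choose_spec

/-- The twisted Leibniz rule for Demazure operators. -/
lemma demazure_mul (α : ι) (p q : MvPolynomial (Fin n) ℂ) :
    demazure e P α (p * q) = demazure e P α p * q + actPol e (refl P α) p * demazure e P α q := by
  refine mul_left_cancel₀ (lin_root_ne_zero (P := P) e α) ?_
  have h1 := demazure_spec (P := P) e α p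
  have h2 := demazure_spec (P := P) e α q
  rw [← demazure_spec, map_mul, mul_add, ← mul_assoc, ← h1, mul_left_comm, ← h2]
  ring

lemma demazure_C (α : ι) (a : ℂ) : demazure e P α (MvPolynomial.C a) = 0 := by
  refine mul_left_cancel₀ (lin_root_ne_zero (P := P) e α) ?_
  rw [← demazure_spec, ← MvPolynomial.algebraMap_eq, AlgHom.commutes, sub_self, mul_zero]

lemma demazure_lin (α : ι) (v : Cplx V₀) :
    demazure e P α (lin e v) = MvPolynomial.C (pair P α v) := by
  refine mul_left_cancel₀ (lin_root_ne_zero (P := P) e α) ?_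
  rw [← demazure_spec, actPol_lin, act_refl, map_sub, map_smul, MvPolynomial.smul_eq_C_mul]
  ring

end Polynomial

section PBW

variable {ι V₀ N : Type u} [Fintype ι] [AddCommGroup V₀] [Module ℝ V₀]
  [AddCommGroup N] [Module ℝ N] {P : RootPairing ι ℝ V₀ N} {S : SimpleSystem P}
  (k : Parameter S) {n : ℕ} (e : Module.Basis (Fin n) ℂ (Cplx V₀))

/-- The vector space `S(V) ⊗ ℂ[W]`; `Finsupp.single w p` stands for `p ⊗ w`. -/
abbrev PBWSpace (P : RootPairing ι ℝ V₀ N) (n : ℕ) : Type u :=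
  P.weylGroup →₀ MvPolynomial (Fin n) ℂ

/-- Left multiplication by the simple reflection `s_α`:
`p ⊗ w ↦ s_α(p) ⊗ s_α w + k_α Δ_α(p) ⊗ w`. -/
def leftRefl (α : S.simple) : PBWSpace P n →ₗ[ℂ] PBWSpace P n :=
  Finsupp.lsum ℂ fun w => Finsupp.lsingle (refl P α * w) ∘ₗ (actPol e (refl P α)).toLinearMap +
    k.val α • (Finsupp.lsingle w ∘ₗ demazure e P α)

lemma leftRefl_single (α : S.simple) (w : P.weylGroup) (p : MvPolynomial (Fin n) ℂ) :
    leftRefl k e α (Finsupp.single w p) =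
      Finsupp.single (refl P α * w) (actPol e (refl P α) p) +
        k.val α • Finsupp.single w (demazure e P α p) := by
  simp [leftRefl]

/-- Left multiplication by `v ∈ V`. -/
def leftVec (P : RootPairing ι ℝ V₀ N) (v : Cplx V₀) : PBWSpace P n →ₗ[ℂ] PBWSpace P n :=
  Finsupp.lsum ℂ fun w => Finsupp.lsingle w ∘ₗ LinearMap.mulLeft ℂ (lin e v)

lemma leftVec_single (v : Cplx V₀) (w : P.weylGroup) (p : MvPolynomial (Fin n) ℂ) :
    leftVec e P v (Finsupp.single w p) = Finsupp.single w (lin e v * p) := by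
  simp [leftVec]

/-- Right multiplication by `w' ∈ W`. -/
def rightWeyl (n : ℕ) (w' : P.weylGroup) : PBWSpace P n →ₗ[ℂ] PBWSpace P n :=
  Finsupp.lsum ℂ fun w => Finsupp.lsingle (w * w')

lemma rightWeyl_single (w' w : P.weylGroup) (p : MvPolynomial (Fin n) ℂ) :
    rightWeyl n w' (Finsupp.single w p) = Finsupp.single (w * w') p := by
  simp [rightWeyl]

open Classical in
/-- The coefficient of `w s_β` in `w v - w(v) w`; it vanishes unless `β` is an inversion of `w`. -/
def crossCoeff (w : P.weylGroup) (v : Cplx V₀) (β : ι) : ℂ :=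
  if S.IsPos β ∧ ¬ S.IsPos (perm P w β) then k.ext β * pair P β v else 0

/-- Right multiplication by `v ∈ V`:
`p ⊗ w ↦ p w(v) ⊗ w + ∑_β k_β ⟨v, β^∨⟩ p ⊗ w s_β`, over the inversions `β` of `w`. -/
def rightVec (v : Cplx V₀) : PBWSpace P n →ₗ[ℂ] PBWSpace P n :=
  Finsupp.lsum ℂ fun w => Finsupp.lsingle w ∘ₗ LinearMap.mulLeft ℂ (lin e (act P w v)) +
    ∑ β, crossCoeff k w v β • Finsupp.lsingle (w * refl P β)

lemma rightVec_single (v : Cplx V₀) (w : P.weylGroup) (p : MvPolynomial (Fin n) ℂ) :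
    rightVec k e v (Finsupp.single w p) = Finsupp.single w (lin e (act P w v) * p) +
      ∑ β, crossCoeff k w v β • Finsupp.single (w * refl P β) p := by
  simp [rightVec, LinearMap.sum_apply]

/-- The inversions of `s_α w` are those of `w`, up to adding or removing `± w⁻¹ α`. -/
lemma sum_crossCoeff [P.IsReduced] {E : Type*} [AddCommGroup E] [Module ℂ E] (α : S.simple)
    (w : P.weylGroup) (v : Cplx V₀) (f : P.weylGroup → E) :
    ∑ β, crossCoeff k (refl P α * w) v β • f (refl P α * w * refl P β) =
      ∑ β, crossCoeff k w v β • f (refl P α * w * refl P β) +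
        (k.val α * pair P α (act P w v)) • f w := by
  classical
  set β₀ := perm P w⁻¹ α with hβ₀
  have hwβ₀ : perm P w β₀ = α := by rw [hβ₀, ← perm_mul, mul_inv_cancel, perm_one]
  set β₁ := P.reflectionPerm β₀ β₀ with hβ₁
  have hr1 : P.root β₁ = - P.root β₀ := root_reflectionPerm_self _
  have hwβ₁ : perm P w β₁ = P.reflectionPerm α α := by
    apply P.root.injective
    rw [root_perm, hr1, smul_neg, ← root_perm, hwβ₀, root_reflectionPerm_self]
  have hα := S.isPos_simple α.2
  have hnα : ¬ S.IsPos (P.reflectionPerm α α) :=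
    S.not_isPos_of_neg hα (root_reflectionPerm_self _)
  have hs (β) : perm P (refl P α * w) β = P.reflectionPerm α (perm P w β) := by
    rw [perm_mul, perm_refl]
  have hk : k.ext β₀ * pair P β₀ v = k.val α * pair P α (act P w v) := by
    rw [← k.ext_simple, ← k.ext_perm w β₀, hwβ₀, ← hwβ₀, pair_act]
  have hw0 : refl P α * w * refl P β₀ = w := by
    rw [← hwβ₀, refl_perm, inv_mul_cancel_right, mul_assoc, refl_mul_self, mul_one]
  have hw1 : refl P α * w * refl P β₁ = w := by
    rw [refl_eq_of_neg hr1, hw0]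
  -- away from `± w⁻¹ α` the coefficients agree
  have hother (β) (h0 : β ≠ β₀) (h1 : β ≠ β₁) :
      crossCoeff k (refl P α * w) v β = crossCoeff k w v β := by
    have hne : perm P w β ≠ α := fun h => h0 ((perm P w).injective (h.trans hwβ₀.symm))
    have hne' : P.reflectionPerm α (perm P w β) ≠ α := fun h => h1 ((perm P w).injective (by
      have h' := congrArg (P.reflectionPerm α) h
      rw [RootPairing.reflectionPerm_self] at h'
      exact h'.trans hwβ₁.symm))
    have : S.IsPos (P.reflectionPerm α (perm P w β)) ↔ S.IsPos (perm P w β) :=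
      ⟨fun h => by simpa using S.isPos_reflectionPerm α.2 h hne',
        fun h => S.isPos_reflectionPerm α.2 h hne⟩
    simp only [crossCoeff, hs, this]
  have h01 : β₀ ≠ β₁ := by
    intro h
    by_cases hp : S.IsPos β₀
    · exact S.not_isPos_of_neg hp hr1 (h ▸ hp)
    · exact hp (h ▸ S.isPos_of_not hp hr1)
  rw [← sub_eq_iff_eq_add', ← Finset.sum_sub_distrib, ← Finset.sum_subset
    (Finset.subset_univ {β₀, β₁}) (fun β _ hβ => ?_), Finset.sum_pair h01, hw0, hw1,
    ← sub_smul, ← sub_smul, ← add_smul]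
  · congr 1
    unfold crossCoeff
    rw [hs, hs, hwβ₀, hwβ₁, RootPairing.reflectionPerm_self]
    by_cases hp : S.IsPos β₀
    · have := S.not_isPos_of_neg hp hr1
      simp [hp, this, hα, hnα, hk]
    · have := S.isPos_of_not hp hr1
      have h3 : k.ext β₁ = k.ext β₀ := by rw [hβ₁, ← perm_refl, k.ext_perm]
      simp [hp, this, hα, hnα, ← hk, pair_neg hr1, h3]
  · simp only [Finset.mem_insert, Finset.mem_singleton, not_or] at hβ
    rw [hother β hβ.1 hβ.2, sub_self]

/-- Left multiplication by a simple reflection commutes with right multiplication by `V`. This is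
where the twisted Leibniz rule and the change of the set of inversions enter. -/
lemma leftRefl_rightVec [P.IsReduced] (α : S.simple) (v : Cplx V₀) (z : PBWSpace P n) :
    leftRefl k e α (rightVec k e v z) = rightVec k e v (leftRefl k e α z) := by
  induction z using Finsupp.induction_linear with
  | zero => simp
  | add a b ha hb => simp only [map_add, ha, hb]
  | single w p =>
    rw [rightVec_single, map_add, leftRefl_single, leftRefl_single, map_add, map_smul,
      rightVec_single, rightVec_single, map_sum, sum_crossCoeff k α w v
      (fun w' => Finsupp.single w' (actPol e (refl P α) p)), mul_comm (lin e (act P w v)) p,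
      demazure_mul, demazure_lin, map_mul, actPol_lin, ← act_mul]
    simp only [map_smul, leftRefl_single, smul_add, Finset.sum_add_distrib, Finset.smul_sum,
      Finsupp.single_add, mul_smul]
    simp only [smul_comm (k.val α) (crossCoeff k w v _)]
    have h1 : Finsupp.single w (actPol e (refl P α) p * MvPolynomial.C (pair P α (act P w v))) =
      (pair P α (act P w v)) • Finsupp.single w (actPol e (refl P α) p) := by
      rw [Finsupp.smul_single, MvPolynomial.smul_eq_C_mul, mul_comm]
    have hsum : ∀ a b c d f : PBWSpace P n, a + (c + b) + (d + f) = a + (d + b) + (c + f) := by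
      intros; abel
    rw [← h1, mul_comm (lin e _) (actPol e _ _), mul_comm (lin e _) (demazure e P _ _)]
    exact hsum _ _ _ _ _

lemma leftRefl_rightWeyl (α : S.simple) (w' : P.weylGroup) (z : PBWSpace P n) :
    leftRefl k e α (rightWeyl n w' z) = rightWeyl n w' (leftRefl k e α z) := by
  induction z using Finsupp.induction_linear with
  | zero => simp
  | add a b ha hb => simp only [map_add, ha, hb]
  | single w p => simp only [rightWeyl_single, leftRefl_single, map_add, map_smul, mul_assoc]

/-- `1 ⊗ 1` generates `S(V) ⊗ ℂ[W]` under the right multiplications. -/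
lemma eq_zero_of_commutes {φ : PBWSpace P n →ₗ[ℂ] PBWSpace P n}
    (hv : ∀ v z, φ (rightVec k e v z) = rightVec k e v (φ z))
    (hw : ∀ w z, φ (rightWeyl n w z) = rightWeyl n w (φ z)) (h1 : φ (Finsupp.single 1 1) = 0) :
    φ = 0 := by
  have h2 (p) : φ (Finsupp.single 1 p) = 0 := by
    induction p using MvPolynomial.induction_on with
    | C a =>
      rw [← mul_one (MvPolynomial.C a), ← MvPolynomial.smul_eq_C_mul, ← Finsupp.smul_single,
        map_smul, h1, smul_zero]
    | add p q hp hq => rw [Finsupp.single_add, map_add, hp, hq, add_zero]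
    | mul_X p l hp =>
      have h := hv (e l) (Finsupp.single 1 p)
      rw [hp, map_zero, rightVec_single, act_one, lin_basis, Finset.sum_eq_zero, add_zero] at h
      · rwa [mul_comm]
      · intro β _
        have : crossCoeff k 1 (e l) β = 0 := if_neg (by rw [perm_one]; tauto)
        rw [this, zero_smul]
  refine Finsupp.lhom_ext fun w p => ?_
  have h := hw w (Finsupp.single 1 p)
  rw [rightWeyl_single, one_mul, h2, map_zero] at h
  rw [h, LinearMap.zero_apply]

/-- Left multiplication by `t_w` exists as a product of left multiplications by simple reflections.
It depends only on `w`, because an operator that commutes with the right multiplications is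
determined by its value at `1 ⊗ 1`; so no braid relations need to be verified. -/
lemma exists_leftWeyl [P.IsReduced] (w : P.weylGroup) :
    ∃ φ : PBWSpace P n →ₗ[ℂ] PBWSpace P n, (∀ v z, φ (rightVec k e v z) = rightVec k e v (φ z)) ∧
      (∀ w z, φ (rightWeyl n w z) = rightWeyl n w (φ z)) ∧
      φ (Finsupp.single 1 1) = Finsupp.single w 1 := by
  induction w using S.weyl_induction with
  | one => exact ⟨LinearMap.id, fun _ _ => rfl, fun _ _ => rfl, rfl⟩
  | mul α hα w ih =>
    obtain ⟨φ, h1, h2, h3⟩ := ih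
    refine ⟨leftRefl k e ⟨α, hα⟩ ∘ₗ φ, fun v z => ?_, fun w z => ?_, ?_⟩
    · rw [LinearMap.comp_apply, h1, leftRefl_rightVec, LinearMap.comp_apply]
    · rw [LinearMap.comp_apply, h2, leftRefl_rightWeyl, LinearMap.comp_apply]
    · rw [LinearMap.comp_apply, h3, leftRefl_single, map_one]
      have := demazure_C (P := P) e α 1
      rw [MvPolynomial.C_1] at this
      simp [this]

/-- Left multiplication by `t_w` on `S(V) ⊗ ℂ[W]`. -/
def leftWeyl [P.IsReduced] (w : P.weylGroup) : PBWSpace P n →ₗ[ℂ] PBWSpace P n :=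
  (exists_leftWeyl k e w).choose

section leftWeyl

variable [P.IsReduced]

lemma leftWeyl_rightVec (w : P.weylGroup) (v : Cplx V₀) (z : PBWSpace P n) :
    leftWeyl k e w (rightVec k e v z) = rightVec k e v (leftWeyl k e w z) :=
  (exists_leftWeyl k e w).choose_spec.1 v z

lemma leftWeyl_rightWeyl (w w' : P.weylGroup) (z : PBWSpace P n) :
    leftWeyl k e w (rightWeyl n w' z) = rightWeyl n w' (leftWeyl k e w z) :=
  (exists_leftWeyl k e w).choose_spec.2.1 w' z

lemma leftWeyl_one_one (w : P.weylGroup) :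
    leftWeyl k e w (Finsupp.single 1 1) = Finsupp.single w 1 :=
  (exists_leftWeyl k e w).choose_spec.2.2

lemma leftWeyl_unique {w : P.weylGroup} {φ : PBWSpace P n →ₗ[ℂ] PBWSpace P n}
    (hv : ∀ v z, φ (rightVec k e v z) = rightVec k e v (φ z))
    (hw : ∀ w z, φ (rightWeyl n w z) = rightWeyl n w (φ z))
    (h1 : φ (Finsupp.single 1 1) = Finsupp.single w 1) : leftWeyl k e w = φ := by
  rw [← sub_eq_zero]
  refine eq_zero_of_commutes k e (fun v z => ?_) (fun w z => ?_) ?_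
  · simp only [LinearMap.sub_apply, leftWeyl_rightVec, hv, map_sub]
  · simp only [LinearMap.sub_apply, leftWeyl_rightWeyl, hw, map_sub]
  · rw [LinearMap.sub_apply, leftWeyl_one_one, h1, sub_self]

lemma leftWeyl_refl (α : S.simple) : leftWeyl k e (refl P α) = leftRefl (n := n) k e α := by
  refine leftWeyl_unique k e (leftRefl_rightVec k e α) (leftRefl_rightWeyl k e α) ?_
  rw [leftRefl_single, map_one]
  have := demazure_C (P := P) e α 1
  rw [MvPolynomial.C_1] at this
  simp [this]

/-- The representation of `ℍ` on `S(V) ⊗ ℂ[W]` by left multiplications. -/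
def pbwRep : GradedHeckeAlgebra k →ₐ[ℂ] Module.End ℂ (PBWSpace P n) :=
  lift k (leftWeyl k e) (leftVec e P)
    (leftWeyl_unique k e (fun _ _ => rfl) (fun _ _ => rfl) rfl)
    (fun w w' => leftWeyl_unique k e
      (fun v z => by simp only [Module.End.mul_apply, leftWeyl_rightVec])
      (fun v z => by simp only [Module.End.mul_apply, leftWeyl_rightWeyl])
      (by
        rw [Module.End.mul_apply, leftWeyl_one_one, ← one_mul w', ← rightWeyl_single,
          leftWeyl_rightWeyl, leftWeyl_one_one, rightWeyl_single, one_mul]))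
    (fun v v' => Finsupp.lhom_ext fun w p => by
      simp only [leftVec_single, LinearMap.add_apply, map_add, add_mul, Finsupp.single_add])
    (fun c v => Finsupp.lhom_ext fun w p => by
      simp only [leftVec_single, LinearMap.smul_apply, map_smul, smul_mul_assoc,
        Finsupp.smul_single])
    (fun v v' => Finsupp.lhom_ext fun w p => by
      simp only [leftVec_single, Module.End.mul_apply, mul_left_comm])
    (fun α v => Finsupp.lhom_ext fun w p => by
      simp only [leftWeyl_refl, LinearMap.sub_apply, Module.End.mul_apply, leftVec_single,
        leftRefl_single, map_add, map_smul, demazure_mul, demazure_lin, map_mul, actPol_lin,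
        Finsupp.single_add, smul_add, Module.algebraMap_end_apply]
      rw [add_sub_add_left_eq_sub, add_sub_cancel_right, ← MvPolynomial.smul_eq_C_mul,
        ← Finsupp.smul_single, smul_smul, mul_comm (k.val α), mul_smul])

/-- The coordinates of `h ∈ ℍ` with respect to the decomposition `ℍ = S(V) ⊗ ℂ[W]`. -/
def pbw : GradedHeckeAlgebra k →ₗ[ℂ] PBWSpace P n :=
  LinearMap.applyₗ (Finsupp.single 1 1) ∘ₗ (pbwRep k e).toLinearMap

lemma pbw_apply (h : GradedHeckeAlgebra k) :
    pbw k e h = pbwRep k e h (Finsupp.single 1 1) := rfl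

lemma pbwRep_t (w : P.weylGroup) : pbwRep k e (t k w) = leftWeyl k e w := lift_t ..

lemma pbwRep_x (v : Cplx V₀) : pbwRep k e (x k v) = leftVec e P v := lift_x ..

/-- Induction on the elements of `ℍ`. -/
lemma hecke_induction {p : GradedHeckeAlgebra k → Prop} (ht : ∀ w, p (t k w))
    (hx : ∀ v, p (x k v)) (hc : ∀ c : ℂ, p (algebraMap ℂ _ c))
    (hadd : ∀ a b, p a → p b → p (a + b)) (hmul : ∀ a b, p a → p b → p (a * b))
    (h : GradedHeckeAlgebra k) : p h := by
  obtain ⟨f, rfl⟩ := RingQuot.mkAlgHom_surjective ℂ (Rel k) h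
  induction f using FreeAlgebra.induction with
  | grade0 c => rw [AlgHom.commutes]; exact hc c
  | grade1 s =>
    cases s with
    | inl w => exact ht w
    | inr v => exact hx v
  | mul a b ha hb => rw [map_mul]; exact hmul _ _ ha hb
  | add a b ha hb => rw [map_add]; exact hadd _ _ ha hb

lemma pbwRep_rightWeyl (h : GradedHeckeAlgebra k) (w : P.weylGroup) (z : PBWSpace P n) :
    pbwRep k e h (rightWeyl n w z) = rightWeyl n w (pbwRep k e h z) := by
  induction h using hecke_induction generalizing z with
  | ht w => rw [pbwRep_t, leftWeyl_rightWeyl]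
  | hx v =>
    rw [pbwRep_x]
    induction z using Finsupp.induction_linear with
    | zero => simp
    | add a b ha hb => simp only [map_add, ha, hb]
    | single w p => simp only [rightWeyl_single, leftVec_single]
  | hc c => simp only [AlgHom.commutes, Module.algebraMap_end_apply, map_smul]
  | hadd a b ha hb => simp only [map_add, LinearMap.add_apply, ha, hb]
  | hmul a b ha hb => simp only [map_mul, Module.End.mul_apply, ha, hb]

lemma pbw_mul_t (h : GradedHeckeAlgebra k) (w : P.weylGroup) :
    pbw (n := n) k e (h * t k w) = rightWeyl n w (pbw k e h) := by
  rw [pbw_apply, map_mul, Module.End.mul_apply, pbwRep_t, leftWeyl_one_one, ← one_mul w,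
    ← rightWeyl_single, pbwRep_rightWeyl, one_mul, pbw_apply]

lemma pbw_x_mul (v : Cplx V₀) (h : GradedHeckeAlgebra k) :
    pbw (n := n) k e (x k v * h) = leftVec e P v (pbw k e h) := by
  rw [pbw_apply, map_mul, Module.End.mul_apply, pbwRep_x, pbw_apply]

end leftWeyl

/-- The subalgebra of `ℍ` generated by `V`. -/
def vecSubalgebra : Subalgebra ℂ (GradedHeckeAlgebra k) := Algebra.adjoin ℂ (Set.range (x k))

instance : IsMulCommutative (vecSubalgebra k) :=
  Algebra.isMulCommutative_adjoin ℂ (by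
    rintro _ ⟨v, rfl⟩ _ ⟨v', rfl⟩
    exact x_comm k v v')

open scoped IsMulCommutative in
/-- The homomorphism `S(V) → ℍ`. -/
def polHom : MvPolynomial (Fin n) ℂ →ₐ[ℂ] GradedHeckeAlgebra k :=
  (vecSubalgebra k).val.comp
    (MvPolynomial.aeval fun l => ⟨x k (e l), Algebra.subset_adjoin ⟨e l, rfl⟩⟩)

open scoped IsMulCommutative in
lemma polHom_X (l : Fin n) : polHom k e (MvPolynomial.X l) = x k (e l) := by
  simp [polHom]

/-- The map `x` as a linear map. -/
def xLin : Cplx V₀ →ₗ[ℂ] GradedHeckeAlgebra k where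
  toFun := x k
  map_add' := x_add k
  map_smul' := x_smul k

lemma xLin_apply (v : Cplx V₀) : xLin k v = x k v := rfl

lemma polHom_lin (v : Cplx V₀) : polHom k e (lin e v) = x k v := by
  have : (polHom k e).toLinearMap ∘ₗ lin e = xLin k :=
    e.ext fun l => by simp [polHom_X, xLin_apply]
  exact LinearMap.congr_fun this v

/-- The commutation relation between `t_{s_α}` and `S(V)`. -/
lemma t_mul_polHom (α : S.simple) (p : MvPolynomial (Fin n) ℂ) :
    t k (refl P α) * polHom k e p = polHom k e (actPol e (refl P α) p) * t k (refl P α) +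
      k.val α • polHom k e (demazure e P α p) := by
  induction p using MvPolynomial.induction_on with
  | C a =>
    rw [demazure_C, map_zero, smul_zero, add_zero, ← MvPolynomial.algebraMap_eq, AlgHom.commutes,
      AlgHom.commutes, AlgHom.commutes, Algebra.commutes]
  | add p q hp hq => simp only [map_add, mul_add, add_mul, hp, hq, smul_add]; abel
  | mul_X p l hp =>
    have h := cross k α (e l)
    rw [sub_eq_iff_eq_add] at h
    have hX : actPol e (refl P α) (MvPolynomial.X l) = lin e (act P (refl P α) (e l)) := by
      rw [← actPol_lin, lin_basis]
    have hD : demazure e P α (MvPolynomial.X l) = MvPolynomial.C (pair P α (e l)) := by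
      rw [← demazure_lin, lin_basis]
    have hC : ∀ a, polHom k e (MvPolynomial.C a) = algebraMap ℂ _ a := fun a => by
      rw [← MvPolynomial.algebraMap_eq, AlgHom.commutes]
    rw [map_mul, ← mul_assoc, hp, polHom_X, add_mul, mul_assoc, h, demazure_mul]
    simp only [map_add, map_mul (polHom k e), map_mul (actPol e _), hX, hD, polHom_lin, polHom_X,
      hC, Algebra.algebraMap_eq_smul_one, mul_add, smul_add, smul_mul_assoc, mul_smul_comm,
      mul_one, mul_assoc, mul_smul]
    abel

/-- The inverse of `pbw`: `p ⊗ w ↦ p t_w`. -/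
def pbwInv : PBWSpace P n →ₗ[ℂ] GradedHeckeAlgebra k :=
  Finsupp.lsum ℂ fun w => LinearMap.mulRight ℂ (t k w) ∘ₗ (polHom k e).toLinearMap

lemma pbwInv_single (w : P.weylGroup) (p : MvPolynomial (Fin n) ℂ) :
    pbwInv k e (Finsupp.single w p) = polHom k e p * t k w := by
  simp [pbwInv]

variable [P.IsReduced]

lemma pbwInv_pbwRep (h : GradedHeckeAlgebra k) (z : PBWSpace P n) :
    pbwInv k e (pbwRep k e h z) = h * pbwInv k e z := by
  induction h using hecke_induction generalizing z with
  | ht w =>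
    rw [pbwRep_t, ← pbwRep_t]
    induction w using S.weyl_induction generalizing z with
    | one => rw [t_one, map_one, Module.End.one_apply, one_mul]
    | mul α hα w ih =>
      rw [t_mul, map_mul, Module.End.mul_apply, mul_assoc, ← ih]
      generalize pbwRep k e (t k w) z = y
      rw [pbwRep_t]
      change pbwInv k e (leftWeyl k e (refl P ((⟨α, hα⟩ : S.simple) : ι)) y) = _
      rw [leftWeyl_refl]
      induction y using Finsupp.induction_linear with
      | zero => simp
      | add a b ha hb => simp only [map_add, ha, hb, mul_add]
      | single w p =>
        rw [leftRefl_single, map_add, map_smul, pbwInv_single, pbwInv_single, pbwInv_single,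
          t_mul, ← mul_assoc, ← mul_assoc, t_mul_polHom k e ⟨α, hα⟩, add_mul, smul_mul_assoc]
  | hx v =>
    rw [pbwRep_x]
    induction z using Finsupp.induction_linear with
    | zero => simp
    | add a b ha hb => simp only [map_add, ha, hb, mul_add]
    | single w p => simp only [leftVec_single, pbwInv_single, map_mul, polHom_lin, mul_assoc]
  | hc c => simp only [AlgHom.commutes, Module.algebraMap_end_apply, map_smul, Algebra.smul_def]
  | hadd a b ha hb => simp only [map_add, LinearMap.add_apply, ha, hb, add_mul]
  | hmul a b ha hb => simp only [map_mul, Module.End.mul_apply, ha, hb, mul_assoc]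

/-- Together with `pbw_polHom_mul` and `pbw_mul_t`, this is the theorem of Poincaré–Birkhoff–Witt
type: the elements `p t_w` give a decomposition `ℍ = S(V) ⊗ ℂ[W]`. -/
lemma pbwInv_pbw (h : GradedHeckeAlgebra k) : pbwInv (n := n) k e (pbw k e h) = h := by
  rw [pbw_apply, pbwInv_pbwRep, pbwInv_single, map_one, t_one, mul_one, mul_one]

lemma pbw_polHom_mul (p : MvPolynomial (Fin n) ℂ) (h : GradedHeckeAlgebra k) :
    pbw k e (polHom k e p * h) = p • pbw (n := n) k e h := by
  induction p using MvPolynomial.induction_on generalizing h with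
  | C a =>
    rw [← MvPolynomial.algebraMap_eq, AlgHom.commutes, algebraMap_smul, ← Algebra.smul_def,
      map_smul]
  | add p q hp hq => rw [map_add, add_mul, map_add, hp, hq, add_smul]
  | mul_X p l hp =>
    rw [map_mul (polHom k e), mul_assoc, hp, polHom_X, pbw_x_mul, mul_smul]
    congr 1
    generalize pbw k e h = z
    induction z using Finsupp.induction_linear with
    | zero => simp
    | add a b ha hb => simp only [map_add, ha, hb, smul_add]
    | single w p => simp only [leftVec_single, Finsupp.smul_single, smul_eq_mul, lin_basis]

lemma pbw_polHom (p : MvPolynomial (Fin n) ℂ) :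
    pbw k e (polHom k e p) = Finsupp.single 1 p := by
  rw [← mul_one (polHom k e p), pbw_polHom_mul, pbw_apply, map_one, Module.End.one_apply,
    Finsupp.smul_single, smul_eq_mul, mul_one]

end PBW

/-! ### Contractions on exterior powers -/

section Exterior

open CliffordAlgebra

variable {R V V' : Type*} [CommRing R] [AddCommGroup V] [Module R V] [AddCommGroup V'] [Module R V']

lemma contractLeft_ιMulti_succ (φ : Module.Dual R V) (i : ℕ) (v : Fin (i + 1) → V) :
    contractLeft (Q := (0 : QuadraticForm R V)) φ (ExteriorAlgebra.ιMulti R (i + 1) v) =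
      ∑ j : Fin (i + 1), ((-1 : ℤ) ^ (j : ℕ) • φ (v j)) •
        ExteriorAlgebra.ιMulti R i (v ∘ j.succAbove) := by
  induction i with
  | zero =>
    rw [ExteriorAlgebra.ιMulti_succ_apply]
    erw [contractLeft_ι_mul]
    simp [contractLeft_one]
  | succ i ih =>
    rw [ExteriorAlgebra.ιMulti_succ_apply]
    erw [contractLeft_ι_mul]
    rw [ih, Fin.sum_univ_succ (n := i + 1), Finset.mul_sum, sub_eq_add_neg,
      ← Finset.sum_neg_distrib]
    congr 1
    · simp only [Fin.val_zero, pow_zero, one_smul]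
      rfl
    · refine Finset.sum_congr rfl fun j _ => ?_
      have h : ExteriorAlgebra.ιMulti R (i + 1) (v ∘ j.succ.succAbove) =
          ExteriorAlgebra.ι R (v 0) *
            ExteriorAlgebra.ιMulti R i (Matrix.vecTail v ∘ j.succAbove) := by
        rw [ExteriorAlgebra.ιMulti_succ_apply]
        congr 2
        funext l
        simp [Matrix.vecTail]
      rw [h, mul_smul_comm, Fin.val_succ, pow_succ, mul_neg_one, neg_smul, neg_smul]
      rfl

lemma contractLeft_mem (φ : Module.Dual R V) (i : ℕ) (ω : ExteriorAlgebra R V)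
    (hω : ω ∈ ⋀[R]^(i + 1) V) :
    contractLeft (Q := (0 : QuadraticForm R V)) φ ω ∈ ⋀[R]^i V := by
  rw [← exteriorPower.ιMulti_span_fixedDegree] at hω
  induction hω using Submodule.span_induction with
  | mem _ h =>
    obtain ⟨v, rfl⟩ := h
    rw [contractLeft_ιMulti_succ]
    exact sum_mem fun j _ => Submodule.smul_mem _ _
      (ExteriorAlgebra.ιMulti_range R i (Set.mem_range_self _))
  | zero => rw [map_zero]; exact zero_mem _
  | add a b _ _ ha hb => rw [map_add]; exact add_mem ha hb
  | smul c a _ ha => rw [map_smul]; exact Submodule.smul_mem _ _ ha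

/-- Contraction of an exterior power by a linear form. -/
def contr (φ : Module.Dual R V) (i : ℕ) : ⋀[R]^(i + 1) V →ₗ[R] ⋀[R]^i V :=
  (contractLeft (Q := (0 : QuadraticForm R V)) φ).restrict (contractLeft_mem φ i)

lemma coe_contr (φ : Module.Dual R V) (i : ℕ) (ω : ⋀[R]^(i + 1) V) :
    (contr φ i ω : ExteriorAlgebra R V) =
      contractLeft (Q := (0 : QuadraticForm R V)) φ (ω : ExteriorAlgebra R V) := rfl

/-- Left exterior multiplication by a vector. -/
def wedge (v : V) (i : ℕ) : ⋀[R]^i V →ₗ[R] ⋀[R]^(i + 1) V :=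
  (LinearMap.mulLeft R (ExteriorAlgebra.ι R v)).restrict fun ω hω => by
    change _ ∈ LinearMap.range (ExteriorAlgebra.ι R) ^ (i + 1)
    rw [pow_succ']
    exact Submodule.mul_mem_mul ⟨v, rfl⟩ hω

lemma contr_wedge (φ : Module.Dual R V) (v : V) (i : ℕ) (ω : ⋀[R]^(i + 1) V) :
    contr φ (i + 1) (wedge v (i + 1) ω) = φ v • ω - wedge v i (contr φ i ω) :=
  Subtype.ext (contractLeft_ι_mul φ v (ω : ExteriorAlgebra R V))

lemma contr_wedge_zero (φ : Module.Dual R V) (v : V) (ω : ⋀[R]^0 V) :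
    contr φ 0 (wedge v 0 ω) = φ v • ω := by
  refine Subtype.ext ((contractLeft_ι_mul φ v (ω : ExteriorAlgebra R V)).trans ?_)
  obtain ⟨r, hr⟩ := Submodule.mem_one.mp ((pow_zero (LinearMap.range (ExteriorAlgebra.ι R))).le ω.2)
  have h : contractLeft (Q := (0 : QuadraticForm R V)) φ (ω : ExteriorAlgebra R V) = 0 := by
    rw [← hr]
    exact contractLeft_algebraMap (Q := (0 : QuadraticForm R V)) (d := φ) r
  rw [h, mul_zero, sub_zero]
  rfl

lemma contr_contr (φ ψ : Module.Dual R V) (i : ℕ) (ω : ⋀[R]^(i + 1 + 1) V) :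
    contr φ i (contr ψ (i + 1) ω) = - contr ψ i (contr φ (i + 1) ω) :=
  Subtype.ext (contractLeft_comm φ ψ (ω : ExteriorAlgebra R V))

lemma contr_ιMulti (φ : Module.Dual R V) (i : ℕ) (v : Fin (i + 1) → V) :
    contr φ i (exteriorPower.ιMulti R (i + 1) v) =
      ∑ j : Fin (i + 1), ((-1 : ℤ) ^ (j : ℕ) • φ (v j)) •
        exteriorPower.ιMulti R i (v ∘ j.succAbove) := by
  refine Subtype.ext ((contractLeft_ιMulti_succ φ i v).trans ?_)
  rw [Submodule.coe_sum]
  rfl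

lemma exteriorPower_induction {i : ℕ} {p : ⋀[R]^i V → Prop}
    (mk : ∀ v, p (exteriorPower.ιMulti R i v)) (hz : p 0) (ha : ∀ a b, p a → p b → p (a + b))
    (hs : ∀ (c : R) a, p a → p (c • a)) (ω : ⋀[R]^i V) : p ω := by
  have hω : ω ∈ Submodule.span R (Set.range (exteriorPower.ιMulti R i)) := by
    rw [exteriorPower.ιMulti_span]; trivial
  induction hω using Submodule.span_induction with
  | mem _ h' => obtain ⟨v, rfl⟩ := h'; exact mk v
  | zero => exact hz
  | add a b _ _ ha' hb => exact ha _ _ ha' hb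
  | smul c a _ ha' => exact hs _ _ ha'

lemma map_contr (f : V →ₗ[R] V') (φ : Module.Dual R V') (i : ℕ) (ω : ⋀[R]^(i + 1) V) :
    exteriorPower.map i f (contr (φ ∘ₗ f) i ω) = contr φ i (exteriorPower.map (i + 1) f ω) := by
  induction ω using exteriorPower_induction with
  | mk v =>
    rw [contr_ιMulti, exteriorPower.map_apply_ιMulti, contr_ιMulti, map_sum]
    refine Finset.sum_congr rfl fun j _ => ?_
    rw [map_smul, exteriorPower.map_apply_ιMulti]
    rfl
  | hz => simp
  | ha a b ha hb => simp only [map_add, ha, hb]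
  | hs c a ha => simp only [map_smul, ha]

lemma contr_sum_smul {κ : Type*} [Fintype κ] (c : κ → R) (φ : κ → Module.Dual R V) (i : ℕ)
    (ω : ⋀[R]^(i + 1) V) : contr (∑ l, c l • φ l) i ω = ∑ l, c l • contr (φ l) i ω := by
  refine Subtype.ext ?_
  rw [coe_contr, Submodule.coe_sum, map_sum, LinearMap.sum_apply]
  refine Finset.sum_congr rfl fun l _ => ?_
  rw [map_smul, LinearMap.smul_apply, Submodule.coe_smul, coe_contr]

lemma sum_contr_coord {κ : Type*} [Fintype κ] (e : Module.Basis κ R V) (φ : Module.Dual R V)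
    (i : ℕ) (ω : ⋀[R]^(i + 1) V) : ∑ l, φ (e l) • contr (e.coord l) i ω = contr φ i ω := by
  rw [← contr_sum_smul]
  congr 2
  refine (e.ext fun m => ?_ : (∑ l, φ (e l) • e.coord l : Module.Dual R V) = φ)
  classical
  simp

/-- The comultiplication `⋀^{i+1} V → V ⊗ ⋀^i V`, in terms of a basis `e` of `V`, followed by a
bilinear map `B` and evaluated on decomposable elements. -/
lemma sum_contr_ιMulti {κ E : Type*} [Fintype κ] [AddCommGroup E] [Module R E]
    (e : Module.Basis κ R V) (i : ℕ) (B : V →ₗ[R] ⋀[R]^i V →ₗ[R] E) (v : Fin (i + 1) → V) :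
    ∑ l, B (e l) (contr (e.coord l) i (exteriorPower.ιMulti R (i + 1) v)) =
      ∑ j : Fin (i + 1), (-1 : ℤ) ^ (j : ℕ) •
        B (v j) (exteriorPower.ιMulti R i (v ∘ j.succAbove)) := by
  simp only [contr_ιMulti, map_sum, map_smul]
  rw [Finset.sum_comm]
  refine Finset.sum_congr rfl fun j _ => ?_
  conv_rhs => rw [← e.sum_repr (v j), map_sum, LinearMap.sum_apply, Finset.smul_sum]
  refine Finset.sum_congr rfl fun l _ => ?_
  rw [map_smul, LinearMap.smul_apply, smul_assoc, Module.Basis.coord_apply]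

/-- Naturality of the comultiplication `⋀^{i+1} V → V ⊗ ⋀^i V`. -/
lemma sum_map_contr {κ E : Type*} [Fintype κ] [AddCommGroup E] [Module R E]
    (e : Module.Basis κ R V) (i : ℕ) (B : V →ₗ[R] ⋀[R]^i V →ₗ[R] E) (f : V →ₗ[R] V)
    (ω : ⋀[R]^(i + 1) V) :
    ∑ l, B (f (e l)) (exteriorPower.map i f (contr (e.coord l) i ω)) =
      ∑ l, B (e l) (contr (e.coord l) i (exteriorPower.map (i + 1) f ω)) := by
  induction ω using exteriorPower_induction with
  | mk v =>
    rw [exteriorPower.map_apply_ιMulti, sum_contr_ιMulti]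
    have h := sum_contr_ιMulti e i ((B ∘ₗ f).compl₂ (exteriorPower.map i f)) v
    simp only [LinearMap.compl₂_apply, LinearMap.comp_apply,
      exteriorPower.map_apply_ιMulti] at h
    exact h
  | hz => simp
  | ha a b ha hb => simp only [map_add, Finset.sum_add_distrib, ha, hb]
  | hs c a ha => simp only [map_smul, ← Finset.smul_sum, ha]

/-- The Euler identity `∑ₗ eₗ ∧ ι(eₗ^*) ω = deg(ω) ω`. -/
lemma sum_wedge_contr {κ : Type*} [Fintype κ] (e : Module.Basis κ R V) (i : ℕ)
    (ω : ⋀[R]^(i + 1) V) :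
    ∑ l, wedge (e l) i (contr (e.coord l) i ω) = (i + 1) • ω := by
  have key : ∀ (i : ℕ) (v : Fin i → V), ∑ l, ExteriorAlgebra.ι R (e l) *
      contractLeft (Q := (0 : QuadraticForm R V)) (e.coord l) (ExteriorAlgebra.ιMulti R i v) =
        i • ExteriorAlgebra.ιMulti R i v := by
    intro i
    induction i with
    | zero =>
      intro v
      simp only [ExteriorAlgebra.ιMulti_zero_apply, zero_smul]
      refine Finset.sum_eq_zero fun l _ => ?_
      erw [contractLeft_one]
      rw [mul_zero]
    | succ i ih =>
      intro v
      rw [ExteriorAlgebra.ιMulti_succ_apply]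
      set b := ExteriorAlgebra.ιMulti R i (Matrix.vecTail v)
      have h : ∀ l, ExteriorAlgebra.ι R (e l) * contractLeft (Q := (0 : QuadraticForm R V))
          (e.coord l) (ExteriorAlgebra.ι R (v 0) * b) = ExteriorAlgebra.ι R (e.coord l (v 0) • e l)
            * b + ExteriorAlgebra.ι R (v 0) * (ExteriorAlgebra.ι R (e l) *
              contractLeft (Q := (0 : QuadraticForm R V)) (e.coord l) b) := by
        intro l
        erw [contractLeft_ι_mul]
        rw [mul_sub, sub_eq_add_neg, map_smul, mul_smul_comm, smul_mul_assoc]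
        congr 1
        have h := ExteriorAlgebra.ι_add_mul_swap (R := R) (e l) (v 0)
        rw [add_eq_zero_iff_eq_neg] at h
        erw [← mul_assoc, ← mul_assoc, h, neg_mul, neg_neg]
      simp only [h]
      rw [Finset.sum_add_distrib, ← Finset.sum_mul, ← Finset.mul_sum, ih, ← map_sum]
      have h2 : ∑ l, e.coord l (v 0) • e l = v 0 := e.sum_repr (v 0)
      rw [h2, add_smul, one_smul, mul_smul_comm, add_comm]
  induction ω using exteriorPower_induction with
  | mk v =>
    refine Subtype.ext ?_
    rw [Submodule.coe_sum]
    exact key (i + 1) v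
  | hz => simp
  | ha a b ha hb => simp only [map_add, Finset.sum_add_distrib, ha, hb, smul_add]
  | hs c a ha => simp only [map_smul, ← Finset.smul_sum, ha]; rw [smul_comm]

/-- The action on exterior powers of a transvection-like map `v ↦ v - φ(v) γ`. -/
lemma coe_map_sub (φ : Module.Dual R V) (γ : V) (s : V →ₗ[R] V)
    (hs : ∀ v, s v = v - φ v • γ) (i : ℕ) (ω : ⋀[R]^i V) :
    (exteriorPower.map i s ω : ExteriorAlgebra R V) = (ω : ExteriorAlgebra R V) -
      ExteriorAlgebra.ι R γ *
        contractLeft (Q := (0 : QuadraticForm R V)) φ (ω : ExteriorAlgebra R V) := by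
  have key : ∀ (i : ℕ) (v : Fin i → V), ExteriorAlgebra.ιMulti R i (s ∘ v) =
      ExteriorAlgebra.ιMulti R i v - ExteriorAlgebra.ι R γ *
        contractLeft (Q := (0 : QuadraticForm R V)) φ (ExteriorAlgebra.ιMulti R i v) := by
    intro i
    induction i with
    | zero =>
      intro v
      simp only [ExteriorAlgebra.ιMulti_zero_apply]
      erw [contractLeft_one]
      rw [mul_zero, sub_zero]
    | succ i ih =>
      intro v
      rw [ExteriorAlgebra.ιMulti_succ_apply, ExteriorAlgebra.ιMulti_succ_apply]
      have ht : Matrix.vecTail (s ∘ v) = s ∘ Matrix.vecTail v := rfl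
      rw [ht, ih, Function.comp_apply, hs, map_sub, map_smul]
      set b := ExteriorAlgebra.ιMulti R i (Matrix.vecTail v)
      erw [contractLeft_ι_mul]
      have h := ExteriorAlgebra.ι_add_mul_swap (R := R) γ (v 0)
      rw [add_eq_zero_iff_eq_neg] at h
      have h2 := ExteriorAlgebra.ι_sq_zero (R := R) γ
      set c := contractLeft (Q := (0 : QuadraticForm R V)) φ b
      change (ExteriorAlgebra.ι R (v 0) - φ (v 0) • ExteriorAlgebra.ι R γ) *
        (b - ExteriorAlgebra.ι R γ * c) = ExteriorAlgebra.ι R (v 0) * b -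
          ExteriorAlgebra.ι R γ * (φ (v 0) • b - ExteriorAlgebra.ι R (v 0) * c)
      rw [mul_sub, mul_sub, ← mul_assoc (ExteriorAlgebra.ι R γ), h, sub_mul, sub_mul,
        smul_mul_assoc, smul_mul_assoc, ← mul_assoc (ExteriorAlgebra.ι R γ), h2, zero_mul,
        smul_zero, sub_zero, mul_smul_comm, neg_mul, mul_assoc]
      abel
  induction ω using exteriorPower_induction with
  | mk v =>
    rw [exteriorPower.map_apply_ιMulti]
    exact key i v
  | hz => simp
  | ha a b ha hb => simp only [map_add, Submodule.coe_add, ha, hb, mul_add]; abel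
  | hs c a ha => simp only [map_smul, Submodule.coe_smul, ha, smul_sub, mul_smul_comm]

/-- The reflection `v ↦ v - φ(v) γ` fixes all contractions by `φ`. -/
lemma map_sub_contr (φ : Module.Dual R V) (γ : V) (s : V →ₗ[R] V)
    (hs : ∀ v, s v = v - φ v • γ) (i : ℕ) (ω : ⋀[R]^(i + 1) V) :
    exteriorPower.map i s (contr φ i ω) = contr φ i ω := by
  refine Subtype.ext ?_
  rw [coe_map_sub φ γ s hs, coe_contr, contractLeft_contractLeft, mul_zero, sub_zero]

end Exterior

/-! ### The Koszul-type complex -/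

section KoszulComplex

open ModuleCat

variable {ι V₀ N : Type u} [Fintype ι] [AddCommGroup V₀] [Module ℝ V₀] [FiniteDimensional ℝ V₀]
  [AddCommGroup N] [Module ℝ N] {P : RootPairing ι ℝ V₀ N} {S : SimpleSystem P}
  {k : Parameter S}

/-- The element `h ⊗ (y ⊗ ω)` of `ℍ ⊗_{ℂ[W]} (X ⊗ ⋀^i V)`. -/
def kmk {X : ModuleCat.{u} (GradedHeckeAlgebra k)} {i : ℕ} (h : GradedHeckeAlgebra k)
    (y : X) (ω : ⋀[ℂ]^i (Cplx V₀)) : koszul X i :=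
  (koszulRel X i).mkQ (h ⊗ₜ[ℂ] (y ⊗ₜ[ℂ] ω))

section kmk

variable {X : ModuleCat.{u} (GradedHeckeAlgebra k)} {i : ℕ}

lemma koszulMk_eq (h : GradedHeckeAlgebra k) (y : X) (v : Fin i → Cplx V₀) :
    koszulMk h y v = kmk h y (exteriorPower.ιMulti ℂ i v) := rfl

lemma mkQ_smul (c : ℂ) (z : KoszulPre X i) :
    (koszulRel X i).mkQ (c • z) = c • ((koszulRel X i).mkQ z : koszul X i) := by
  rw [← algebraMap_smul (GradedHeckeAlgebra k) c z, map_smul]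
  rfl

lemma kmk_add_left (h h' : GradedHeckeAlgebra k) (y : X) (ω : ⋀[ℂ]^i (Cplx V₀)) :
    kmk (h + h') y ω = kmk h y ω + kmk h' y ω := by
  unfold kmk; rw [TensorProduct.add_tmul, map_add]; rfl

lemma kmk_smul_left (c : ℂ) (h : GradedHeckeAlgebra k) (y : X) (ω : ⋀[ℂ]^i (Cplx V₀)) :
    kmk (c • h) y ω = c • kmk h y ω := by
  unfold kmk; rw [← TensorProduct.smul_tmul']; exact mkQ_smul c _

lemma kmk_add_mid (h : GradedHeckeAlgebra k) (y y' : X) (ω : ⋀[ℂ]^i (Cplx V₀)) :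
    kmk h (y + y') ω = kmk h y ω + kmk h y' ω := by
  unfold kmk; rw [TensorProduct.add_tmul, TensorProduct.tmul_add, map_add]; rfl

lemma kmk_smul_mid (c : ℂ) (h : GradedHeckeAlgebra k) (y : X) (ω : ⋀[ℂ]^i (Cplx V₀)) :
    kmk h (c • y) ω = c • kmk h y ω := by
  unfold kmk; rw [← TensorProduct.smul_tmul', TensorProduct.tmul_smul]; exact mkQ_smul c _

lemma kmk_add_right (h : GradedHeckeAlgebra k) (y : X) (ω ω' : ⋀[ℂ]^i (Cplx V₀)) :
    kmk h y (ω + ω') = kmk h y ω + kmk h y ω' := by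
  unfold kmk; rw [TensorProduct.tmul_add, TensorProduct.tmul_add, map_add]; rfl

lemma kmk_smul_right (c : ℂ) (h : GradedHeckeAlgebra k) (y : X) (ω : ⋀[ℂ]^i (Cplx V₀)) :
    kmk h y (c • ω) = c • kmk h y ω := by
  unfold kmk; rw [TensorProduct.tmul_smul, TensorProduct.tmul_smul]; exact mkQ_smul c _

/-- `(h, y, ω) ↦ h ⊗ (y ⊗ ω)` as a trilinear map. -/
def kmkLin (X : ModuleCat.{u} (GradedHeckeAlgebra k)) (i : ℕ) :
    GradedHeckeAlgebra k →ₗ[ℂ] X →ₗ[ℂ] ⋀[ℂ]^i (Cplx V₀) →ₗ[ℂ] koszul X i where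
  toFun h := LinearMap.mk₂ ℂ (kmk h) (kmk_add_mid h) (fun c => kmk_smul_mid c h)
    (kmk_add_right h) (fun c => kmk_smul_right c h)
  map_add' h h' := LinearMap.ext fun y => LinearMap.ext fun ω => kmk_add_left h h' y ω
  map_smul' c h := LinearMap.ext fun y => LinearMap.ext fun ω => kmk_smul_left c h y ω

lemma kmkLin_apply (h : GradedHeckeAlgebra k) (y : X) (ω : ⋀[ℂ]^i (Cplx V₀)) :
    kmkLin X i h y ω = kmk h y ω := rfl

lemma smul_kmk (a h : GradedHeckeAlgebra k) (y : X) (ω : ⋀[ℂ]^i (Cplx V₀)) :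
    a • kmk h y ω = kmk (a * h) y ω := rfl

lemma kmk_mul_t (h : GradedHeckeAlgebra k) (w : P.weylGroup) (y : X) (ω : ⋀[ℂ]^i (Cplx V₀)) :
    kmk (h * t k w) y ω = kmk h (t k w • y) (exteriorPower.map i (act P w) ω) := by
  have h1 : kmk (t k w) y ω = kmk 1 (t k w • y) (exteriorPower.map i (act P w) ω) := by
    have := (Submodule.Quotient.mk_eq_zero (koszulRel X i)).mpr
      (Submodule.subset_span ⟨w, y, ω, rfl⟩)
    rw [Submodule.Quotient.mk_sub, sub_eq_zero] at this
    exact this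
  rw [← smul_kmk, h1, smul_kmk, mul_one]

lemma koszul_induction {p : koszul X i → Prop} (h0 : p 0) (hadd : ∀ a b, p a → p b → p (a + b))
    (hmk : ∀ h y ω, p (kmk h y ω)) (z : koszul X i) : p z := by
  obtain ⟨z, rfl⟩ := (koszulRel X i).mkQ_surjective z
  induction z using TensorProduct.induction_on with
  | zero => rw [map_zero]; exact h0
  | add a b ha hb => rw [map_add]; exact hadd _ _ ha hb
  | tmul h m =>
    induction m using TensorProduct.induction_on with
    | zero => rw [TensorProduct.tmul_zero, map_zero]; exact h0
    | add a b ha hb => rw [TensorProduct.tmul_add, map_add]; exact hadd _ _ ha hb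
    | tmul y ω => exact hmk h y ω

/-- The elements `1 ⊗ (y ⊗ v₁ ∧ ⋯ ∧ v_i)` generate `ℍ ⊗_{ℂ[W]} (X ⊗ ⋀^i V)`. -/
lemma koszul_hom_ext {Y : ModuleCat.{u} (GradedHeckeAlgebra k)} {f g : koszul X i ⟶ Y}
    (hfg : ∀ y v, f.hom (koszulMk 1 y v) = g.hom (koszulMk 1 y v)) : f = g := by
  refine ModuleCat.hom_ext (LinearMap.ext fun z => ?_)
  induction z using koszul_induction with
  | h0 => rw [map_zero, map_zero]
  | hadd a b ha hb => rw [map_add, map_add, ha, hb]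
  | hmk h y ω =>
    rw [← mul_one h, ← smul_kmk, map_smul, map_smul]
    congr 1
    induction ω using exteriorPower_induction with
    | mk v => exact hfg y v
    | hz =>
      have : kmk (1 : GradedHeckeAlgebra k) y (0 : ⋀[ℂ]^i (Cplx V₀)) = 0 := by
        simpa using kmk_smul_right 0 1 y (0 : ⋀[ℂ]^i (Cplx V₀))
      rw [this, map_zero, map_zero]
    | ha a b ha hb => rw [kmk_add_right, map_add, map_add, ha, hb]
    | hs c a ha =>
      rw [kmk_smul_right]
      exact (f.hom.map_smul (algebraMap ℂ _ c) _).trans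
        ((congrArg _ ha).trans (g.hom.map_smul (algebraMap ℂ _ c) _).symm)

end kmk

section Frobenius

lemma act_comp (w w' : P.weylGroup) : act P w ∘ₗ act P w' = act P (w * w') :=
  LinearMap.ext fun v => (act_mul w w' v).symm

lemma map_act_mul (i : ℕ) (w w' : P.weylGroup) (ω : ⋀[ℂ]^i (Cplx V₀)) :
    exteriorPower.map i (act P (w * w')) ω =
      exteriorPower.map i (act P w) (exteriorPower.map i (act P w') ω) := by
  rw [← act_comp, exteriorPower.map_comp]
  rfl

lemma map_act_one (i : ℕ) (ω : ⋀[ℂ]^i (Cplx V₀)) : exteriorPower.map i (act P 1) ω = ω := by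
  have : act P 1 = LinearMap.id := LinearMap.ext fun v => act_one v
  rw [this, exteriorPower.map_id]
  rfl

variable (X Y : ModuleCat.{u} (GradedHeckeAlgebra k)) (i : ℕ)

/-- The space of `ℂ`-linear maps `X ⊗ ⋀^i V → Y`, in curried form. -/
abbrev Coch : Type u := X →ₗ[ℂ] ⋀[ℂ]^i (Cplx V₀) →ₗ[ℂ] Y

variable {X Y i} in
/-- `W`-equivariance of a linear map `X ⊗ ⋀^i V → Y`. -/
def IsEquivariant (η : Coch X Y i) : Prop :=
  ∀ (w : P.weylGroup) y ω,
    η (t k w • y) (exteriorPower.map i (act P w) ω) = t k w • η y ω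

variable {Y}

/-- Frobenius reciprocity: the morphism out of `ℍ ⊗_{ℂ[W]} (X ⊗ ⋀^i V)` given by a `W`-equivariant
map out of `X ⊗ ⋀^i V`. -/
def kdesc (g : Coch X Y i) (hg : IsEquivariant g) :
    koszul X i ⟶ Y :=
  ModuleCat.ofHom <| (koszulRel X i).liftQ
    (TensorProduct.AlgebraTensorModule.lift
      (LinearMap.toSpanSingleton (GradedHeckeAlgebra k) _ (TensorProduct.lift g))) (by
    rw [koszulRel, Submodule.span_le]
    rintro _ ⟨w, y, ω, rfl⟩
    rw [SetLike.mem_coe, LinearMap.mem_ker, map_sub, sub_eq_zero]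
    exact (hg w y ω).symm.trans (one_smul _ _).symm)

variable {X i}

lemma kdesc_kmk (g : Coch X Y i) (hg : IsEquivariant g)
    (h : GradedHeckeAlgebra k) (y : X) (ω : ⋀[ℂ]^i (Cplx V₀)) :
    (kdesc X i g hg).hom (kmk h y ω) = h • g y ω := rfl

end Frobenius

section Differential

variable [P.IsReduced] {n : ℕ} (e : Module.Basis (Fin n) ℂ (Cplx V₀))
  (X : ModuleCat.{u} (GradedHeckeAlgebra k)) (i : ℕ)

/-- `(v, ω) ↦ h v ⊗ (y ⊗ ω) - h ⊗ (v y ⊗ ω)` as a bilinear map. -/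
def koszulStep {X : ModuleCat.{u} (GradedHeckeAlgebra k)} (h : GradedHeckeAlgebra k) (y : X) :
    Cplx V₀ →ₗ[ℂ] ⋀[ℂ]^i (Cplx V₀) →ₗ[ℂ] koszul X i :=
  LinearMap.mk₂ ℂ (fun v ω => kmk (h * x k v) y ω - kmk h (x k v • y) ω)
    (fun v v' ω => by
      rw [x_add, mul_add, kmk_add_left, add_smul, kmk_add_mid]; abel)
    (fun c v ω => by
      rw [x_smul, mul_smul_comm, kmk_smul_left, smul_assoc, kmk_smul_mid, smul_sub])
    (fun v ω ω' => by rw [kmk_add_right, kmk_add_right]; abel)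
    (fun c v ω => by rw [kmk_smul_right, kmk_smul_right, smul_sub])

variable {X i} in
lemma koszulStep_apply (h : GradedHeckeAlgebra k) (y : X) (v : Cplx V₀) (ω : ⋀[ℂ]^i (Cplx V₀)) :
    koszulStep i h y v ω = kmk (h * x k v) y ω - kmk h (x k v • y) ω := rfl

/-- The value of the differential on `1 ⊗ (y ⊗ ω)`. -/
def koszulDiffLin : X →ₗ[ℂ] ⋀[ℂ]^(i + 1) (Cplx V₀) →ₗ[ℂ] koszul X i :=
  LinearMap.mk₂ ℂ (fun y ω => ∑ l, koszulStep i 1 y (e l) (contr (e.coord l) i ω))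
    (fun y y' ω => by
      rw [← Finset.sum_add_distrib]
      refine Finset.sum_congr rfl fun l _ => ?_
      simp only [koszulStep_apply, smul_add, kmk_add_mid]; abel)
    (fun c y ω => by
      rw [Finset.smul_sum]
      refine Finset.sum_congr rfl fun l _ => ?_
      have h : x k (e l) • c • y = c • x k (e l) • y := (actBy X (x k (e l))).map_smul c y
      rw [koszulStep_apply, koszulStep_apply, smul_sub, h, kmk_smul_mid, kmk_smul_mid])
    (fun y ω ω' => by simp only [map_add, Finset.sum_add_distrib])
    (fun c y ω => by simp only [map_smul, Finset.smul_sum])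

variable {X i} in
lemma koszulDiffLin_apply (y : X) (ω : ⋀[ℂ]^(i + 1) (Cplx V₀)) :
    koszulDiffLin e X i y ω = ∑ l, koszulStep i 1 y (e l) (contr (e.coord l) i ω) := rfl

lemma map_refl_contr (γ : ι) (ω : ⋀[ℂ]^(i + 1) (Cplx V₀)) :
    exteriorPower.map i (act P (refl P γ)) (contr (pair P γ) i ω) = contr (pair P γ) i ω :=
  map_sub_contr _ _ _ (act_refl γ) i ω

/-- The differential is well defined over `ℂ[W]`: the reflection terms arising from `t_w v` in
`h v ⊗ y` and in `h ⊗ v y` cancel, because a contraction by `γ^∨` is fixed by `s_γ`. -/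
lemma koszulDiffLin_equivariant : IsEquivariant (koszulDiffLin e X i) := by
  intro w y ω
  obtain ⟨c, hc⟩ := exists_t_mul_x k w
  rw [koszulDiffLin_apply, koszulDiffLin_apply, ← sum_map_contr, Finset.smul_sum, ← sub_eq_zero,
    ← Finset.sum_sub_distrib]
  -- move `t_w`, and then the reflections, across the tensor sign
  have hA : ∀ (v : Cplx V₀) (η : ⋀[ℂ]^i (Cplx V₀)), kmk (t k w * x k v) y η =
      kmk (x k (act P w v)) (t k w • y) (exteriorPower.map i (act P w) η) +
        ∑ γ, (c γ * pair P γ (act P w v)) • kmk 1 (t k (refl P γ) • t k w • y)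
          (exteriorPower.map i (act P (refl P γ)) (exteriorPower.map i (act P w) η)) := by
    intro v η
    rw [hc, kmk_mul_t, kmk_add_left, ← kmkLin_apply (∑ γ, _), map_sum, LinearMap.sum_apply,
      LinearMap.sum_apply]
    congr 1
    refine Finset.sum_congr rfl fun γ _ => ?_
    rw [kmkLin_apply, kmk_smul_left, ← one_mul (t k (refl P γ)), kmk_mul_t, one_mul]
  have hB : ∀ (v : Cplx V₀) (η : ⋀[ℂ]^i (Cplx V₀)), kmk (t k w) (x k v • y) η =
      kmk 1 (x k (act P w v) • t k w • y) (exteriorPower.map i (act P w) η) +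
        ∑ γ, (c γ * pair P γ (act P w v)) • kmk 1 (t k (refl P γ) • t k w • y)
          (exteriorPower.map i (act P w) η) := by
    intro v η
    rw [← one_mul (t k w), kmk_mul_t, one_mul, ← mul_smul, hc, mul_smul, add_smul, kmk_add_mid,
      Finset.sum_smul, ← kmkLin_apply _ (∑ γ, _), map_sum, LinearMap.sum_apply]
    congr 1
    refine Finset.sum_congr rfl fun γ _ => ?_
    rw [kmkLin_apply, smul_assoc, kmk_smul_mid]
  -- both sides agree up to terms involving reflections
  have key : ∀ l, koszulStep i 1 (t k w • y) (act P w (e l))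
      (exteriorPower.map i (act P w) (contr (e.coord l) i ω)) -
        t k w • koszulStep i 1 y (e l) (contr (e.coord l) i ω) =
      ∑ γ, c γ • kmkLin X i 1 (t k (refl P γ) • t k w • y)
        (pair P γ (act P w (e l)) •
          (exteriorPower.map i (act P w) (contr (e.coord l) i ω) -
            exteriorPower.map i (act P (refl P γ))
              (exteriorPower.map i (act P w) (contr (e.coord l) i ω)))) := by
    intro l
    rw [koszulStep_apply, koszulStep_apply, smul_sub, smul_kmk, smul_kmk, one_mul, mul_one, one_mul,
      hA, hB]
    simp only [map_smul, map_sub, smul_sub, smul_smul, kmkLin_apply, Finset.sum_sub_distrib]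
    abel
  simp only [key]
  rw [Finset.sum_comm]
  refine Finset.sum_eq_zero fun γ _ => ?_
  have h0 : ∑ l, pair P γ (act P w (e l)) •
      (exteriorPower.map i (act P w) (contr (e.coord l) i ω) -
        exteriorPower.map i (act P (refl P γ))
          (exteriorPower.map i (act P w) (contr (e.coord l) i ω))) = 0 := by
    have h1 := map_contr (act P w) (pair P γ) i ω
    rw [← sum_contr_coord e (pair P γ ∘ₗ act P w), map_sum] at h1
    simp only [map_smul, LinearMap.comp_apply] at h1
    have h2 := congrArg (exteriorPower.map i (act P (refl P γ))) h1
    rw [map_refl_contr, ← h1, map_sum] at h2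
    simp only [map_smul] at h2
    simp only [smul_sub, Finset.sum_sub_distrib, h2, sub_self]
  rw [← Finset.smul_sum, ← map_sum, h0, map_zero, smul_zero]

/-- The differential of the Koszul-type resolution. -/
def koszulD : koszul X (i + 1) ⟶ koszul X i :=
  kdesc X (i + 1) (koszulDiffLin e X i) (koszulDiffLin_equivariant e X i)

variable {X i}

lemma koszulD_kmk (h : GradedHeckeAlgebra k) (y : X) (ω : ⋀[ℂ]^(i + 1) (Cplx V₀)) :
    (koszulD e X i).hom (kmk h y ω) = ∑ l, koszulStep i h y (e l) (contr (e.coord l) i ω) := by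
  rw [koszulD, kdesc_kmk, koszulDiffLin_apply, Finset.smul_sum]
  refine Finset.sum_congr rfl fun l _ => ?_
  rw [koszulStep_apply, koszulStep_apply, smul_sub, smul_kmk, smul_kmk, one_mul, mul_one]

lemma koszulD_koszulMk (h : GradedHeckeAlgebra k) (y : X) (v : Fin (i + 1) → Cplx V₀) :
    (koszulD e X i).hom (koszulMk h y v) =
      ∑ j : Fin (i + 1), (-1 : ℤ) ^ (j : ℕ) •
        (koszulMk (h * x k (v j)) y (v ∘ j.succAbove) -
          koszulMk h (x k (v j) • y) (v ∘ j.succAbove)) := by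
  rw [koszulMk_eq, koszulD_kmk, sum_contr_ιMulti]
  rfl

lemma koszulD_comp : koszulD e X (i + 1) ≫ koszulD e X i = 0 := by
  refine koszul_hom_ext fun y v => ?_
  rw [koszulMk_eq]
  generalize exteriorPower.ιMulti ℂ (i + 1 + 1) v = ω
  rw [ModuleCat.hom_comp, LinearMap.comp_apply, koszulD_kmk, map_sum, ModuleCat.hom_zero,
    LinearMap.zero_apply]
  set F : Fin n → Fin n → koszul X i := fun l m =>
    let η := contr (e.coord m) i (contr (e.coord l) (i + 1) ω)
    kmk (x k (e l) * x k (e m)) y η - kmk (x k (e l)) (x k (e m) • y) η -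
        kmk (x k (e m)) (x k (e l) • y) η + kmk 1 (x k (e m) • x k (e l) • y) η with hF
  have h1 : ∀ l, (koszulD e X i).hom
      (koszulStep (i + 1) 1 y (e l) (contr (e.coord l) (i + 1) ω)) = ∑ m, F l m := by
    intro l
    rw [koszulStep_apply, map_sub, koszulD_kmk, koszulD_kmk, ← Finset.sum_sub_distrib]
    refine Finset.sum_congr rfl fun m _ => ?_
    rw [koszulStep_apply, koszulStep_apply, one_mul, one_mul]
    simp only [hF]
    abel
  simp only [h1]
  have hanti : ∀ l m, F l m = - F m l := by
    intro l m
    simp only [hF]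
    rw [contr_contr, x_comm k (e l) (e m), smul_smul, smul_smul, x_comm k (e l) (e m)]
    have hneg : ∀ (h : GradedHeckeAlgebra k) (y : X) (ω : ⋀[ℂ]^i (Cplx V₀)),
        kmk h y (-ω) = - kmk h y ω := fun h y ω => map_neg (kmkLin X i h y) ω
    simp only [hneg]
    abel
  change ∑ l, ∑ m, F l m = 0
  have h2 : ∑ l, ∑ m, F l m = - ∑ l, ∑ m, F l m := by
    conv_lhs => rw [Finset.sum_comm]
    rw [← Finset.sum_neg_distrib]
    refine Finset.sum_congr rfl fun l _ => ?_
    rw [← Finset.sum_neg_distrib]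
    exact Finset.sum_congr rfl fun m _ => hanti m l
  have h3 : (2 : ℂ) • ∑ l, ∑ m, F l m = 0 := by
    rw [two_smul]
    nth_rewrite 1 [h2]
    exact neg_add_cancel _
  exact (smul_eq_zero.mp h3).resolve_left two_ne_zero

end Differential

section Augmentation

variable (X : ModuleCat.{u} (GradedHeckeAlgebra k))

/-- The map `y ⊗ c ↦ c y` on `X ⊗ ⋀^0 V`. -/
def augLin : Coch X X 0 :=
  LinearMap.mk₂ ℂ (fun y ω => exteriorPower.zeroEquiv ℂ (Cplx V₀) ω • y)
    (fun y y' ω => smul_add _ _ _) (fun c y ω => smul_comm _ _ _)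
    (fun y ω ω' => by rw [map_add, add_smul])
    (fun c y ω => by rw [map_smul, smul_assoc])

lemma isEquivariant_augLin : IsEquivariant (augLin X) := by
  intro w y ω
  have h : exteriorPower.zeroEquiv ℂ (Cplx V₀) (exteriorPower.map 0 (act P w) ω) =
      exteriorPower.zeroEquiv ℂ (Cplx V₀) ω :=
    LinearMap.congr_fun (exteriorPower.zeroEquiv_naturality (act P w)) ω
  simp only [augLin, LinearMap.mk₂_apply, h]
  exact ((actBy X (t k w)).map_smul _ y).symm

/-- The augmentation `h ⊗ y ↦ h y`. -/
def koszulAug : koszul X 0 ⟶ X := kdesc X 0 (augLin X) (isEquivariant_augLin X)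

variable {X}

lemma koszulAug_koszulMk (h : GradedHeckeAlgebra k) (y : X) (v : Fin 0 → Cplx V₀) :
    (koszulAug X).hom (koszulMk h y v) = h • y := by
  rw [koszulMk_eq, koszulAug, kdesc_kmk, augLin]
  simp

variable [P.IsReduced] {n : ℕ} (e : Module.Basis (Fin n) ℂ (Cplx V₀))

lemma koszulD_comp_aug : koszulD e X 0 ≫ koszulAug X = 0 := by
  refine koszul_hom_ext fun y v => ?_
  rw [ModuleCat.hom_comp, LinearMap.comp_apply, koszulD_koszulMk, map_sum, ModuleCat.hom_zero,
    LinearMap.zero_apply]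
  refine Finset.sum_eq_zero fun j _ => ?_
  rw [map_zsmul, map_sub, koszulAug_koszulMk, koszulAug_koszulMk, one_mul, one_smul, sub_self,
    smul_zero]

end Augmentation

end KoszulComplex

/-! ### The Koszul complex over a polynomial ring -/

section PolynomialKoszul

variable {n : ℕ} {M V : Type*} [AddCommGroup M] [Module ℂ M] [AddCommGroup V] [Module ℂ V]
  (a : Fin n → Module.End ℂ M) (e : Module.Basis (Fin n) ℂ V)

variable (n M) in
/-- The space `ℂ[X_1, …, X_n] ⊗ M`, as a vector space; the definition hides the tensor product from
instance search. -/
def PolyTensor : Type _ := MvPolynomial (Fin n) ℂ ⊗[ℂ] M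

instance : AddCommGroup (PolyTensor n M) :=
  inferInstanceAs (AddCommGroup (MvPolynomial (Fin n) ℂ ⊗[ℂ] M))

instance : Module ℂ (PolyTensor n M) :=
  inferInstanceAs (Module ℂ (MvPolynomial (Fin n) ℂ ⊗[ℂ] M))

variable (n M) in
/-- The bilinear map `(p, y) ↦ p ⊗ y`. -/
def polyMk : MvPolynomial (Fin n) ℂ →ₗ[ℂ] M →ₗ[ℂ] PolyTensor n M := TensorProduct.mk ℂ _ _

lemma polyTensor_induction {p : PolyTensor n M → Prop} (zero : p 0)
    (add : ∀ q q', p q → p q' → p (q + q')) (tmul : ∀ f y, p (polyMk n M f y)) (q) : p q :=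
  TensorProduct.induction_on q zero tmul add

/-- The operator `X_l ⊗ 1 - 1 ⊗ a_l` on `ℂ[X] ⊗ M`. -/
def shiftMul (l : Fin n) : Module.End ℂ (PolyTensor n M) :=
  TensorProduct.lift ((polyMk n M ∘ₗ LinearMap.mulLeft ℂ (MvPolynomial.X l)) -
    (polyMk n M).compl₂ (a l))

lemma shiftMul_tmul (l : Fin n) (p : MvPolynomial (Fin n) ℂ) (y : M) :
    shiftMul a l (polyMk n M p y) =
      polyMk n M (MvPolynomial.X l * p) y - polyMk n M p (a l y) := rfl

variable (M) in
/-- The partial derivative `∂_l ⊗ 1` on `ℂ[X] ⊗ M`. -/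
def partialDer (l : Fin n) : Module.End ℂ (PolyTensor n M) :=
  TensorProduct.lift (polyMk n M ∘ₗ (MvPolynomial.pderiv l).toLinearMap)

lemma partialDer_tmul (l : Fin n) (p : MvPolynomial (Fin n) ℂ) (y : M) :
    partialDer M l (polyMk n M p y) = polyMk n M (MvPolynomial.pderiv l p) y := rfl

lemma partialDer_shiftMul (l m : Fin n) (z : PolyTensor n M) :
    partialDer M m (shiftMul a l z) = shiftMul a l (partialDer M m z) +
      (if l = m then z else 0) := by
  induction z using polyTensor_induction with
  | zero => simp
  | add z z' hz hz' => simp only [map_add, hz, hz']; split_ifs <;> abel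
  | tmul p y =>
    rw [shiftMul_tmul, map_sub, partialDer_tmul, partialDer_tmul, partialDer_tmul, shiftMul_tmul,
      Derivation.leibniz, map_add, LinearMap.add_apply, smul_eq_mul, smul_eq_mul]
    by_cases h : l = m
    · subst h
      rw [if_pos rfl, MvPolynomial.pderiv_X_self, mul_one]
      abel
    · rw [if_neg h, MvPolynomial.pderiv_X_of_ne h, mul_zero, map_zero, LinearMap.zero_apply]
      abel

/-- The differential `∑_l (X_l - a_l) ⊗ contr_l` of the Koszul complex on `ℂ[X] ⊗ M`. -/
def polyD (i : ℕ) : PolyTensor n M ⊗[ℂ] ⋀[ℂ]^(i + 1) V →ₗ[ℂ]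
    PolyTensor n M ⊗[ℂ] ⋀[ℂ]^i V :=
  ∑ l, TensorProduct.map (shiftMul a l) (contr (e.coord l) i)

lemma polyD_tmul (i : ℕ) (q : PolyTensor n M) (ω : ⋀[ℂ]^(i + 1) V) :
    polyD a e i (q ⊗ₜ ω) = ∑ l, shiftMul a l q ⊗ₜ contr (e.coord l) i ω := by
  simp [polyD, LinearMap.sum_apply]

variable (M) in
/-- The de Rham differential `∑_l ∂_l ⊗ (e_l ∧ ·)`, which is a homotopy for the Koszul complex. -/
def polyH (i : ℕ) : PolyTensor n M ⊗[ℂ] ⋀[ℂ]^i V →ₗ[ℂ]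
    PolyTensor n M ⊗[ℂ] ⋀[ℂ]^(i + 1) V :=
  ∑ l, TensorProduct.map (partialDer M l) (wedge (e l) i)

lemma polyH_tmul (i : ℕ) (q : PolyTensor n M) (ω : ⋀[ℂ]^i V) :
    polyH M e i (q ⊗ₜ ω) = ∑ l, partialDer M l q ⊗ₜ wedge (e l) i ω := by
  simp [polyH, LinearMap.sum_apply]

/-- The deformed Euler operator `∑_l (X_l - a_l) ∂_l` on `ℂ[X] ⊗ M`. -/
def euler : Module.End ℂ (PolyTensor n M) :=
  ∑ l, shiftMul a l ∘ₗ partialDer M l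

lemma euler_apply (z : PolyTensor n M) :
    euler a z = ∑ l, shiftMul a l (partialDer M l z) := by
  simp [euler, LinearMap.sum_apply]

lemma coord_tmul (l m : Fin n) (i : ℕ) (q : PolyTensor n M) (ω : ⋀[ℂ]^i V) :
    q ⊗ₜ[ℂ] (e.coord l (e m) • ω) = if l = m then q ⊗ₜ[ℂ] ω else 0 := by
  rw [Module.Basis.coord_apply, Module.Basis.repr_self, Finsupp.single_apply]
  by_cases h : l = m
  · rw [if_pos h, if_pos h.symm, one_smul]
  · rw [if_neg h, if_neg (Ne.symm h), zero_smul, TensorProduct.tmul_zero]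

/-- The Cartan formula. -/
lemma polyD_polyH_succ (i : ℕ) (z : PolyTensor n M ⊗[ℂ] ⋀[ℂ]^(i + 1) V) :
    polyD a e (i + 1) (polyH M e (i + 1) z) + polyH M e i (polyD a e i z) =
      (euler a).rTensor _ z + (i + 1) • z := by
  induction z using TensorProduct.induction_on with
  | zero => simp
  | add z z' hz hz' =>
    simp only [map_add]
    calc _ = (polyD a e (i + 1) (polyH M e (i + 1) z) + polyH M e i (polyD a e i z)) +
          (polyD a e (i + 1) (polyH M e (i + 1) z') + polyH M e i (polyD a e i z')) := by abel
      _ = _ := by rw [hz, hz', smul_add]; abel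
  | tmul q ω =>
    have h1 : polyD a e (i + 1) (polyH M e (i + 1) (q ⊗ₜ ω)) =
        (euler a).rTensor _ (q ⊗ₜ ω) - ∑ m, ∑ l, shiftMul a l (partialDer M m q) ⊗ₜ[ℂ]
          wedge (e m) i (contr (e.coord l) i ω) := by
      rw [polyH_tmul, map_sum, LinearMap.rTensor_tmul, euler_apply, TensorProduct.sum_tmul,
        eq_sub_iff_add_eq, ← Finset.sum_add_distrib]
      refine Finset.sum_congr rfl fun m _ => ?_
      rw [polyD_tmul, ← Finset.sum_add_distrib]
      simp only [contr_wedge, TensorProduct.tmul_sub, coord_tmul, sub_add_cancel,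
        Finset.sum_ite_eq', Finset.mem_univ, if_true]
    have h2 : polyH M e i (polyD a e i (q ⊗ₜ ω)) =
        ∑ m, ∑ l, shiftMul a l (partialDer M m q) ⊗ₜ[ℂ]
          wedge (e m) i (contr (e.coord l) i ω) + (i + 1) • q ⊗ₜ[ℂ] ω := by
      rw [polyD_tmul, map_sum, Finset.sum_comm, ← TensorProduct.tmul_smul,
        ← sum_wedge_contr e, TensorProduct.tmul_sum, ← Finset.sum_add_distrib]
      refine Finset.sum_congr rfl fun l _ => ?_
      rw [polyH_tmul]
      simp only [partialDer_shiftMul, TensorProduct.add_tmul, Finset.sum_add_distrib,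
        TensorProduct.ite_tmul, Finset.sum_ite_eq, Finset.mem_univ, if_true]
    rw [h1, h2]
    abel

lemma polyD_polyH_zero (z : PolyTensor n M ⊗[ℂ] ⋀[ℂ]^0 V) :
    polyD a e 0 (polyH M e 0 z) = (euler a).rTensor _ z := by
  induction z using TensorProduct.induction_on with
  | zero => simp
  | add z z' hz hz' => simp only [map_add, hz, hz']
  | tmul q ω =>
    rw [polyH_tmul, map_sum, LinearMap.rTensor_tmul, euler_apply, TensorProduct.sum_tmul]
    refine Finset.sum_congr rfl fun m _ => ?_
    rw [polyD_tmul]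
    simp only [contr_wedge_zero, coord_tmul, Finset.sum_ite_eq', Finset.mem_univ, if_true]

/-- The filtration by generalized eigenspaces of the Euler operator: an element of level `N + 1` is
mapped to level `N` by `euler - (N + 1)`, and level `0` is spanned by the constants. -/
def eulerFil (i : ℕ) : ℕ → Submodule ℂ (PolyTensor n M ⊗[ℂ] ⋀[ℂ]^i V)
  | 0 => Submodule.span ℂ {z | ∃ y ω, z = polyMk n M 1 y ⊗ₜ[ℂ] ω}
  | N + 1 => Submodule.comap
      ((euler a).rTensor (⋀[ℂ]^i V) + (-(N + 1) : ℂ) •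
        LinearMap.id (R := ℂ) (M := PolyTensor n M ⊗[ℂ] ⋀[ℂ]^i V)) (eulerFil i N)

lemma mem_eulerFil_succ (i N : ℕ) (z : PolyTensor n M ⊗[ℂ] ⋀[ℂ]^i V) :
    z ∈ eulerFil a i (N + 1) ↔
      (euler a).rTensor _ z - (N + 1 : ℂ) • z ∈ eulerFil (V := V) a i N := by
  rw [sub_eq_add_neg, ← neg_smul]
  rfl

lemma euler_eulerFil_zero (i : ℕ) {z : PolyTensor n M ⊗[ℂ] ⋀[ℂ]^i V}
    (hz : z ∈ eulerFil a i 0) : (euler a).rTensor _ z = 0 := by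
  induction hz using Submodule.span_induction with
  | mem _ h =>
    obtain ⟨y, ω, rfl⟩ := h
    rw [LinearMap.rTensor_tmul, euler_apply, Finset.sum_eq_zero, TensorProduct.zero_tmul]
    intro l _
    rw [partialDer_tmul, ← MvPolynomial.C_1, MvPolynomial.pderiv_C, map_zero,
      LinearMap.zero_apply, map_zero]
  | zero => simp
  | add z z' _ _ hz hz' => rw [map_add, hz, hz', add_zero]
  | smul c z _ hz => rw [map_smul, hz, smul_zero]

lemma eulerFil_le_succ (i N : ℕ) :
    eulerFil (V := V) a i N ≤ eulerFil a i (N + 1) := by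
  induction N with
  | zero =>
    intro z hz
    rw [mem_eulerFil_succ, euler_eulerFil_zero a i hz, zero_sub]
    exact Submodule.neg_mem _ (Submodule.smul_mem _ _ hz)
  | succ N ih =>
    intro z hz
    rw [mem_eulerFil_succ]
    have h1 := ih ((mem_eulerFil_succ a i N z).mp hz)
    convert Submodule.sub_mem _ h1 hz using 1
    push_cast
    rw [add_smul, one_smul]
    abel

lemma eulerFil_mono (i : ℕ) : Monotone (eulerFil (V := V) a i) :=
  monotone_nat_of_le_succ (eulerFil_le_succ a i)

lemma monomial_mem_eulerFil (i d : ℕ) (s : Fin n →₀ ℕ) (hs : s.degree = d) (c : ℂ) (y : M)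
    (ω : ⋀[ℂ]^i V) : polyMk n M (MvPolynomial.monomial s c) y ⊗ₜ[ℂ] ω ∈ eulerFil a i d := by
  induction d generalizing s c y with
  | zero =>
    rw [Finsupp.degree_eq_zero_iff] at hs
    subst hs
    refine Submodule.subset_span ⟨c • y, ω, ?_⟩
    rw [map_smul, ← LinearMap.smul_apply, ← map_smul, MvPolynomial.smul_eq_C_mul, mul_one]
    rfl
  | succ d ih =>
    rw [mem_eulerFil_succ, LinearMap.rTensor_tmul, euler_apply]
    have h1 : ∑ l, shiftMul a l (partialDer M l (polyMk n M (MvPolynomial.monomial s c) y)) =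
        (d + 1 : ℂ) • polyMk n M (MvPolynomial.monomial s c) y -
          ∑ l, polyMk n M (MvPolynomial.pderiv l (MvPolynomial.monomial s c)) (a l y) := by
      simp only [partialDer_tmul, shiftMul_tmul, Finset.sum_sub_distrib]
      congr 1
      rw [← LinearMap.sum_apply, ← map_sum]
      simp only [MvPolynomial.X_mul_pderiv_monomial]
      rw [Finsupp.degree_eq_sum] at hs
      rw [← Finset.sum_smul, hs, ← Nat.cast_smul_eq_nsmul ℂ, map_smul, LinearMap.smul_apply]
      push_cast
      rfl
    rw [h1, TensorProduct.sub_tmul, TensorProduct.smul_tmul', sub_sub_cancel_left,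
      TensorProduct.sum_tmul]
    refine Submodule.neg_mem _ (Submodule.sum_mem _ fun l _ => ?_)
    rw [MvPolynomial.pderiv_monomial]
    by_cases hl : s l = 0
    · rw [hl]; simp
    · refine ih _ ?_ _ _
      have h2 : s - Finsupp.single l 1 + Finsupp.single l 1 = s :=
        tsub_add_cancel_of_le (Finsupp.single_le_iff.mpr (Nat.one_le_iff_ne_zero.mpr hl))
      have h3 := congrArg Finsupp.degree h2
      rw [map_add, Finsupp.degree_single, hs] at h3
      omega

lemma exists_mem_eulerFil (i : ℕ) (z : PolyTensor n M ⊗[ℂ] ⋀[ℂ]^i V) :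
    ∃ N, z ∈ eulerFil a i N := by
  have hadd : ∀ z z' : PolyTensor n M ⊗[ℂ] ⋀[ℂ]^i V,
      (∃ N, z ∈ eulerFil a i N) → (∃ N, z' ∈ eulerFil a i N) →
      ∃ N, z + z' ∈ eulerFil a i N := by
    rintro z z' ⟨N, hN⟩ ⟨N', hN'⟩
    exact ⟨max N N', Submodule.add_mem _ (eulerFil_mono a i (le_max_left _ _) hN)
      (eulerFil_mono a i (le_max_right _ _) hN')⟩
  induction z using TensorProduct.induction_on with
  | zero => exact ⟨0, Submodule.zero_mem _⟩
  | add z z' hz hz' => exact hadd z z' hz hz'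
  | tmul q ω =>
    induction q using polyTensor_induction with
    | zero => exact ⟨0, by rw [TensorProduct.zero_tmul]; exact Submodule.zero_mem _⟩
    | add q q' hq hq' => rw [TensorProduct.add_tmul]; exact hadd _ _ hq hq'
    | tmul p y =>
      induction p using MvPolynomial.monomial_add_induction_on with
      | C c => exact ⟨_, monomial_mem_eulerFil a i _ 0 rfl c y ω⟩
      | monomial_add s c p _ _ hp =>
        rw [map_add, LinearMap.add_apply, TensorProduct.add_tmul]
        exact hadd _ _ ⟨_, monomial_mem_eulerFil a i _ s rfl c y ω⟩ hp

/-- Since `euler - (N + 1)` lowers the level of the filtration and `euler + i` is homotopic to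
zero, cycles become boundaries by induction on the level. -/
lemma mem_range_of_eulerFil (i : ℕ)
    {K : Submodule ℂ (PolyTensor n M ⊗[ℂ] ⋀[ℂ]^i V)}
    (hK : ∀ z, polyD a e i z ∈ K)
    (hE : ∀ z ∈ K, (euler a).rTensor _ z + (i : ℂ) • z ∈ LinearMap.range (polyD a e i))
    (h0 : ∀ z ∈ K, z ∈ eulerFil a i 0 → z ∈ LinearMap.range (polyD a e i)) {z} (hz : z ∈ K) :
    z ∈ LinearMap.range (polyD a e i) := by
  obtain ⟨N, hN⟩ := exists_mem_eulerFil a i z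
  induction N generalizing z with
  | zero => exact h0 z hz hN
  | succ N ih =>
    have hz1 := hE z hz
    have hz2 : (euler a).rTensor _ z + (i : ℂ) • z ∈ K := by
      obtain ⟨u, hu⟩ := hz1
      rw [← hu]
      exact hK u
    rw [mem_eulerFil_succ] at hN
    have h1 : (euler a).rTensor _ z - (N + 1 : ℂ) • z =
        ((euler a).rTensor _ z + (i : ℂ) • z) - (i + N + 1 : ℂ) • z := by
      simp only [add_smul]
      abel
    have h2 := ih (by rw [h1]; exact K.sub_mem hz2 (K.smul_mem _ hz)) hN
    rw [h1] at h2
    have h3 := Submodule.sub_mem _ hz1 h2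
    rw [sub_sub_cancel] at h3
    refine (Submodule.smul_mem_iff _ ?_).mp h3
    exact_mod_cast Nat.succ_ne_zero (i + N)

lemma mem_range_polyD_succ (i : ℕ) (hdd : ∀ z, polyD a e i (polyD a e (i + 1) z) = 0)
    {z} (hz : polyD a e i z = 0) : z ∈ LinearMap.range (polyD a e (i + 1)) := by
  have hE : ∀ z, polyD a e i z = 0 → (euler a).rTensor _ z + ((i + 1 : ℕ) : ℂ) • z ∈
      LinearMap.range (polyD a e (i + 1)) := by
    intro z hz
    refine ⟨polyH M e (i + 1) z, ?_⟩
    have := polyD_polyH_succ a e i z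
    rw [hz, map_zero, add_zero] at this
    rw [this, Nat.cast_smul_eq_nsmul]
  refine mem_range_of_eulerFil a e (i + 1) (K := LinearMap.ker (polyD a e i)) hdd hE
    (fun z hz hz0 => ?_) hz
  have := hE z hz
  rw [euler_eulerFil_zero a _ hz0, zero_add] at this
  exact (Submodule.smul_mem_iff _ (Nat.cast_ne_zero.mpr (Nat.succ_ne_zero i))).mp this

lemma mem_range_polyD_zero {K : Submodule ℂ (PolyTensor n M ⊗[ℂ] ⋀[ℂ]^0 V)}
    (hK : ∀ z, polyD a e 0 z ∈ K) (h0 : ∀ z ∈ K, z ∈ eulerFil a 0 0 → z = 0) {z} (hz : z ∈ K) :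
    z ∈ LinearMap.range (polyD a e 0) := by
  refine mem_range_of_eulerFil a e 0 (K := K) hK (fun z _ => ?_)
    (fun z hz hz0 => by rw [h0 z hz hz0]; exact Submodule.zero_mem _) hz
  exact ⟨polyH M e 0 z, by rw [polyD_polyH_zero]; simp⟩

end PolynomialKoszul

/-! ### Exactness of the Koszul-type complex -/

section Exactness

open ModuleCat

variable {ι V₀ N : Type u} [Fintype ι] [AddCommGroup V₀] [Module ℝ V₀] [FiniteDimensional ℝ V₀]
  [AddCommGroup N] [Module ℝ N] {P : RootPairing ι ℝ V₀ N} [P.IsReduced] {S : SimpleSystem P}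
  {k : Parameter S}

variable {n : ℕ} (e : Module.Basis (Fin n) ℂ (Cplx V₀))
  (X : ModuleCat.{u} (GradedHeckeAlgebra k)) (i : ℕ)

/-- The map `ℂ[X_1, …, X_n] ⊗ X ⊗ ⋀^i V → ℍ ⊗_{ℂ[W]} (X ⊗ ⋀^i V)`, which is bijective by the
PBW theorem. -/
def polyToKoszul : PolyTensor n X ⊗[ℂ] ⋀[ℂ]^i (Cplx V₀) →ₗ[ℂ] koszul X i :=
  TensorProduct.lift (TensorProduct.lift (kmkLin X i ∘ₗ (polHom k e).toLinearMap))

variable {X i} in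
lemma polyToKoszul_tmul (p : MvPolynomial (Fin n) ℂ) (y : X) (ω : ⋀[ℂ]^i (Cplx V₀)) :
    polyToKoszul e X i (polyMk n X p y ⊗ₜ ω) = kmk (polHom k e p) y ω := rfl

/-- The diagonal action of `w ∈ W` on `X ⊗ ⋀^i V`. -/
def diagAct (w : P.weylGroup) :
    X ⊗[ℂ] ⋀[ℂ]^i (Cplx V₀) →ₗ[ℂ] X ⊗[ℂ] ⋀[ℂ]^i (Cplx V₀) :=
  TensorProduct.map (actBy X (t k w)) (exteriorPower.map i (act P w))

variable {X i} in
lemma diagAct_tmul (w : P.weylGroup) (y : X) (ω : ⋀[ℂ]^i (Cplx V₀)) :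
    diagAct X i w (y ⊗ₜ ω) = (t k w • y) ⊗ₜ exteriorPower.map i (act P w) ω := rfl

variable {X i} in
lemma diagAct_mul (w w' : P.weylGroup) (m : X ⊗[ℂ] ⋀[ℂ]^i (Cplx V₀)) :
    diagAct X i (w * w') m = diagAct X i w (diagAct X i w' m) := by
  induction m using TensorProduct.induction_on with
  | zero => simp
  | add m m' hm hm' => simp only [map_add, hm, hm']
  | tmul y ω => rw [diagAct_tmul, diagAct_tmul, diagAct_tmul, t_mul, mul_smul, map_act_mul]

variable {X i} in
lemma diagAct_one (m : X ⊗[ℂ] ⋀[ℂ]^i (Cplx V₀)) : diagAct X i 1 m = m := by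
  induction m using TensorProduct.induction_on with
  | zero => simp
  | add m m' hm hm' => simp only [map_add, hm, hm']
  | tmul y ω => rw [diagAct_tmul, t_one, one_smul, map_act_one]

/-- The map `PBWSpace → Hom (X ⊗ ⋀^i V, ℂ[X_1, …, X_n] ⊗ X ⊗ ⋀^i V)`, `p ⊗ w ↦ p ⊗ w`. -/
def pbwToPoly : PBWSpace P n →ₗ[ℂ] X ⊗[ℂ] ⋀[ℂ]^i (Cplx V₀) →ₗ[ℂ]
    PolyTensor n X ⊗[ℂ] ⋀[ℂ]^i (Cplx V₀) :=
  Finsupp.lsum ℂ fun w => LinearMap.lcomp ℂ _ (diagAct X i w) ∘ₗ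
    LinearMap.rTensorHom (⋀[ℂ]^i (Cplx V₀)) ∘ₗ polyMk n X

variable {X i} in
lemma pbwToPoly_single (w : P.weylGroup) (p : MvPolynomial (Fin n) ℂ)
    (m : X ⊗[ℂ] ⋀[ℂ]^i (Cplx V₀)) : pbwToPoly X i (Finsupp.single w p) m =
      (polyMk n X p).rTensor _ (diagAct X i w m) := by
  simp [pbwToPoly]

variable {X i} in
lemma pbwToPoly_rightWeyl (w : P.weylGroup) (z : PBWSpace P n)
    (m : X ⊗[ℂ] ⋀[ℂ]^i (Cplx V₀)) :
    pbwToPoly X i (rightWeyl n w z) m = pbwToPoly X i z (diagAct X i w m) := by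
  induction z using Finsupp.induction_linear with
  | zero => simp
  | add z z' hz hz' => simp only [map_add, LinearMap.add_apply, hz, hz']
  | single w' p => rw [rightWeyl_single, pbwToPoly_single, pbwToPoly_single, diagAct_mul]

/-- A left inverse of `polyToKoszul`, before passing to the quotient. -/
def koszulPreToPoly : KoszulPre X i →ₗ[ℂ] PolyTensor n X ⊗[ℂ] ⋀[ℂ]^i (Cplx V₀) :=
  TensorProduct.lift (pbwToPoly X i ∘ₗ pbw k e)

variable {X i}

lemma koszulPreToPoly_tmul (h : GradedHeckeAlgebra k) (m : X ⊗[ℂ] ⋀[ℂ]^i (Cplx V₀)) :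
    koszulPreToPoly e X i (h ⊗ₜ m) = pbwToPoly X i (pbw k e h) m := rfl

lemma koszulPreToPoly_rel {z : KoszulPre X i} (hz : z ∈ koszulRel X i) :
    koszulPreToPoly e X i z = 0 := by
  have key : ∀ a : GradedHeckeAlgebra k, koszulPreToPoly e X i (a • z) = 0 := by
    unfold koszulRel at hz
    induction hz using Submodule.span_induction with
    | mem _ h =>
      obtain ⟨w, y, ω, rfl⟩ := h
      intro a
      rw [smul_sub, map_sub, TensorProduct.smul_tmul', TensorProduct.smul_tmul',
        koszulPreToPoly_tmul, koszulPreToPoly_tmul, smul_eq_mul, smul_eq_mul, mul_one,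
        pbw_mul_t, pbwToPoly_rightWeyl, diagAct_tmul, sub_self]
    | zero => intro a; rw [smul_zero, map_zero]
    | add z z' _ _ hz hz' => intro a; rw [smul_add, map_add, hz, hz', add_zero]
    | smul b z _ hz => intro a; rw [smul_smul, hz]
  rw [← one_smul (GradedHeckeAlgebra k) z, key]

lemma polyToKoszul_injective : Function.Injective (polyToKoszul e X i) := by
  rw [injective_iff_map_eq_zero]
  intro z hz
  have key : ∀ z, ∃ z' : KoszulPre X i, (koszulRel X i).mkQ z' = polyToKoszul e X i z ∧
      koszulPreToPoly e X i z' = z := by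
    have hadd : ∀ z₁ z₂, (∃ z' : KoszulPre X i, (koszulRel X i).mkQ z' = polyToKoszul e X i z₁ ∧
        koszulPreToPoly e X i z' = z₁) →
        (∃ z' : KoszulPre X i, (koszulRel X i).mkQ z' = polyToKoszul e X i z₂ ∧
        koszulPreToPoly e X i z' = z₂) →
        ∃ z' : KoszulPre X i, (koszulRel X i).mkQ z' = polyToKoszul e X i (z₁ + z₂) ∧
        koszulPreToPoly e X i z' = z₁ + z₂ := by
      rintro z₁ z₂ ⟨u₁, h₁, h₁'⟩ ⟨u₂, h₂, h₂'⟩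
      exact ⟨u₁ + u₂, by rw [map_add, map_add, h₁, h₂]; rfl, by rw [map_add, h₁', h₂']⟩
    intro z
    induction z using TensorProduct.induction_on with
    | zero => exact ⟨0, by rw [map_zero, map_zero]; rfl, map_zero _⟩
    | add z z' hz hz' => exact hadd z z' hz hz'
    | tmul q ω =>
      induction q using polyTensor_induction with
      | zero => exact ⟨0, by rw [TensorProduct.zero_tmul, map_zero, map_zero]; rfl,
          by rw [TensorProduct.zero_tmul, map_zero]⟩
      | add q q' hq hq' => rw [TensorProduct.add_tmul]; exact hadd _ _ hq hq'
      | tmul p y =>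
        refine ⟨polHom k e p ⊗ₜ (y ⊗ₜ ω), rfl, ?_⟩
        rw [koszulPreToPoly_tmul, pbw_polHom, pbwToPoly_single, diagAct_one,
          LinearMap.rTensor_tmul]
  obtain ⟨z', h1, h2⟩ := key z
  rw [hz] at h1
  rw [← h2]
  exact koszulPreToPoly_rel e ((Submodule.Quotient.mk_eq_zero _).mp h1)

lemma polyToKoszul_surjective : Function.Surjective (polyToKoszul e X i) := by
  intro z
  rw [← LinearMap.mem_range]
  induction z using koszul_induction with
  | h0 => exact Submodule.zero_mem _
  | hadd a b ha hb => exact Submodule.add_mem _ ha hb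
  | hmk h y ω =>
    rw [← pbwInv_pbw k e h]
    generalize pbw k e h = z
    induction z using Finsupp.induction_linear with
    | zero =>
      rw [map_zero, ← kmkLin_apply, map_zero]
      exact Submodule.zero_mem _
    | add z z' hz hz' =>
      rw [map_add, kmk_add_left]
      exact Submodule.add_mem _ hz hz'
    | single w p =>
      rw [pbwInv_single, kmk_mul_t]
      exact ⟨_, polyToKoszul_tmul e p _ _⟩

lemma koszulD_polyToKoszul (z : PolyTensor n X ⊗[ℂ] ⋀[ℂ]^(i + 1) (Cplx V₀)) :
    (koszulD e X i).hom (polyToKoszul e X (i + 1) z) =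
      polyToKoszul e X i (polyD (fun l => actBy X (x k (e l))) e i z) := by
  induction z using TensorProduct.induction_on with
  | zero => simp only [map_zero]
  | add z z' hz hz' => simp only [map_add, hz, hz']
  | tmul q ω =>
    induction q using polyTensor_induction with
    | zero => simp only [TensorProduct.zero_tmul, map_zero]
    | add q q' hq hq' => simp only [TensorProduct.add_tmul, map_add, hq, hq']
    | tmul p y =>
      rw [polyToKoszul_tmul, koszulD_kmk, polyD_tmul, map_sum]
      refine Finset.sum_congr rfl fun l _ => ?_
      rw [shiftMul_tmul, TensorProduct.sub_tmul, map_sub, polyToKoszul_tmul, polyToKoszul_tmul,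
        koszulStep_apply, mul_comm, map_mul, polHom_X]
      rfl

lemma koszulD_koszulD (z : koszul X (i + 1 + 1)) :
    (koszulD e X i).hom ((koszulD e X (i + 1)).hom z) = 0 := by
  rw [← LinearMap.comp_apply, ← ModuleCat.hom_comp, koszulD_comp]
  rfl

lemma koszulAug_koszulD (z : koszul X 1) :
    (koszulAug X).hom ((koszulD e X 0).hom z) = 0 := by
  rw [← LinearMap.comp_apply, ← ModuleCat.hom_comp, koszulD_comp_aug]
  rfl

/-- The Koszul-type complex is exact in positive degrees. -/
lemma koszulD_exact {z : koszul X (i + 1)} (hz : (koszulD e X i).hom z = 0) :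
    ∃ z', (koszulD e X (i + 1)).hom z' = z := by
  obtain ⟨z, rfl⟩ := polyToKoszul_surjective e z
  rw [koszulD_polyToKoszul] at hz
  obtain ⟨z', hz'⟩ := mem_range_polyD_succ (fun l => actBy X (x k (e l))) e i
    (fun z => polyToKoszul_injective e (by
      rw [map_zero, ← koszulD_polyToKoszul, ← koszulD_polyToKoszul]
      exact koszulD_koszulD e _))
    (polyToKoszul_injective e (hz.trans (map_zero _).symm))
  exact ⟨_, by rw [koszulD_polyToKoszul, hz']⟩

lemma eq_smul_ιMulti_zero (ω : ⋀[ℂ]^0 (Cplx V₀)) :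
    ω = exteriorPower.zeroEquiv ℂ (Cplx V₀) ω • exteriorPower.ιMulti ℂ 0 Fin.elim0 := by
  apply (exteriorPower.zeroEquiv ℂ (Cplx V₀)).injective
  rw [map_smul, exteriorPower.zeroEquiv_ιMulti, smul_eq_mul, mul_one]

/-- The Koszul-type complex is exact in degree zero. Elements of level `0` of the filtration
have the form `1 ⊗ y`, and the augmentation is injective on them. -/
lemma koszulAug_exact {z : koszul X 0} (hz : (koszulAug X).hom z = 0) :
    ∃ z', (koszulD e X 0).hom z' = z := by
  obtain ⟨z, rfl⟩ := polyToKoszul_surjective e z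
  obtain ⟨z', hz'⟩ := mem_range_polyD_zero (fun l => actBy X (x k (e l))) e
    (K := LinearMap.ker (homC (koszulAug X) ∘ₗ polyToKoszul e X 0))
    (fun z => by
      rw [LinearMap.mem_ker, LinearMap.comp_apply, ← koszulD_polyToKoszul]
      exact koszulAug_koszulD e _)
    (fun z hz hz0 => by
      obtain ⟨y, rfl⟩ : ∃ y, z = polyMk n X 1 y ⊗ₜ[ℂ] exteriorPower.ιMulti ℂ 0 Fin.elim0 := by
        clear hz
        induction hz0 using Submodule.span_induction with
        | mem _ h =>
          obtain ⟨y, ω, rfl⟩ := h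
          refine ⟨exteriorPower.zeroEquiv ℂ (Cplx V₀) ω • y, ?_⟩
          rw [map_smul, TensorProduct.smul_tmul, ← eq_smul_ιMulti_zero]
        | zero => exact ⟨0, by rw [map_zero, TensorProduct.zero_tmul]⟩
        | add z z' _ _ hz hz' =>
          obtain ⟨y, rfl⟩ := hz
          obtain ⟨y', rfl⟩ := hz'
          exact ⟨y + y', by rw [map_add, TensorProduct.add_tmul]⟩
        | smul c z _ hz =>
          obtain ⟨y, rfl⟩ := hz
          exact ⟨c • y, by rw [map_smul, TensorProduct.smul_tmul']⟩
      rw [LinearMap.mem_ker, LinearMap.comp_apply, polyToKoszul_tmul, map_one] at hz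
      have h1 : (koszulAug X).hom (koszulMk 1 y Fin.elim0) = 0 := hz
      rw [koszulAug_koszulMk, one_smul] at h1
      rw [h1, map_zero, TensorProduct.zero_tmul])
    (z := z) hz
  exact ⟨_, by rw [koszulD_polyToKoszul, hz']⟩

lemma koszulAug_surjective : Function.Surjective (koszulAug X).hom := fun y =>
  ⟨koszulMk 1 y Fin.elim0, by rw [koszulAug_koszulMk, one_smul]⟩

end Exactness

/-! ### Projectivity and the Koszul-type resolution -/

section Averaging

open ModuleCat

variable {ι V₀ N : Type u} [Fintype ι] [AddCommGroup V₀] [Module ℝ V₀] [FiniteDimensional ℝ V₀]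
  [AddCommGroup N] [Module ℝ N] {P : RootPairing ι ℝ V₀ N} {S : SimpleSystem P}
  {k : Parameter S} {X Y Z : ModuleCat.{u} (GradedHeckeAlgebra k)} {i : ℕ}

instance : Fintype P.weylGroup := Fintype.ofFinite _

/-- The action `η ↦ w⁻¹ ∘ η ∘ w` of `w ∈ W` on the space of linear maps `X ⊗ ⋀^i V → Y`. -/
def conj (w : P.weylGroup) : Coch X Y i →ₗ[ℂ] Coch X Y i where
  toFun η := (η.compl₁₂ (actBy X (t k w)) (exteriorPower.map i (act P w))).compr₂
    (actBy Y (t k w⁻¹))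
  map_add' _ _ := LinearMap.ext₂ fun _ _ => map_add (actBy Y (t k w⁻¹)) _ _
  map_smul' c _ := LinearMap.ext₂ fun _ _ => map_smul (actBy Y (t k w⁻¹)) c _

lemma conj_apply (w : P.weylGroup) (η : Coch X Y i) (y : X) (ω : ⋀[ℂ]^i (Cplx V₀)) :
    conj w η y ω = t k w⁻¹ • η (t k w • y) (exteriorPower.map i (act P w) ω) := rfl

lemma t_inv_smul_t (w : P.weylGroup) (y : X) : t k w⁻¹ • t k w • y = y := by
  rw [smul_smul, ← t_mul, inv_mul_cancel, t_one, one_smul]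

lemma t_smul_t_inv (w : P.weylGroup) (y : X) : t k w • t k w⁻¹ • y = y := by
  rw [smul_smul, ← t_mul, mul_inv_cancel, t_one, one_smul]

lemma conj_conj (w w' : P.weylGroup) (η : Coch X Y i) :
    conj w (conj w' η) = conj (w' * w) η := by
  refine LinearMap.ext₂ fun y ω => ?_
  rw [conj_apply, conj_apply, conj_apply, mul_inv_rev, t_mul, t_mul, mul_smul, mul_smul,
    map_act_mul]

lemma isEquivariant_iff_conj {η : Coch X Y i} : IsEquivariant η ↔ ∀ w, conj w η = η := by
  constructor
  · intro h w
    refine LinearMap.ext₂ fun y ω => ?_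
    rw [conj_apply, h, t_inv_smul_t]
  · intro h w y ω
    conv_rhs => rw [← h w, conj_apply, t_smul_t_inv]

/-- The average over `W` of a linear map `X ⊗ ⋀^i V → Y`. -/
def avg (η : Coch X Y i) : Coch X Y i :=
  (Fintype.card P.weylGroup : ℂ)⁻¹ • ∑ w : P.weylGroup, conj w η

lemma isEquivariant_avg (η : Coch X Y i) : IsEquivariant (avg η) := by
  rw [isEquivariant_iff_conj]
  intro w
  rw [avg, map_smul, map_sum]
  congr 1
  simp only [conj_conj]
  exact Fintype.sum_equiv (Equiv.mulRight w) _ _ fun _ => rfl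

lemma card_weylGroup_ne_zero : (Fintype.card P.weylGroup : ℂ) ≠ 0 :=
  Nat.cast_ne_zero.mpr Fintype.card_ne_zero

/-- The cochain of a morphism out of `ℍ ⊗_{ℂ[W]} (X ⊗ ⋀^i V)`. -/
def toCoch (f : koszul X i ⟶ Y) : Coch X Y i := (kmkLin X i 1).compr₂ (homC f)

lemma toCoch_apply (f : koszul X i ⟶ Y) (y : X) (ω : ⋀[ℂ]^i (Cplx V₀)) :
    toCoch f y ω = f.hom (kmk 1 y ω) := rfl

lemma isEquivariant_toCoch (f : koszul X i ⟶ Y) : IsEquivariant (toCoch f) := by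
  intro w y ω
  rw [toCoch_apply, toCoch_apply, ← map_smul, smul_kmk, mul_one, ← kmk_mul_t, one_mul]

lemma hom_ext_toCoch {f g : koszul X i ⟶ Y} (h : toCoch f = toCoch g) : f = g :=
  koszul_hom_ext fun y v => LinearMap.congr_fun₂ h y (exteriorPower.ιMulti ℂ i v)

lemma toCoch_kdesc (η : Coch X Y i) (hη : IsEquivariant η) : toCoch (kdesc X i η hη) = η :=
  LinearMap.ext₂ fun y ω => by rw [toCoch_apply, kdesc_kmk, one_smul]

/-- A `ℂ`-linear lift of a `W`-equivariant map becomes `W`-equivariant after averaging over `W`, and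
by Frobenius reciprocity this gives a lift of morphisms out of `ℍ ⊗_{ℂ[W]} (X ⊗ ⋀^i V)`. -/
instance projective_koszul : Projective (koszul X i) where
  factors {E Z} f q _ := by
    obtain ⟨s, hs⟩ := LinearMap.exists_rightInverse_of_surjective (homC q)
      (LinearMap.range_eq_top.mpr ((ModuleCat.epi_iff_surjective q).mp inferInstance))
    have hs' : ∀ z, q.hom (s z) = z := fun z => LinearMap.congr_fun hs z
    refine ⟨kdesc X i _ (isEquivariant_avg ((toCoch f).compr₂ s)), hom_ext_toCoch ?_⟩
    refine LinearMap.ext₂ fun y ω => ?_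
    rw [toCoch_apply, ModuleCat.hom_comp, LinearMap.comp_apply, kdesc_kmk, one_smul]
    have h1 : ∀ w : P.weylGroup, homC q (conj w ((toCoch f).compr₂ s) y ω) = toCoch f y ω := by
      intro w
      change q.hom (t k w⁻¹ • s (toCoch f (t k w • y) (exteriorPower.map i (act P w) ω))) = _
      rw [map_smul, hs', isEquivariant_toCoch, t_inv_smul_t]
    change homC q (avg _ y ω) = _
    rw [avg, LinearMap.smul_apply, LinearMap.smul_apply, map_smul, LinearMap.sum_apply,
      LinearMap.sum_apply, map_sum, Finset.sum_congr rfl fun w _ => h1 w, Finset.sum_const,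
      Finset.card_univ, ← Nat.cast_smul_eq_nsmul ℂ, smul_smul,
      inv_mul_cancel₀ card_weylGroup_ne_zero, one_smul]

end Averaging

section Resolution

open ModuleCat

variable {ι V₀ N : Type u} [Fintype ι] [AddCommGroup V₀] [Module ℝ V₀] [FiniteDimensional ℝ V₀]
  [AddCommGroup N] [Module ℝ N] {P : RootPairing ι ℝ V₀ N} [P.IsReduced] {S : SimpleSystem P}
  {k : Parameter S} {n : ℕ} (e : Module.Basis (Fin n) ℂ (Cplx V₀))
  (X : ModuleCat.{u} (GradedHeckeAlgebra k))

/-- The Koszul-type complex. -/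
def koszulComplex : ChainComplex (ModuleCat.{u} (GradedHeckeAlgebra k)) ℕ :=
  ChainComplex.of (koszul X) (koszulD e X) fun _ => koszulD_comp e

lemma koszulComplex_d (i : ℕ) : (koszulComplex e X).d (i + 1) i = koszulD e X i :=
  ChainComplex.of_d _ _ _

/-- The augmentation of the Koszul-type complex. -/
def koszulPi : koszulComplex e X ⟶ (ChainComplex.single₀ _).obj X :=
  (ChainComplex.toSingle₀Equiv _ _).symm ⟨koszulAug X, by
    rw [koszulComplex_d]; exact koszulD_comp_aug e⟩

lemma koszulPi_f_zero : (koszulPi e X).f 0 = koszulAug X :=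
  ChainComplex.toSingle₀Equiv_symm_apply_f_zero (C := koszulComplex e X) (koszulAug X) _

/-- The Koszul-type resolution. -/
def koszulRes : ProjectiveResolution X where
  complex := koszulComplex e X
  projective _ := projective_koszul
  π := koszulPi e X
  quasiIso := ⟨fun i => by
    cases i
    · rw [ChainComplex.quasiIsoAt₀_iff, ShortComplex.quasiIso_iff_of_zeros']
      · refine (ShortComplex.exact_and_epi_g_iff_of_iso
          (S₂ := ShortComplex.mk (koszulD e X 0) (koszulAug X) (koszulD_comp_aug e)) ?_).2
          ⟨?_, (ModuleCat.epi_iff_surjective _).mpr koszulAug_surjective⟩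
        · exact ShortComplex.isoMk (Iso.refl _) (Iso.refl _) (Iso.refl _)
            ((Category.id_comp _).trans ((koszulComplex_d e X 0).symm.trans
              (Category.comp_id _).symm))
            ((Category.id_comp _).trans ((koszulPi_f_zero e X).symm.trans
              (Category.comp_id _).symm))
        · rw [ShortComplex.moduleCat_exact_iff]
          exact fun z hz => koszulAug_exact e hz
      all_goals rfl
    · rename_i i
      rw [quasiIsoAt_iff_exactAt']
      · rw [HomologicalComplex.exactAt_iff' _ (i + 1 + 1) (i + 1) i (by simp) (by simp)]
        rw [ShortComplex.moduleCat_exact_iff]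
        intro z hz
        change ((koszulComplex e X).d (i + 1) i).hom z = 0 at hz
        change ∃ z', ((koszulComplex e X).d (i + 1 + 1) (i + 1)).hom z' = z
        rw [koszulComplex_d] at hz ⊢
        exact koszulD_exact e hz
      · apply ChainComplex.exactAt_succ_single_obj⟩

/-- The Koszul-type resolution, as a term of `KoszulResolution`. -/
def koszulResolution : KoszulResolution X where
  res := koszulRes e X
  iso i := Iso.refl _
  augmentation h y v := by
    change ((koszulPi e X).f 0).hom (koszulMk h y v) = _
    rw [koszulPi_f_zero]
    exact koszulAug_koszulMk h y v
  differential i h y v := by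
    change ((koszulComplex e X).d (i + 1) i).hom (koszulMk h y v) = _
    rw [koszulComplex_d]
    exact koszulD_koszulMk e h y v

end Resolution

/-! ### The shuffle coproduct -/

section Shuffle

variable {V : Type*} [AddCommGroup V] [Module ℂ V] {n i j : ℕ}

/-- The decomposition of `{0, …, n - 1}` into the first `i` and the last `j` elements. -/
def blocks (hij : i + j = n) : Fin i ⊕ Fin j ≃ Fin n := finSumFinEquiv.trans (finCongr hij)

/-- The shuffle coproduct: the component in `⋀^i V ⊗ ⋀^j V` of the coproduct of
`v_1 ∧ ⋯ ∧ v_n`. -/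
def shuffle (hij : i + j = n) (v : Fin n → V) : ⋀[ℂ]^i V ⊗[ℂ] ⋀[ℂ]^j V :=
  (exteriorPower.ιMulti ℂ i).domCoprod (exteriorPower.ιMulti ℂ j) (v ∘ blocks hij)

/-- The tensor `(v_1 ∧ ⋯ ∧ v_i) ⊗ (v_{i+1} ∧ ⋯ ∧ v_n)`. -/
def blockTensor (hij : i + j = n) (v : Fin n → V) : ⋀[ℂ]^i V ⊗[ℂ] ⋀[ℂ]^j V :=
  exteriorPower.ιMulti ℂ i (v ∘ blocks hij ∘ Sum.inl) ⊗ₜ[ℂ]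
    exteriorPower.ιMulti ℂ j (v ∘ blocks hij ∘ Sum.inr)

/-- In the sum over all permutations each shuffle is counted `i! j!` times. -/
lemma factorial_smul_shuffle (hij : i + j = n) (v : Fin n → V) :
    (i.factorial * j.factorial) • shuffle hij v = ∑ τ : Equiv.Perm (Fin n), Equiv.Perm.sign τ •
      blockTensor hij (v ∘ τ) := by
  have h := DFunLike.congr_fun (MultilinearMap.domCoprod_alternization_eq
    (exteriorPower.ιMulti ℂ i (M := V)) (exteriorPower.ιMulti ℂ j (M := V))) (v ∘ blocks hij)
  rw [Fintype.card_fin, Fintype.card_fin] at h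
  refine Eq.trans h.symm ?_
  rw [MultilinearMap.alternatization_apply]
  refine Fintype.sum_equiv (blocks hij).permCongr _ _ fun τ => ?_
  rw [Equiv.Perm.sign_permCongr]
  congr 1
  have h1 (m : Fin i ⊕ Fin j) : (v ∘ blocks hij) (τ m) =
      (v ∘ (blocks hij).permCongr τ) (blocks hij m) := by
    simp [Equiv.permCongr_apply]
  rw [MultilinearMap.domDomCongr_apply, MultilinearMap.domCoprod_apply, blockTensor]
  exact congrArg₂ (· ⊗ₜ[ℂ] ·) (congrArg (exteriorPower.ιMulti ℂ i) (funext fun m => h1 (.inl m)))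
    (congrArg (exteriorPower.ιMulti ℂ j) (funext fun m => h1 (.inr m)))

/-- Moving the `p`-th vector to the front in an alternating sum. -/
lemma sum_sign_succAbove {E : Type*} [AddCommGroup E] {N : ℕ} (p : Fin (N + 1))
    (v : Fin (N + 1) → V) (G : V → (Fin N → V) → E) :
    ∑ τ : Equiv.Perm (Fin (N + 1)), Equiv.Perm.sign τ • (-1 : ℤ) ^ (p : ℕ) •
      G (v (τ p)) (v ∘ τ ∘ p.succAbove) =
    ∑ τ : Equiv.Perm (Fin (N + 1)), Equiv.Perm.sign τ • G (v (τ 0)) (v ∘ τ ∘ Fin.succ) := by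
  refine Fintype.sum_equiv (Equiv.mulRight p.cycleRange.symm) _ _ fun τ => ?_
  have h1 : (τ * p.cycleRange.symm) 0 = τ p := by
    rw [Equiv.Perm.mul_apply, Fin.cycleRange_symm_zero]
  have h2 : v ∘ (τ * p.cycleRange.symm) ∘ Fin.succ = v ∘ τ ∘ p.succAbove := by
    funext m
    simp only [Function.comp_apply, Equiv.Perm.mul_apply, Fin.cycleRange_symm_succ]
  rw [Equiv.coe_mulRight, h1, h2, Equiv.Perm.sign_mul, Equiv.Perm.sign_symm, Fin.sign_cycleRange,
    mul_smul]
  rfl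

lemma blocks_inl_succAbove {N : ℕ} (hN : i + j = N) (hij : i + 1 + j = N + 1) (m : Fin (i + 1)) :
    blocks hij ∘ Sum.inl ∘ m.succAbove =
      (blocks hij (Sum.inl m)).succAbove ∘ blocks hN ∘ Sum.inl := by
  funext a
  ext
  simp only [blocks, Function.comp_apply, Equiv.trans_apply, finSumFinEquiv_apply_left,
    finCongr_apply, Fin.succAbove, Fin.lt_def, Fin.val_cast, Fin.val_castAdd, Fin.val_castSucc]
  split_ifs <;> simp

lemma blocks_inr_of_inl {N : ℕ} (hN : i + j = N) (hij : i + 1 + j = N + 1) (m : Fin (i + 1)) :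
    blocks hij ∘ Sum.inr = (blocks hij (Sum.inl m)).succAbove ∘ blocks hN ∘ Sum.inr := by
  funext a
  ext
  have := m.2
  simp only [blocks, Function.comp_apply, Equiv.trans_apply, finSumFinEquiv_apply_left,
    finSumFinEquiv_apply_right, finCongr_apply, Fin.succAbove, Fin.lt_def, Fin.val_cast,
    Fin.val_castAdd, Fin.val_castSucc, Fin.val_natAdd]
  split_ifs <;> simp <;> omega

lemma blocks_inr_succAbove {N : ℕ} (hN : i + j = N) (hij : i + (j + 1) = N + 1)
    (m : Fin (j + 1)) : blocks hij ∘ Sum.inr ∘ m.succAbove =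
      (blocks hij (Sum.inr m)).succAbove ∘ blocks hN ∘ Sum.inr := by
  funext a
  ext
  simp only [blocks, Function.comp_apply, Equiv.trans_apply,
    finSumFinEquiv_apply_right, finCongr_apply, Fin.succAbove, Fin.lt_def, Fin.val_cast,
    Fin.val_castSucc, Fin.val_natAdd]
  split_ifs <;> simp <;> omega

lemma blocks_inl_of_inr {N : ℕ} (hN : i + j = N) (hij : i + (j + 1) = N + 1) (m : Fin (j + 1)) :
    blocks hij ∘ Sum.inl = (blocks hij (Sum.inr m)).succAbove ∘ blocks hN ∘ Sum.inl := by
  funext a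
  ext
  have := a.2
  simp only [blocks, Function.comp_apply, Equiv.trans_apply, finSumFinEquiv_apply_left,
    finSumFinEquiv_apply_right, finCongr_apply, Fin.succAbove, Fin.lt_def, Fin.val_cast,
    Fin.val_castAdd, Fin.val_castSucc, Fin.val_natAdd]
  split_ifs <;> simp <;> omega

lemma zsmul_smul_assoc {E : Type*} [AddCommGroup E] [Module ℂ E] (a : ℤ) (c : ℂ) (z : E) :
    (a • c) • z = a • c • z := by
  rw [zsmul_eq_mul, mul_smul, Int.cast_smul_eq_zsmul]

lemma rTensor_contr_blockTensor {N : ℕ} (hN : i + j = N) (hij : i + 1 + j = N + 1)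
    (φ : Module.Dual ℂ V) (u : Fin (N + 1) → V) :
    (contr φ i).rTensor (⋀[ℂ]^j V) (blockTensor hij u) =
      ∑ m : Fin (i + 1), (-1 : ℤ) ^ (blocks hij (Sum.inl m) : ℕ) •
        (φ (u (blocks hij (Sum.inl m))) •
          blockTensor hN (u ∘ (blocks hij (Sum.inl m)).succAbove)) := by
  rw [blockTensor, LinearMap.rTensor_tmul, contr_ιMulti, TensorProduct.sum_tmul]
  refine Finset.sum_congr rfl fun m _ => ?_
  have h1 : (u ∘ blocks hij ∘ Sum.inl) ∘ m.succAbove =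
      (u ∘ (blocks hij (Sum.inl m)).succAbove) ∘ blocks hN ∘ Sum.inl := by
    rw [Function.comp_assoc, Function.comp_assoc, Function.comp_assoc, blocks_inl_succAbove hN]
  have h2 : u ∘ blocks hij ∘ Sum.inr =
      (u ∘ (blocks hij (Sum.inl m)).succAbove) ∘ blocks hN ∘ Sum.inr := by
    rw [Function.comp_assoc, blocks_inr_of_inl hN]
  have h3 : ((blocks hij (Sum.inl m) : Fin (N + 1)) : ℕ) = m := rfl
  rw [h1, h2, h3, ← TensorProduct.smul_tmul']
  exact zsmul_smul_assoc (E := ⋀[ℂ]^i V ⊗[ℂ] ⋀[ℂ]^j V) _ _ _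

lemma lTensor_contr_blockTensor {N : ℕ} (hN : i + j = N) (hij : i + (j + 1) = N + 1)
    (φ : Module.Dual ℂ V) (u : Fin (N + 1) → V) :
    (contr φ j).lTensor (⋀[ℂ]^i V) (blockTensor hij u) = (-1 : ℤ) ^ i •
      ∑ m : Fin (j + 1), (-1 : ℤ) ^ (blocks hij (Sum.inr m) : ℕ) •
        (φ (u (blocks hij (Sum.inr m))) •
          blockTensor hN (u ∘ (blocks hij (Sum.inr m)).succAbove)) := by
  rw [blockTensor, LinearMap.lTensor_tmul, contr_ιMulti, TensorProduct.tmul_sum, Finset.smul_sum]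
  refine Finset.sum_congr rfl fun m _ => ?_
  have h1 : (u ∘ blocks hij ∘ Sum.inr) ∘ m.succAbove =
      (u ∘ (blocks hij (Sum.inr m)).succAbove) ∘ blocks hN ∘ Sum.inr := by
    rw [Function.comp_assoc, Function.comp_assoc, Function.comp_assoc, blocks_inr_succAbove hN]
  have h2 : u ∘ blocks hij ∘ Sum.inl =
      (u ∘ (blocks hij (Sum.inr m)).succAbove) ∘ blocks hN ∘ Sum.inl := by
    rw [Function.comp_assoc, blocks_inl_of_inr hN]
  have h3 : ((blocks hij (Sum.inr m) : Fin (N + 1)) : ℕ) = i + m := rfl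
  have h4 : (-1 : ℤ) ^ i * (-1) ^ i = 1 := by rw [← mul_pow]; norm_num
  rw [h1, h2, h3, TensorProduct.tmul_smul, pow_add, smul_smul, ← mul_assoc, h4, one_mul]
  exact zsmul_smul_assoc (E := ⋀[ℂ]^i V ⊗[ℂ] ⋀[ℂ]^j V) _ _ _

/-- Contracting the first and the second factor of the shuffle coproduct gives the same result, up
to a sign: both are the shuffle coproduct of the contraction of `v_1 ∧ ⋯ ∧ v_n`. -/
lemma rTensor_contr_shuffle {N : ℕ} (hN : i + j = N) (hij : i + 1 + j = N + 1)
    (hij' : i + (j + 1) = N + 1) (φ : Module.Dual ℂ V) (v : Fin (N + 1) → V) :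
    (contr φ i).rTensor _ (shuffle hij v) =
      (-1 : ℤ) ^ i • (contr φ j).lTensor _ (shuffle hij' v) := by
  set A := ∑ τ : Equiv.Perm (Fin (N + 1)), Equiv.Perm.sign τ •
    (φ (v (τ 0)) • blockTensor hN (v ∘ τ ∘ Fin.succ)) with hA
  have key (p : Fin (N + 1)) : ∑ τ : Equiv.Perm (Fin (N + 1)), Equiv.Perm.sign τ •
      (-1 : ℤ) ^ (p : ℕ) • (φ (v (τ p)) • blockTensor hN ((v ∘ τ) ∘ p.succAbove)) = A :=
    sum_sign_succAbove p v fun a u => φ a • blockTensor hN u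
  have h1 : ((i + 1).factorial * j.factorial) • (contr φ i).rTensor _ (shuffle hij v) =
      (i + 1) • A := by
    rw [← map_nsmul, factorial_smul_shuffle, map_sum]
    simp only [Units.smul_def, map_zsmul, rTensor_contr_blockTensor hN, Finset.smul_sum]
    rw [Finset.sum_comm]
    refine (Finset.sum_congr rfl fun m _ => key (blocks hij (Sum.inl m))).trans ?_
    rw [Finset.sum_const, Finset.card_univ, Fintype.card_fin]
  have h2 : (i.factorial * (j + 1).factorial) • (contr φ j).lTensor _ (shuffle hij' v) =
      (j + 1) • (-1 : ℤ) ^ i • A := by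
    rw [← map_nsmul, factorial_smul_shuffle, map_sum]
    simp only [Units.smul_def, map_zsmul, lTensor_contr_blockTensor hN, Finset.smul_sum]
    rw [Finset.sum_comm]
    refine (Finset.sum_congr rfl fun m _ => ?_).trans
      (b := ∑ m : Fin (j + 1), (-1 : ℤ) ^ i • A) ?_
    · rw [← key (blocks hij' (Sum.inr m)), Finset.smul_sum]
      refine Finset.sum_congr rfl fun τ _ => ?_
      exact smul_comm _ _ _
    rw [Finset.sum_const, Finset.card_univ, Fintype.card_fin]
  have h3 : ((i.factorial * j.factorial : ℕ) : ℂ) • (contr φ i).rTensor _ (shuffle hij v) = A := by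
    refine smul_right_injective _
      (Nat.cast_ne_zero.mpr (Nat.succ_ne_zero i) : ((i + 1 : ℕ) : ℂ) ≠ 0) ?_
    simp only
    rw [smul_smul, ← Nat.cast_mul, Nat.cast_smul_eq_nsmul, Nat.cast_smul_eq_nsmul, ← h1,
      Nat.factorial_succ, mul_assoc]
  have h4 : ((i.factorial * j.factorial : ℕ) : ℂ) • (contr φ j).lTensor _ (shuffle hij' v) =
      (-1 : ℤ) ^ i • A := by
    refine smul_right_injective _
      (Nat.cast_ne_zero.mpr (Nat.succ_ne_zero j) : ((j + 1 : ℕ) : ℂ) ≠ 0) ?_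
    simp only
    rw [smul_smul, ← Nat.cast_mul, Nat.cast_smul_eq_nsmul, Nat.cast_smul_eq_nsmul, ← h2,
      Nat.factorial_succ, mul_left_comm]
  refine smul_right_injective _ (Nat.cast_ne_zero.mpr (Nat.mul_ne_zero i.factorial_ne_zero
    j.factorial_ne_zero) : ((i.factorial * j.factorial : ℕ) : ℂ) ≠ 0) ?_
  have h5 : (-1 : ℤ) ^ i * (-1) ^ i = 1 := by rw [← mul_pow]; norm_num
  simp only
  rw [h3, smul_comm, h4, smul_smul, h5, one_smul]

end Shuffle

/-! ### The wedge pairing of exterior powers -/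

section WedgeForm

variable {V : Type*} [AddCommGroup V] [Module ℂ V] {n i j : ℕ}

lemma factorial_mul_ne_zero (i j : ℕ) : ((i.factorial * j.factorial : ℕ) : ℂ) ≠ 0 :=
  Nat.cast_ne_zero.mpr (Nat.mul_ne_zero i.factorial_ne_zero j.factorial_ne_zero)

lemma factorial_smul_map_shuffle {E : Type*} [AddCommGroup E] [Module ℂ E] (hij : i + j = n)
    (v : Fin n → V) (L : ⋀[ℂ]^i V ⊗[ℂ] ⋀[ℂ]^j V →ₗ[ℂ] E) :
    ((i.factorial * j.factorial : ℕ) : ℂ) • L (shuffle hij v) =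
      ∑ τ : Equiv.Perm (Fin n), Equiv.Perm.sign τ • L (blockTensor hij (v ∘ τ)) := by
  rw [Nat.cast_smul_eq_nsmul, ← map_nsmul, factorial_smul_shuffle, map_sum]
  simp only [Units.smul_def, map_zsmul]

lemma map_shuffle (hij : i + j = n) (g : V →ₗ[ℂ] V) (v : Fin n → V) :
    TensorProduct.map (exteriorPower.map i g) (exteriorPower.map j g) (shuffle hij v) =
      shuffle hij (g ∘ v) := by
  refine smul_right_injective _ (factorial_mul_ne_zero i j) ?_
  refine (factorial_smul_map_shuffle
    (E := ⋀[ℂ]^i V ⊗[ℂ] ⋀[ℂ]^j V) hij v _).trans (Eq.trans ?_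
    (factorial_smul_map_shuffle (E := ⋀[ℂ]^i V ⊗[ℂ] ⋀[ℂ]^j V) hij (g ∘ v) LinearMap.id).symm)
  refine Finset.sum_congr rfl fun τ _ => ?_
  rw [blockTensor, TensorProduct.map_tmul, exteriorPower.map_apply_ιMulti,
    exteriorPower.map_apply_ιMulti]
  rfl

/-- The linear functional on bilinear forms on `⋀^i V × ⋀^j V`, `i + j = n`, that is given by the
identification `⋀^n V ≅ ℂ` dual to the wedge product: the value at the shuffle coproduct of
`e_1 ∧ ⋯ ∧ e_n`. -/
def wedgeForm (hij : i + j = n) (e : Fin n → V) :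
    (⋀[ℂ]^i V →ₗ[ℂ] ⋀[ℂ]^j V →ₗ[ℂ] ℂ) →ₗ[ℂ] ℂ where
  toFun q := TensorProduct.lift q (shuffle hij e)
  map_add' q q' := by
    rw [← LinearMap.add_apply]
    congr 1
    ext a b
    rfl
  map_smul' c q := by
    rw [RingHom.id_apply, ← LinearMap.smul_apply]
    congr 1
    ext a b
    rfl

lemma factorial_smul_wedgeForm (hij : i + j = n) (e : Fin n → V)
    (q : ⋀[ℂ]^i V →ₗ[ℂ] ⋀[ℂ]^j V →ₗ[ℂ] ℂ) :
    ((i.factorial * j.factorial : ℕ) : ℂ) * wedgeForm hij e q =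
      ∑ τ : Equiv.Perm (Fin n), ((Equiv.Perm.sign τ : ℤ) : ℂ) *
        q (exteriorPower.ιMulti ℂ i (e ∘ τ ∘ blocks hij ∘ Sum.inl))
          (exteriorPower.ιMulti ℂ j (e ∘ τ ∘ blocks hij ∘ Sum.inr)) := by
  rw [← smul_eq_mul]
  refine (factorial_smul_map_shuffle hij e (TensorProduct.lift q)).trans ?_
  refine Finset.sum_congr rfl fun τ _ => ?_
  rw [Units.smul_def, zsmul_eq_mul]
  rfl

/-- Naturality: an endomorphism of `V` acts on `⋀^n V` by its determinant. -/
lemma wedgeForm_map (hij : i + j = n) (e : Module.Basis (Fin n) ℂ V) (g : V →ₗ[ℂ] V)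
    (q : ⋀[ℂ]^i V →ₗ[ℂ] ⋀[ℂ]^j V →ₗ[ℂ] ℂ) :
    wedgeForm hij e (q.compl₁₂ (exteriorPower.map i g) (exteriorPower.map j g)) =
      LinearMap.det g * wedgeForm hij e q := by
  have h1 : TensorProduct.lift (q.compl₁₂ (exteriorPower.map i g) (exteriorPower.map j g)) =
      TensorProduct.lift q ∘ₗ
        TensorProduct.map (exteriorPower.map i g) (exteriorPower.map j g) := by
    ext a b
    rfl
  set f : V [⋀^Fin n]→ₗ[ℂ] ℂ := ((TensorProduct.lift q).compAlternatingMap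
    ((exteriorPower.ιMulti ℂ i).domCoprod (exteriorPower.ιMulti ℂ j))).domDomCongr (blocks hij)
    with hf
  have hf' (v : Fin n → V) : TensorProduct.lift q (shuffle hij v) = f v := rfl
  change TensorProduct.lift _ _ = _ * TensorProduct.lift q _
  rw [h1, LinearMap.comp_apply, map_shuffle, hf', hf', AlternatingMap.eq_smul_basis_det e f]
  simp only [AlternatingMap.smul_apply, smul_eq_mul]
  rw [e.det_comp]
  ring

/-- Contracting the first or the second argument gives the same result up to a sign: both amount to
evaluation on the coproduct of the contraction of `e_1 ∧ ⋯ ∧ e_n`. -/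
lemma wedgeForm_contr {N : ℕ} (hij : i + 1 + j = N + 1) (hij' : i + (j + 1) = N + 1)
    (e : Fin (N + 1) → V) (φ : Module.Dual ℂ V) (q : ⋀[ℂ]^i V →ₗ[ℂ] ⋀[ℂ]^j V →ₗ[ℂ] ℂ) :
    wedgeForm hij e (q ∘ₗ contr φ i) = (-1) ^ i * wedgeForm hij' e (q.compl₂ (contr φ j)) := by
  have h1 : TensorProduct.lift (q ∘ₗ contr φ i) =
      TensorProduct.lift q ∘ₗ (contr φ i).rTensor _ := by
    ext a b
    rfl
  have h2 : TensorProduct.lift (q.compl₂ (contr φ j)) =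
      TensorProduct.lift q ∘ₗ (contr φ j).lTensor _ := by
    ext a b
    rfl
  change TensorProduct.lift _ _ = _ * TensorProduct.lift _ _
  rw [h1, h2, LinearMap.comp_apply, LinearMap.comp_apply,
    rTensor_contr_shuffle (by omega) hij hij' φ, map_zsmul, zsmul_eq_mul]
  push_cast
  rfl

lemma comm_blockTensor (hij : i + j = n) (hji : j + i = n) (v : Fin n → V) :
    TensorProduct.comm ℂ _ _ (blockTensor hij v) =
      blockTensor hji (v ∘ (blocks hji).symm.trans ((Equiv.sumComm _ _).trans (blocks hij))) := by
  have h1 : v ∘ blocks hij ∘ Sum.inr =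
      (v ∘ (blocks hji).symm.trans ((Equiv.sumComm _ _).trans (blocks hij))) ∘
        blocks hji ∘ Sum.inl := by
    funext m; simp
  have h2 : v ∘ blocks hij ∘ Sum.inl =
      (v ∘ (blocks hji).symm.trans ((Equiv.sumComm _ _).trans (blocks hij))) ∘
        blocks hji ∘ Sum.inr := by
    funext m; simp
  rw [blockTensor, TensorProduct.comm_tmul, blockTensor, h1, h2]

lemma smul_units_smul_comm {E : Type*} [AddCommGroup E] [Module ℂ E] (c : ℂ) (ε : ℤˣ) (z : E) :
    c • ε • z = ε • c • z := by
  rw [Units.smul_def, Units.smul_def, smul_comm]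

/-- The shuffle coproduct is commutative up to a sign. -/
lemma comm_shuffle (hij : i + j = n) (hji : j + i = n) (v : Fin n → V) :
    ∃ ε : ℤˣ, TensorProduct.comm ℂ _ _ (shuffle hij v) = ε • shuffle hji v := by
  set ρ : Equiv.Perm (Fin n) := (blocks hji).symm.trans ((Equiv.sumComm _ _).trans (blocks hij))
  refine ⟨Equiv.Perm.sign ρ, ?_⟩
  refine smul_right_injective _ (factorial_mul_ne_zero i j) ?_
  refine (factorial_smul_map_shuffle (E := ⋀[ℂ]^j V ⊗[ℂ] ⋀[ℂ]^i V) hij v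
    (TensorProduct.comm ℂ _ _).toLinearMap).trans ?_
  simp only
  rw [smul_units_smul_comm (E := ⋀[ℂ]^j V ⊗[ℂ] ⋀[ℂ]^i V), mul_comm i.factorial]
  refine Eq.trans ?_ (congrArg _ (factorial_smul_map_shuffle
    (E := ⋀[ℂ]^j V ⊗[ℂ] ⋀[ℂ]^i V) hji v LinearMap.id).symm)
  rw [Finset.smul_sum]
  refine Fintype.sum_equiv (Equiv.mulRight ρ) _ _ fun τ => ?_
  rw [smul_smul, Equiv.coe_mulRight, Equiv.Perm.sign_mul, mul_comm, mul_assoc, Int.units_mul_self,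
    mul_one]
  exact congrArg _ (comm_blockTensor hij hji (v ∘ τ))

/-- The wedge pairing is perfect: the value of `χ` at a wedge `e_{f(1)} ∧ ⋯ ∧ e_{f(i)}` of distinct
basis vectors is detected by the functional `ω ↦ det (e_{f(1)} ∧ ⋯ ∧ e_{f(i)} ∧ ω)`. -/
lemma eq_zero_of_wedgeForm_left (hij : i + j = n) (e : Module.Basis (Fin n) ℂ V)
    (χ : ⋀[ℂ]^i V →ₗ[ℂ] ℂ)
    (h : ∀ ψ : ⋀[ℂ]^j V →ₗ[ℂ] ℂ, wedgeForm hij e ((LinearMap.mul ℂ ℂ).compl₁₂ χ ψ) = 0) :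
    χ = 0 := by
  classical
  refine exteriorPower.linearMap_ext (e.ext_alternating fun f hf => ?_)
  -- extend `f` to a bijection from the two blocks
  obtain ⟨σ, hσ⟩ : ∃ σ : Fin i ⊕ Fin j ≃ Fin n, ∀ m, σ (Sum.inl m) = f m := by
    have hc : Fintype.card {b // b ∉ Set.range f} = Fintype.card (Fin j) := by
      have h1 : Fintype.card {b // b ∈ Set.range f} = i :=
        (Fintype.card_congr (Equiv.ofInjective f hf)).symm.trans (Fintype.card_fin i)
      rw [Fintype.card_subtype_compl, Fintype.card_fin, Fintype.card_fin, h1]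
      omega
    refine ⟨(Equiv.sumCongr (Equiv.ofInjective f hf) (Fintype.equivOfCardEq hc).symm).trans
      (Equiv.Set.sumCompl (Set.range f)), fun m => ?_⟩
    simp only [Equiv.trans_apply, Equiv.sumCongr_apply, Sum.map_inl]
    exact Equiv.Set.sumCompl_apply_inl _ _
  set u : Fin i ⊕ Fin j → V := e ∘ σ with hu
  set d := (e.reindex σ.symm).det with hd
  have hdu : d u = 1 := by
    have : u = e.reindex σ.symm := by funext a; simp [hu]
    rw [this, hd, Module.Basis.det_self]
  -- `ψ(ω) = det (u_left ∧ ω)`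
  set ψ : ⋀[ℂ]^j V →ₗ[ℂ] ℂ := exteriorPower.alternatingMapLinearEquiv
    (AlternatingMap.mk (MultilinearMap.currySum d.toMultilinearMap (u ∘ Sum.inl)) (by
      intro v a b hab hne
      exact d.map_eq_zero_of_eq _ (i := Sum.inr a) (j := Sum.inr b) hab
        (fun h => hne (Sum.inr_injective h)))) with hψ
  have hψ' (v : Fin j → V) : ψ (exteriorPower.ιMulti ℂ j v) = d (Sum.elim (u ∘ Sum.inl) v) := by
    rw [hψ, exteriorPower.alternatingMapLinearEquiv_apply_ιMulti]
    rfl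
  set τ₀ : Equiv.Perm (Fin n) := (blocks hij).symm.trans σ with hτ₀
  set χ₀ : ℂ := χ (exteriorPower.ιMulti ℂ i (u ∘ Sum.inl)) with hχ₀
  -- up to a global sign, the sum over permutations is a sum over permutations of the two blocks
  have h0 : ∑ ρ : Equiv.Perm (Fin i ⊕ Fin j), ((Equiv.Perm.sign ρ : ℤ) : ℂ) *
      (χ (exteriorPower.ιMulti ℂ i (u ∘ ρ ∘ Sum.inl)) *
        d (Sum.elim (u ∘ Sum.inl) (u ∘ ρ ∘ Sum.inr))) = 0 := by
    have h1 := factorial_smul_wedgeForm hij e ((LinearMap.mul ℂ ℂ).compl₁₂ χ ψ)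
    rw [h ψ, mul_zero] at h1
    have h2 : ((Equiv.Perm.sign τ₀ : ℤ) : ℂ) ≠ 0 := by simp
    refine (mul_eq_zero.mp (Eq.trans ?_ h1.symm)).resolve_left h2
    rw [Finset.mul_sum]
    refine Fintype.sum_equiv ((blocks hij).permCongr.trans (Equiv.mulLeft τ₀)) _ _ fun ρ => ?_
    have h3 : (e : Fin n → V) ∘ (τ₀ * (blocks hij).permCongr ρ) ∘ blocks hij = u ∘ ρ := by
      funext m
      simp [hτ₀, hu, Equiv.permCongr_apply]
    rw [Equiv.trans_apply, Equiv.coe_mulLeft, Equiv.Perm.sign_mul, Equiv.Perm.sign_permCongr,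
      LinearMap.compl₁₂_apply, ← hψ', LinearMap.mul_apply', Units.val_mul, Int.cast_mul, mul_assoc]
    have h4 : (e : Fin n → V) ∘ (τ₀ * (blocks hij).permCongr ρ) ∘ blocks hij ∘ Sum.inl =
        u ∘ ρ ∘ Sum.inl := congrArg (· ∘ Sum.inl) h3
    have h5 : (e : Fin n → V) ∘ (τ₀ * (blocks hij).permCongr ρ) ∘ blocks hij ∘ Sum.inr =
        u ∘ ρ ∘ Sum.inr := congrArg (· ∘ Sum.inr) h3
    rw [h4, h5]
  -- the terms that do not vanish are all equal to the term of the identity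
  have hterm (ρ : Equiv.Perm (Fin i ⊕ Fin j)) : ((Equiv.Perm.sign ρ : ℤ) : ℂ) *
      (χ (exteriorPower.ιMulti ℂ i (u ∘ ρ ∘ Sum.inl)) *
        d (Sum.elim (u ∘ Sum.inl) (u ∘ ρ ∘ Sum.inr))) =
      (if ρ ∈ (Equiv.Perm.sumCongrHom (Fin i) (Fin j)).range then 1 else 0) * χ₀ := by
    split_ifs with hρ
    · obtain ⟨⟨a, b⟩, rfl⟩ := hρ
      have h1 : Sum.elim (u ∘ Sum.inl) (u ∘ Equiv.Perm.sumCongr a b ∘ Sum.inr) =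
          u ∘ Equiv.Perm.sumCongr 1 b := by
        funext m
        rcases m with m | m <;> simp
      have h2 : u ∘ Equiv.Perm.sumCongr a b ∘ Sum.inl = (u ∘ Sum.inl) ∘ a := by
        funext m
        simp
      have h3 (σ : ℤˣ) : ((σ : ℤ) : ℂ) * ((σ : ℤ) : ℂ) = 1 := by
        rw [← Int.cast_mul, ← Units.val_mul, Int.units_mul_self]; simp
      simp only [Equiv.Perm.sumCongrHom_apply]
      rw [h1, h2, AlternatingMap.map_perm, AlternatingMap.map_perm, hdu, Equiv.Perm.sign_sumCongr,
        Equiv.Perm.sign_sumCongr, Units.smul_def, Units.smul_def, map_zsmul, zsmul_eq_mul,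
        zsmul_eq_mul, Equiv.Perm.sign_one, one_mul, Units.val_mul, Int.cast_mul, mul_one, one_mul]
      linear_combination (χ₀ * ((Equiv.Perm.sign b : ℤ) : ℂ) * ((Equiv.Perm.sign b : ℤ) : ℂ)) *
        h3 (Equiv.Perm.sign a) + χ₀ * h3 (Equiv.Perm.sign b)
    · obtain ⟨b, a, hab⟩ : ∃ b a, ρ (Sum.inr b) = Sum.inl a := by
        by_contra! hne
        refine hρ (Equiv.Perm.mem_sumCongrHom_range_of_perm_mapsTo_inl
          ((Equiv.Perm.perm_mapsTo_inl_iff_mapsTo_inr ρ).mpr ?_))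
        rintro _ ⟨b, rfl⟩
        rcases hb : ρ (Sum.inr b) with a | b'
        · exact absurd hb (hne b a)
        · exact ⟨b', rfl⟩
      rw [d.map_eq_zero_of_eq _ (i := Sum.inl a) (j := Sum.inr b) (by simp [hab]) (by simp),
        mul_zero, mul_zero, zero_mul]
  rw [Finset.sum_congr rfl fun ρ _ => hterm ρ, ← Finset.sum_mul, Finset.sum_boole] at h0
  have h6 := (mul_eq_zero.mp h0).resolve_left (Nat.cast_ne_zero.mpr
    (Finset.card_ne_zero_of_mem (a := 1) (Finset.mem_filter.mpr ⟨Finset.mem_univ _, one_mem _⟩)))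
  have h7 : u ∘ Sum.inl = fun m => e (f m) := by
    funext m
    simp [hu, hσ]
  rw [hχ₀, h7] at h6
  simpa using! h6

lemma eq_zero_of_wedgeForm_right (hij : i + j = n) (e : Module.Basis (Fin n) ℂ V)
    (ψ : ⋀[ℂ]^j V →ₗ[ℂ] ℂ)
    (h : ∀ χ : ⋀[ℂ]^i V →ₗ[ℂ] ℂ, wedgeForm hij e ((LinearMap.mul ℂ ℂ).compl₁₂ χ ψ) = 0) :
    ψ = 0 := by
  refine eq_zero_of_wedgeForm_left ((add_comm j i).trans hij) e ψ fun χ => ?_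
  obtain ⟨ε, hε⟩ := comm_shuffle ((add_comm j i).trans hij) hij e
  have h1 : TensorProduct.lift ((LinearMap.mul ℂ ℂ).compl₁₂ ψ χ) =
      TensorProduct.lift ((LinearMap.mul ℂ ℂ).compl₁₂ χ ψ) ∘ₗ
        (TensorProduct.comm ℂ _ _).toLinearMap := by
    ext a b
    exact mul_comm _ _
  change TensorProduct.lift _ _ = _
  rw [h1, LinearMap.comp_apply, LinearEquiv.coe_coe, hε, Units.smul_def, map_zsmul]
  exact (congrArg _ (h χ)).trans (smul_zero _)

end WedgeForm

/-! ### Traces and duals of modules -/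

section Trace

/-- The contraction of a bilinear form `B` on `X^* × X` is compatible with the transpose of a linear
map; in particular it does not depend on the choice of a basis. -/
lemma sum_coord_comp {E F : Type*} [AddCommGroup E] [Module ℂ E] [AddCommGroup F] [Module ℂ F]
    {r r' : ℕ} (b : Module.Basis (Fin r) ℂ E) (b' : Module.Basis (Fin r') ℂ F) (φ : F →ₗ[ℂ] E)
    (B : Module.Dual ℂ F →ₗ[ℂ] E →ₗ[ℂ] ℂ) :
    ∑ s, B (b'.coord s) (φ (b' s)) = ∑ s, B (b.coord s ∘ₗ φ) (b s) := by
  have h1 (s : Fin r') : φ (b' s) = ∑ t, b.coord t (φ (b' s)) • b t :=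
    (b.sum_repr (φ (b' s))).symm
  have h2 (t : Fin r) : b.coord t ∘ₗ φ = ∑ s, b.coord t (φ (b' s)) • b'.coord s := by
    refine b'.ext fun s => ?_
    simp [Finsupp.single_apply]
  simp only [h2, map_sum, map_smul, LinearMap.sum_apply, LinearMap.smul_apply]
  rw [Finset.sum_comm]
  refine Finset.sum_congr rfl fun s _ => ?_
  conv_lhs => rw [h1 s, map_sum]
  simp only [map_smul]

end Trace

section Duality

open ModuleCat

variable {ι V₀ N : Type u} [Fintype ι] [AddCommGroup V₀] [Module ℝ V₀] [FiniteDimensional ℝ V₀]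
  [AddCommGroup N] [Module ℝ N] {P : RootPairing ι ℝ V₀ N} {S : SimpleSystem P}
  {k : Parameter S}

/-- A linear functional on `X`, as an element of the dual of `X`, as a linear equivalence. -/
def toDualLin {A : Type u} [Ring A] [Algebra ℂ A] (σ : A →ₐ[ℂ] Aᵐᵒᵖ) (X : ModuleCat.{u} A) :
    Module.Dual ℂ X ≃ₗ[ℂ] (dualFunctor σ).obj (.op X) where
  toFun f := toDual σ X f
  invFun f := f
  map_add' _ _ := rfl
  map_smul' c f := by
    change toDual σ X (c • f) = algebraMap ℂ A c • toDual σ X f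
    refine LinearMap.ext (R := ℂ) fun (y : X) => ?_
    change c • f y = f ((σ (algebraMap ℂ A c)).unop • y)
    rw [AlgHom.commutes, MulOpposite.algebraMap_apply, MulOpposite.unop_op]
    exact (map_smul f c y).symm
  left_inv _ := rfl
  right_inv _ := rfl

lemma smul_kappa {Y : ModuleCat.{u} (GradedHeckeAlgebra k)} (h : GradedHeckeAlgebra k) (y : Y) :
    h • kappa y = kappa (im k h • y) := rfl

lemma toDual_star_smul [P.IsReduced] {X : ModuleCat.{u} (GradedHeckeAlgebra k)}
    (h : GradedHeckeAlgebra k) (f : Module.Dual ℂ X) :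
    h • toDualLin (star k) X f = toDualLin (star k) X (f ∘ₗ actBy X (star k h).unop) := rfl

variable (k) in
/-- The pairing of `ι(Y)^•` and `Y`. -/
def evalIm (Y : ModuleCat.{u} (GradedHeckeAlgebra k)) :
    (imBulletDual k).obj (.op Y) →ₗ[ℂ] Y →ₗ[ℂ] ℂ :=
  LinearMap.mk₂ ℂ (fun f y => evalDual (bullet k) f (kappa y)) (fun _ _ _ => rfl)
    (fun c f y => LinearMap.congr_fun ((toDualLin (bullet k) ((imTwist k).obj Y)).symm.map_smul c f)
      (kappa y))
    (fun f y y' => map_add ((toDualLin (bullet k) ((imTwist k).obj Y)).symm f) (kappa y) (kappa y'))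
    (fun c f y => by
      have h : kappa (c • y) = c • kappa y := by
        change kappa (algebraMap ℂ (GradedHeckeAlgebra k) c • y) =
          algebraMap ℂ (GradedHeckeAlgebra k) c • kappa y
        rw [smul_kappa, AlgHom.commutes]
      rw [h]
      exact map_smul ((toDualLin (bullet k) ((imTwist k).obj Y)).symm f) c (kappa y))

variable {Y : ModuleCat.{u} (GradedHeckeAlgebra k)}

lemma evalIm_smul (h : GradedHeckeAlgebra k) (f : (imBulletDual k).obj (.op Y)) (y : Y) :
    evalIm k Y (h • f) y = evalIm k Y f (im k (bullet k h).unop • y) := rfl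

lemma evalIm_t_smul (w : P.weylGroup) (f : (imBulletDual k).obj (.op Y)) (y : Y) :
    evalIm k Y (t k w • f) y = sgn P w⁻¹ * evalIm k Y f (t k w⁻¹ • y) := by
  rw [evalIm_smul, bullet, lift_t, MulOpposite.unop_op, im, lift_t, smul_assoc, map_smul,
    smul_eq_mul]

lemma evalIm_x_smul (v : Cplx V₀) (f : (imBulletDual k).obj (.op Y)) (y : Y) :
    evalIm k Y (x k v • f) y = - evalIm k Y f (x k v • y) := by
  rw [evalIm_smul, bullet, lift_x, MulOpposite.unop_op, im, lift_x, neg_smul, map_neg]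

/-- The pairing of `ι(Y)^•` and `Y` is separating in the first variable. -/
lemma evalIm_ext {f g : (imBulletDual k).obj (.op Y)} (h : ∀ y, evalIm k Y f y = evalIm k Y g y) :
    f = g :=
  (toDualLin (bullet k) ((imTwist k).obj Y)).symm.injective
    (LinearMap.ext fun (y : (imTwist k).obj Y) => h (show Y from y))

lemma exists_evalIm (g : Module.Dual ℂ Y) :
    ∃ f : (imBulletDual k).obj (.op Y), evalIm k Y f = g := by
  refine ⟨toDual (bullet k) ((imTwist k).obj Y)
    { toFun := fun y => g (show Y from y)
      map_add' := fun y y' => map_add g (show Y from y) (show Y from y')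
      map_smul' := fun c y => ?_ }, rfl⟩
  have h : (show Y from c • y) = c • (show Y from y) := by
    change im k (algebraMap ℂ (GradedHeckeAlgebra k) c) • (show Y from y) =
      algebraMap ℂ (GradedHeckeAlgebra k) c • (show Y from y)
    rw [AlgHom.commutes]
  exact (congrArg g h).trans (map_smul g c _)

lemma star_t [P.IsReduced] (w : P.weylGroup) : (star k (t k w)).unop = t k w⁻¹ := by
  rw [star, lift_t, MulOpposite.unop_op]

/-- The anti-involution `*` on `V`, in terms of the reflections. -/
lemma exists_star_x [P.IsReduced] : ∃ c : ι → ℂ, ∀ v : Cplx V₀, (star k (x k v)).unop =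
    - x k v - ∑ γ, (c γ * pair P γ v) • t k (refl P γ) := by
  obtain ⟨c, hc⟩ := exists_t_mul_x k S.longest
  refine ⟨c, fun v => ?_⟩
  have h1 : act P S.longest (- act P S.longest⁻¹ v) = - v := by
    rw [map_neg, ← act_mul, mul_inv_cancel, act_one]
  rw [star, lift_x, MulOpposite.unop_op, hc, mul_assoc, ← t_mul, mul_inv_cancel, t_one, mul_one,
    h1, x_neg, sub_eq_add_neg, ← Finset.sum_neg_distrib]
  congr 1
  refine Finset.sum_congr rfl fun γ _ => ?_
  rw [map_neg, mul_neg, neg_smul]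

end Duality

/-! ### The pairing of values of cochains -/

section ValuePairing

open ModuleCat

variable {ι V₀ N : Type u} [Fintype ι] [AddCommGroup V₀] [Module ℝ V₀] [FiniteDimensional ℝ V₀]
  [AddCommGroup N] [Module ℝ N] {P : RootPairing ι ℝ V₀ N} {S : SimpleSystem P}
  {k : Parameter S} {n i j : ℕ} (hij : i + j = n) (e : Module.Basis (Fin n) ℂ (Cplx V₀))
  {Y : ModuleCat.{u} (GradedHeckeAlgebra k)}

/-- The pairing of linear maps `⋀^i V → Y` and `⋀^j V → ι(Y)^•`, `i + j = n`, that is induced by the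
pairing of `Y` and `ι(Y)^•` and by the wedge product. -/
def valuePairing : (⋀[ℂ]^i (Cplx V₀) →ₗ[ℂ] Y) →ₗ[ℂ]
    (⋀[ℂ]^j (Cplx V₀) →ₗ[ℂ] (imBulletDual k).obj (.op Y)) →ₗ[ℂ] ℂ :=
  LinearMap.mk₂ ℂ (fun A A' => wedgeForm hij e (((evalIm k Y).flip ∘ₗ A).compl₂ A'))
    (fun A B A' => by
      rw [← map_add]; exact congrArg _ (LinearMap.ext₂ fun _ _ => map_add (evalIm k Y _) _ _))
    (fun c A A' => by
      rw [← map_smul]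
      exact congrArg _ (LinearMap.ext₂ fun _ _ => map_smul (evalIm k Y _) _ _))
    (fun A A' B' => by
      rw [← map_add]
      exact congrArg _
        (LinearMap.ext₂ fun _ _ => LinearMap.congr_fun (map_add (evalIm k Y) _ _) _))
    (fun c A A' => by
      rw [← map_smul]
      exact congrArg _
        (LinearMap.ext₂ fun _ _ => LinearMap.congr_fun (map_smul (evalIm k Y) _ _) _))

lemma valuePairing_apply (A : ⋀[ℂ]^i (Cplx V₀) →ₗ[ℂ] Y)
    (A' : ⋀[ℂ]^j (Cplx V₀) →ₗ[ℂ] (imBulletDual k).obj (.op Y)) :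
    valuePairing hij e A A' = wedgeForm hij e (((evalIm k Y).flip ∘ₗ A).compl₂ A') := rfl

lemma valuePairing_t (w : P.weylGroup) (A : ⋀[ℂ]^i (Cplx V₀) →ₗ[ℂ] Y)
    (A' : ⋀[ℂ]^j (Cplx V₀) →ₗ[ℂ] (imBulletDual k).obj (.op Y)) :
    valuePairing hij e (actBy Y (t k w) ∘ₗ A) (actBy _ (t k w) ∘ₗ A') =
      sgn P w⁻¹ * valuePairing hij e A A' := by
  rw [valuePairing_apply, valuePairing_apply, ← smul_eq_mul, ← map_smul]
  congr 1
  refine LinearMap.ext₂ fun a b => ?_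
  change evalIm k Y (t k w • A' b) (t k w • A a) = sgn P w⁻¹ * evalIm k Y (A' b) (A a)
  rw [evalIm_t_smul, t_inv_smul_t]

lemma sgn_eq_det (w : P.weylGroup) : sgn P w = LinearMap.det (act P w) := by
  rw [act, LinearMap.det_baseChange]
  rfl

lemma valuePairing_act (w : P.weylGroup) (A : ⋀[ℂ]^i (Cplx V₀) →ₗ[ℂ] Y)
    (A' : ⋀[ℂ]^j (Cplx V₀) →ₗ[ℂ] (imBulletDual k).obj (.op Y)) :
    valuePairing hij e (A ∘ₗ exteriorPower.map i (act P w))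
      (A' ∘ₗ exteriorPower.map j (act P w)) = sgn P w * valuePairing hij e A A' := by
  rw [sgn_eq_det, valuePairing_apply, valuePairing_apply, ← wedgeForm_map]
  rfl

lemma sgn_mul_self [P.IsReduced] (S : SimpleSystem P) (w : P.weylGroup) :
    sgn P w * sgn P w = 1 := by
  induction w using S.weyl_induction with
  | one => rw [map_one, one_mul]
  | mul α _ w ih => rw [map_mul, sgn_refl, mul_mul_mul_comm, ih]; norm_num

/-- The pairing is invariant under `W`: the sign in the action on `ι(Y)^•` cancels the determinant
of the action on `V`. -/
lemma valuePairing_conj [P.IsReduced] (w : P.weylGroup) (A : ⋀[ℂ]^i (Cplx V₀) →ₗ[ℂ] Y)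
    (A' : ⋀[ℂ]^j (Cplx V₀) →ₗ[ℂ] (imBulletDual k).obj (.op Y)) :
    valuePairing hij e (actBy Y (t k w⁻¹) ∘ₗ A ∘ₗ exteriorPower.map i (act P w))
      (actBy _ (t k w⁻¹) ∘ₗ A' ∘ₗ exteriorPower.map j (act P w)) = valuePairing hij e A A' := by
  rw [valuePairing_t, valuePairing_act, inv_inv, ← mul_assoc,
    sgn_mul_self S, one_mul]

lemma valuePairing_x (v : Cplx V₀) (A : ⋀[ℂ]^i (Cplx V₀) →ₗ[ℂ] Y)
    (A' : ⋀[ℂ]^j (Cplx V₀) →ₗ[ℂ] (imBulletDual k).obj (.op Y)) :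
    valuePairing hij e (actBy Y (x k v) ∘ₗ A) A' =
      - valuePairing hij e A (actBy _ (x k v) ∘ₗ A') := by
  rw [valuePairing_apply, valuePairing_apply, ← map_neg]
  congr 1
  refine LinearMap.ext₂ fun a b => ?_
  change evalIm k Y (A' b) (x k v • A a) = - evalIm k Y (x k v • A' b) (A a)
  rw [evalIm_x_smul, neg_neg]

lemma valuePairing_contr {N : ℕ} (hij : i + 1 + j = N + 1) (hij' : i + (j + 1) = N + 1)
    (e : Module.Basis (Fin (N + 1)) ℂ (Cplx V₀)) (φ : Module.Dual ℂ (Cplx V₀))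
    (A : ⋀[ℂ]^i (Cplx V₀) →ₗ[ℂ] Y)
    (A' : ⋀[ℂ]^j (Cplx V₀) →ₗ[ℂ] (imBulletDual k).obj (.op Y)) :
    valuePairing hij e (A ∘ₗ contr φ i) A' =
      (-1) ^ i * valuePairing hij' e A (A' ∘ₗ contr φ j) :=
  wedgeForm_contr hij hij' e φ (((evalIm k Y).flip ∘ₗ A).compl₂ A')

lemma factorial_mul_valuePairing (A : ⋀[ℂ]^i (Cplx V₀) →ₗ[ℂ] Y)
    (A' : ⋀[ℂ]^j (Cplx V₀) →ₗ[ℂ] (imBulletDual k).obj (.op Y)) :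
    ((i.factorial * j.factorial : ℕ) : ℂ) * valuePairing hij e A A' =
      ∑ τ : Equiv.Perm (Fin n), ((Equiv.Perm.sign τ : ℤ) : ℂ) *
        evalDual (bullet k)
          (A' (exteriorPower.ιMulti ℂ j fun m => e (τ (Fin.cast hij (Fin.natAdd i m)))))
          (kappa (A (exteriorPower.ιMulti ℂ i fun m => e (τ (Fin.cast hij (Fin.castAdd j m)))))) :=
  factorial_smul_wedgeForm hij e _

lemma eq_zero_of_valuePairing_left (A : ⋀[ℂ]^i (Cplx V₀) →ₗ[ℂ] Y)
    (h : ∀ (ψ : ⋀[ℂ]^j (Cplx V₀) →ₗ[ℂ] ℂ) (f : (imBulletDual k).obj (.op Y)),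
      valuePairing hij e A (ψ.smulRight f) = 0) : A = 0 := by
  refine LinearMap.ext fun ω => ?_
  refine (Module.forall_dual_apply_eq_zero_iff ℂ (A ω)).mp fun g => ?_
  obtain ⟨f, rfl⟩ := exists_evalIm g
  have h1 := eq_zero_of_wedgeForm_left hij e (evalIm k Y f ∘ₗ A) fun ψ => by
    rw [← h ψ f, valuePairing_apply]
    congr 1
    refine LinearMap.ext₂ fun a b => ?_
    change evalIm k Y f (A a) * ψ b = evalIm k Y (ψ b • f) (A a)
    rw [map_smul, LinearMap.smul_apply, smul_eq_mul, mul_comm]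
  exact LinearMap.congr_fun h1 ω

lemma eq_zero_of_valuePairing_right
    (A' : ⋀[ℂ]^j (Cplx V₀) →ₗ[ℂ] (imBulletDual k).obj (.op Y))
    (h : ∀ (χ : ⋀[ℂ]^i (Cplx V₀) →ₗ[ℂ] ℂ) (y : Y),
      valuePairing hij e (χ.smulRight y) A' = 0) : A' = 0 := by
  refine LinearMap.ext fun ω => evalIm_ext fun y => ?_
  have h1 := eq_zero_of_wedgeForm_right hij e ((evalIm k Y).flip y ∘ₗ A') fun χ => by
    rw [← h χ y, valuePairing_apply]
    congr 1
    refine LinearMap.ext₂ fun a b => ?_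
    change χ a * evalIm k Y (A' b) y = evalIm k Y (A' b) (χ a • y)
    rw [map_smul, smul_eq_mul]
  exact (LinearMap.congr_fun h1 ω).trans (LinearMap.congr_fun (map_zero (evalIm k Y)) y).symm

/-- The pairing is natural in `Y`. -/
lemma valuePairing_map {Y' : ModuleCat.{u} (GradedHeckeAlgebra k)} (φ : Y ⟶ Y')
    (A : ⋀[ℂ]^i (Cplx V₀) →ₗ[ℂ] Y)
    (A' : ⋀[ℂ]^j (Cplx V₀) →ₗ[ℂ] (imBulletDual k).obj (.op Y')) :
    valuePairing hij e (homC φ ∘ₗ A) A' =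
      valuePairing hij e A (homC ((imBulletDual k).map φ.op) ∘ₗ A') := rfl

end ValuePairing

/-! ### The pairing of cochains -/

section CochainPairing

open ModuleCat

variable {ι V₀ N : Type u} [Fintype ι] [AddCommGroup V₀] [Module ℝ V₀] [FiniteDimensional ℝ V₀]
  [AddCommGroup N] [Module ℝ N] {P : RootPairing ι ℝ V₀ N} [P.IsReduced] {S : SimpleSystem P}
  {k : Parameter S} {n i j : ℕ}

section Differential

variable {X Y : ModuleCat.{u} (GradedHeckeAlgebra k)} (e : Module.Basis (Fin n) ℂ (Cplx V₀))

/-- The differential of the complex of linear maps `X ⊗ ⋀^i V → Y`. -/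
def cochD : Coch X Y i →ₗ[ℂ] Coch X Y (i + 1) where
  toFun η := ∑ l, ((η.compr₂ (actBy Y (x k (e l)))).compl₂ (contr (e.coord l) i) -
    (η ∘ₗ actBy X (x k (e l))).compl₂ (contr (e.coord l) i))
  map_add' η η' := by
    rw [← Finset.sum_add_distrib]
    refine Finset.sum_congr rfl fun l _ => LinearMap.ext₂ fun y ω => ?_
    change x k (e l) • (η y (contr (e.coord l) i ω) + η' y (contr (e.coord l) i ω)) -
      (η (x k (e l) • y) (contr (e.coord l) i ω) + η' (x k (e l) • y) (contr (e.coord l) i ω)) =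
      (x k (e l) • η y (contr (e.coord l) i ω) - η (x k (e l) • y) (contr (e.coord l) i ω)) +
      (x k (e l) • η' y (contr (e.coord l) i ω) - η' (x k (e l) • y) (contr (e.coord l) i ω))
    rw [smul_add]
    abel
  map_smul' c η := by
    rw [RingHom.id_apply, Finset.smul_sum]
    refine Finset.sum_congr rfl fun l _ => LinearMap.ext₂ fun y ω => ?_
    change actBy Y (x k (e l)) (c • η y (contr (e.coord l) i ω)) -
      c • η (x k (e l) • y) (contr (e.coord l) i ω) =
      c • (actBy Y (x k (e l)) (η y (contr (e.coord l) i ω)) -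
        η (x k (e l) • y) (contr (e.coord l) i ω))
    rw [map_smul, smul_sub]

lemma cochD_apply (η : Coch X Y i) (y : X) : cochD e η y =
    ∑ l, (actBy Y (x k (e l)) ∘ₗ η y ∘ₗ contr (e.coord l) i -
      η (x k (e l) • y) ∘ₗ contr (e.coord l) i) := by
  exact LinearMap.sum_apply _ _ _

lemma toCoch_koszulD_comp (f : koszul X i ⟶ Y) :
    toCoch (koszulD e X i ≫ f) = cochD e (toCoch f) := by
  refine LinearMap.ext₂ fun y ω => ?_
  rw [toCoch_apply, ModuleCat.hom_comp, LinearMap.comp_apply, koszulD_kmk, map_sum, cochD_apply,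
    LinearMap.sum_apply]
  refine Finset.sum_congr rfl fun l _ => ?_
  rw [koszulStep_apply, map_sub, one_mul, ← mul_one (x k (e l)), ← smul_kmk, map_smul, mul_one]
  rfl

end Differential

section Pairing

variable (hij : i + j = n) (e : Module.Basis (Fin n) ℂ (Cplx V₀))
  {X Y : ModuleCat.{u} (GradedHeckeAlgebra k)}

/-- The bilinear form on `X^* × X` obtained from two cochains by pairing their values. -/
def traceForm (η : Coch X Y i)
    (η' : Coch ((starDual k).obj (.op X)) ((imBulletDual k).obj (.op Y)) j) :
    Module.Dual ℂ X →ₗ[ℂ] X →ₗ[ℂ] ℂ :=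
  ((valuePairing hij e).compl₁₂ η (η' ∘ₗ (toDualLin (star k) X).toLinearMap)).flip

lemma traceForm_apply (η : Coch X Y i)
    (η' : Coch ((starDual k).obj (.op X)) ((imBulletDual k).obj (.op Y)) j)
    (f : Module.Dual ℂ X) (y : X) : traceForm hij e η η' f y =
      valuePairing hij e (η y) (η' (toDualLin (star k) X f)) := rfl

lemma traceForm_conj (w : P.weylGroup) (η : Coch X Y i)
    (η' : Coch ((starDual k).obj (.op X)) ((imBulletDual k).obj (.op Y)) j)
    (f : Module.Dual ℂ X) (y : X) : traceForm hij e (conj w η) (conj w η') f y =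
      traceForm hij e η η' (f ∘ₗ actBy X (t k w⁻¹)) (actBy X (t k w) y) := by
  rw [traceForm_apply, traceForm_apply]
  refine (valuePairing_conj hij e w (η (t k w • y))
    (η' (t k w • toDualLin (star k) X f))).trans ?_
  rw [toDual_star_smul, star_t]
  rfl

variable [FiniteDimensional ℂ X]

/-- The pairing of cochains, as a bilinear form. -/
def cochPairing : Coch X Y i →ₗ[ℂ]
    Coch ((starDual k).obj (.op X)) ((imBulletDual k).obj (.op Y)) j →ₗ[ℂ] ℂ :=
  ∑ s, (valuePairing hij e).compl₁₂ (LinearMap.applyₗ (Module.finBasis ℂ X s))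
    (LinearMap.applyₗ (toDualLin (star k) X ((Module.finBasis ℂ X).coord s)))

lemma cochPairing_eq_finBasis (η : Coch X Y i)
    (η' : Coch ((starDual k).obj (.op X)) ((imBulletDual k).obj (.op Y)) j) :
    cochPairing hij e η η' = ∑ s, traceForm hij e η η' ((Module.finBasis ℂ X).coord s)
      (Module.finBasis ℂ X s) := by
  simp only [cochPairing, LinearMap.sum_apply]
  rfl

/-- The pairing of cochains does not depend on the basis of `X`. -/
lemma cochPairing_eq {r : ℕ} (b : Module.Basis (Fin r) ℂ X) (η : Coch X Y i)
    (η' : Coch ((starDual k).obj (.op X)) ((imBulletDual k).obj (.op Y)) j) :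
    cochPairing hij e η η' = ∑ s, traceForm hij e η η' (b.coord s) (b s) := by
  rw [cochPairing_eq_finBasis]
  exact sum_coord_comp b (Module.finBasis ℂ X) LinearMap.id (traceForm hij e η η')

/-- The pairing of cochains is natural in `X`. -/
lemma cochPairing_comp {X' : ModuleCat.{u} (GradedHeckeAlgebra k)} [FiniteDimensional ℂ X']
    (φ : X' ⟶ X) (η : Coch X Y i)
    (η' : Coch ((starDual k).obj (.op X')) ((imBulletDual k).obj (.op Y)) j) :
    cochPairing hij e (η ∘ₗ homC φ) η' =
      cochPairing hij e η (η' ∘ₗ homC ((starDual k).map φ.op)) := by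
  rw [cochPairing_eq_finBasis, cochPairing_eq_finBasis]
  exact sum_coord_comp (Module.finBasis ℂ X) (Module.finBasis ℂ X') (homC φ)
    ((valuePairing hij e).compl₁₂ η (η' ∘ₗ (toDualLin (star k) X').toLinearMap)).flip

/-- The pairing of cochains is natural in `Y`. -/
lemma cochPairing_compr₂ {Y' : ModuleCat.{u} (GradedHeckeAlgebra k)} (φ : Y ⟶ Y')
    (η : Coch X Y i)
    (η' : Coch ((starDual k).obj (.op X)) ((imBulletDual k).obj (.op Y')) j) :
    cochPairing hij e (η.compr₂ (homC φ)) η' =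
      cochPairing hij e η (η'.compr₂ (homC ((imBulletDual k).map φ.op))) := by
  rw [cochPairing_eq_finBasis, cochPairing_eq_finBasis]
  rfl

lemma cochPairing_conj (w : P.weylGroup) (η : Coch X Y i)
    (η' : Coch ((starDual k).obj (.op X)) ((imBulletDual k).obj (.op Y)) j) :
    cochPairing hij e (conj w η) (conj w η') = cochPairing hij e η η' := by
  rw [cochPairing_eq_finBasis, cochPairing_eq_finBasis]
  simp only [traceForm_conj]
  refine (sum_coord_comp (Module.finBasis ℂ X) (Module.finBasis ℂ X) (actBy X (t k w⁻¹))
    ((traceForm hij e η η').compl₂ (actBy X (t k w)))).symm.trans ?_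
  refine Finset.sum_congr rfl fun s _ => ?_
  have h2 (y : X) : actBy X (t k w) (actBy X (t k w⁻¹) y) = y := t_smul_t_inv w y
  rw [LinearMap.compl₂_apply, h2]

/-- Since the pairing is `W`-invariant, averaging one argument does not change its value if the
other argument is equivariant. -/
lemma cochPairing_avg {η : Coch X Y i} (hη : IsEquivariant η)
    (η' : Coch ((starDual k).obj (.op X)) ((imBulletDual k).obj (.op Y)) j) :
    cochPairing hij e η (avg η') = cochPairing hij e η η' := by
  have h (w : P.weylGroup) : cochPairing hij e η (conj w η') = cochPairing hij e η η' := by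
    conv_lhs => rw [← isEquivariant_iff_conj.mp hη w]
    exact cochPairing_conj hij e w η η'
  rw [avg, map_smul, map_sum, Finset.sum_congr rfl fun w _ => h w, Finset.sum_const,
    Finset.card_univ, ← Nat.cast_smul_eq_nsmul ℂ, smul_smul,
    inv_mul_cancel₀ card_weylGroup_ne_zero, one_smul]

lemma cochPairing_avg_left (η : Coch X Y i)
    {η' : Coch ((starDual k).obj (.op X)) ((imBulletDual k).obj (.op Y)) j}
    (hη' : IsEquivariant η') :
    cochPairing hij e (avg η) η' = cochPairing hij e η η' := by
  have h (w : P.weylGroup) : cochPairing hij e (conj w η) η' = cochPairing hij e η η' := by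
    conv_lhs => rw [← isEquivariant_iff_conj.mp hη' w]
    exact cochPairing_conj hij e w η η'
  rw [avg, map_smul, map_sum, LinearMap.smul_apply, LinearMap.sum_apply,
    Finset.sum_congr rfl fun w _ => h w, Finset.sum_const,
    Finset.card_univ, ← Nat.cast_smul_eq_nsmul ℂ, smul_smul,
    inv_mul_cancel₀ card_weylGroup_ne_zero, one_smul]

/-- The pairing of cochains is separating on the left. -/
lemma eq_zero_of_cochPairing_left (η : Coch X Y i) (h : ∀ η' : Coch ((starDual k).obj (.op X))
    ((imBulletDual k).obj (.op Y)) j, cochPairing hij e η η' = 0) : η = 0 := by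
  refine LinearMap.ext fun y => eq_zero_of_valuePairing_left hij e (η y) fun ψ f => ?_
  -- the cochain `(g, ω) ↦ g(y) ψ(ω) f`
  rw [← h (LinearMap.smulRight ((LinearMap.applyₗ y : Module.Dual ℂ X →ₗ[ℂ] ℂ) ∘ₗ
    (toDualLin (star k) X).symm.toLinearMap) (ψ.smulRight f)),
    cochPairing_eq_finBasis]
  have h1 (s : Fin _) : traceForm hij e η (LinearMap.smulRight
      ((LinearMap.applyₗ y : Module.Dual ℂ X →ₗ[ℂ] ℂ) ∘ₗ
        (toDualLin (star k) X).symm.toLinearMap) (ψ.smulRight f))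
      ((Module.finBasis ℂ X).coord s) (Module.finBasis ℂ X s) =
      valuePairing hij e (η ((Module.finBasis ℂ X).coord s y • Module.finBasis ℂ X s))
        (ψ.smulRight f) := by
    rw [map_smul, map_smul, LinearMap.smul_apply, traceForm_apply, ← map_smul]
    rfl
  simp only [h1]
  rw [← LinearMap.sum_apply, ← map_sum, ← map_sum]
  congr 3
  exact ((Module.finBasis ℂ X).sum_repr y).symm

/-- The pairing of cochains is separating on the right. -/
lemma eq_zero_of_cochPairing_right
    (η' : Coch ((starDual k).obj (.op X)) ((imBulletDual k).obj (.op Y)) j)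
    (h : ∀ η : Coch X Y i, cochPairing hij e η η' = 0) : η' = 0 := by
  refine LinearMap.ext fun f' => ?_
  obtain ⟨f, rfl⟩ := (toDualLin (star k) X).surjective f'
  refine eq_zero_of_valuePairing_right hij e (η' (toDualLin (star k) X f)) fun χ y => ?_
  -- the cochain `(z, ω) ↦ f(z) χ(ω) y`
  rw [← h (LinearMap.smulRight f (χ.smulRight y)), cochPairing_eq_finBasis]
  have h1 (s : Fin _) : traceForm hij e (LinearMap.smulRight f (χ.smulRight y)) η'
      ((Module.finBasis ℂ X).coord s) (Module.finBasis ℂ X s) =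
      valuePairing hij e (χ.smulRight y)
        (η' (toDualLin (star k) X
          (f (Module.finBasis ℂ X s) • (Module.finBasis ℂ X).coord s))) := by
    rw [map_smul, map_smul, map_smul, traceForm_apply, ← LinearMap.smul_apply, ← map_smul]
    rfl
  simp only [h1]
  rw [← map_sum, ← map_sum, ← map_sum]
  congr 3
  refine (Module.finBasis ℂ X).ext fun s => ?_
  simp

end Pairing

end CochainPairing

/-! ### Adjointness of the differentials -/

section Adjointness

open ModuleCat

variable {ι V₀ N : Type u} [Fintype ι] [AddCommGroup V₀] [Module ℝ V₀] [FiniteDimensional ℝ V₀]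
  [AddCommGroup N] [Module ℝ N] {P : RootPairing ι ℝ V₀ N} [P.IsReduced] {S : SimpleSystem P}
  {k : Parameter S} {n i j : ℕ} (hij : i + j = n) (e : Module.Basis (Fin n) ℂ (Cplx V₀))
  {X Y : ModuleCat.{u} (GradedHeckeAlgebra k)} {r : ℕ} (b : Module.Basis (Fin r) ℂ X)

/-- The contraction of `valuePairing` along `X`, after a linear endomorphism of `X` and an operation
on the values of the second cochain. -/
lemma sum_valuePairing_comp (η : Coch X Y i)
    (G : (starDual k).obj (.op X) →ₗ[ℂ] ⋀[ℂ]^j (Cplx V₀) →ₗ[ℂ] (imBulletDual k).obj (.op Y))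
    (φ : X →ₗ[ℂ] X) :
    ∑ s, valuePairing hij e (η (φ (b s))) (G (toDualLin (star k) X (b.coord s))) =
    ∑ s, valuePairing hij e (η (b s)) (G (toDualLin (star k) X (b.coord s ∘ₗ φ))) :=
  sum_coord_comp b b φ (traceForm hij e η G)

lemma contr_neg {R V : Type*} [CommRing R] [AddCommGroup V] [Module R V] (φ : Module.Dual R V)
    (i : ℕ) (ω : ⋀[R]^(i + 1) V) : contr (-φ) i ω = - contr φ i ω := by
  refine Subtype.ext ?_
  rw [coe_contr, map_neg, LinearMap.neg_apply]
  rfl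

lemma t_refl_smul_t_refl {Z : ModuleCat.{u} (GradedHeckeAlgebra k)} (γ : ι) (y : Z) :
    t k (refl P γ) • t k (refl P γ) • y = y := by
  rw [smul_smul, ← t_mul, refl_mul_self, t_one, one_smul]

/-- The correction terms in the formula for `v^*` do not contribute to the pairing: the reflection
`s_γ` fixes their sum by invariance of the pairing, and changes its sign since contraction with
`γ^∨` anticommutes with `s_γ`. -/
lemma sum_valuePairing_refl {N : ℕ} (hij : i + (j + 1) = N)
    (e : Module.Basis (Fin N) ℂ (Cplx V₀)) {η : Coch X Y i} (hη : IsEquivariant η)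
    {η' : Coch ((starDual k).obj (.op X)) ((imBulletDual k).obj (.op Y)) j}
    (hη' : IsEquivariant η') (γ : ι) :
    ∑ s, valuePairing hij e (η (b s))
      (η' (toDualLin (star k) X (b.coord s ∘ₗ actBy X (t k (refl P γ)))) ∘ₗ
        contr (pair P γ) j) = 0 := by
  have hs (f : Module.Dual ℂ X) : toDualLin (star k) X (f ∘ₗ actBy X (t k (refl P γ))) =
      t k (refl P γ) • toDualLin (star k) X f := by
    rw [toDual_star_smul, star_t, refl_inv]
  -- move the transpose of `s_γ` on `X^*` to `X`
  have h1 := sum_valuePairing_comp hij e b η (η'.compl₂ (contr (pair P γ) j))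
    (actBy X (t k (refl P γ)))
  have hanti (ω : ⋀[ℂ]^(j + 1) (Cplx V₀)) :
      contr (pair P γ) j (exteriorPower.map (j + 1) (act P (refl P γ)) ω) =
        - exteriorPower.map j (act P (refl P γ)) (contr (pair P γ) j ω) := by
    rw [← map_contr]
    have : pair P γ ∘ₗ act P (refl P γ) = - pair P γ := LinearMap.ext (pair_act_refl γ)
    rw [this, contr_neg, map_neg]
  have h2 (f : Module.Dual ℂ X) (y : X) :
      valuePairing hij e (η y)
        (η' (toDualLin (star k) X (f ∘ₗ actBy X (t k (refl P γ)))) ∘ₗ contr (pair P γ) j) =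
      - valuePairing hij e (η (actBy X (t k (refl P γ)) y))
        (η' (toDualLin (star k) X f) ∘ₗ contr (pair P γ) j) := by
    have e1 : actBy Y (t k (refl P γ)⁻¹) ∘ₗ η y ∘ₗ exteriorPower.map i (act P (refl P γ)) =
        η (actBy X (t k (refl P γ)) y) := by
      refine LinearMap.ext fun ω => ?_
      have h5 := LinearMap.congr_fun₂ (isEquivariant_iff_conj.mp hη (refl P γ))
        (t k (refl P γ) • y) ω
      rw [conj_apply, t_refl_smul_t_refl] at h5
      exact h5
    have e2 : actBy _ (t k (refl P γ)⁻¹) ∘ₗ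
        (η' (t k (refl P γ) • toDualLin (star k) X f) ∘ₗ contr (pair P γ) j) ∘ₗ
          exteriorPower.map (j + 1) (act P (refl P γ)) =
        - (η' (toDualLin (star k) X f) ∘ₗ contr (pair P γ) j) := by
      refine LinearMap.ext fun ω => ?_
      have h5 := LinearMap.congr_fun₂ (isEquivariant_iff_conj.mp hη' (refl P γ))
        (toDualLin (star k) X f) (contr (pair P γ) j ω)
      rw [conj_apply] at h5
      change t k (refl P γ)⁻¹ • η' (t k (refl P γ) • toDualLin (star k) X f)
        (contr (pair P γ) j (exteriorPower.map (j + 1) (act P (refl P γ)) ω)) =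
        - η' (toDualLin (star k) X f) (contr (pair P γ) j ω)
      rw [hanti, map_neg, smul_neg, h5]
    rw [← valuePairing_conj hij e (refl P γ), e1, hs, e2, map_neg]
  have h3 := Finset.sum_congr (rfl : Finset.univ = Finset.univ) fun s _ => h2 (b.coord s) (b s)
  rw [Finset.sum_neg_distrib] at h3
  have h4 := h3.trans (congrArg Neg.neg h1)
  exact self_eq_neg.mp h4

/-- The action of `V` on `X^*`. -/
lemma toDualLin_x_smul {c : ι → ℂ} (hc : ∀ v : Cplx V₀, (star k (x k v)).unop =
    - x k v - ∑ γ, (c γ * pair P γ v) • t k (refl P γ)) (v : Cplx V₀) (f : Module.Dual ℂ X) :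
    x k v • toDualLin (star k) X f = - toDualLin (star k) X (f ∘ₗ actBy X (x k v)) -
      ∑ γ, (c γ * pair P γ v) • toDualLin (star k) X (f ∘ₗ actBy X (t k (refl P γ))) := by
  simp only [← map_neg, ← map_smul, ← map_sum]
  rw [← map_sub, toDual_star_smul]
  congr 1
  refine LinearMap.ext fun y => ?_
  change f ((star k (x k v)).unop • y) = _
  rw [hc, sub_smul, neg_smul, Finset.sum_smul, map_sub, map_neg, map_sum]
  simp only [LinearMap.sub_apply, LinearMap.neg_apply, LinearMap.sum_apply, LinearMap.smul_apply,
    smul_assoc, map_smul]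
  rfl

lemma valuePairing_cochD_left {N : ℕ} (hij : i + 1 + j = N + 1) (hij' : i + (j + 1) = N + 1)
    (e : Module.Basis (Fin (N + 1)) ℂ (Cplx V₀)) (η : Coch X Y i) (y : X)
    (A' : ⋀[ℂ]^j (Cplx V₀) →ₗ[ℂ] (imBulletDual k).obj (.op Y)) :
    valuePairing hij e (cochD e η y) A' = (-1) ^ i *
      (- ∑ l, valuePairing hij' e (η y) (actBy _ (x k (e l)) ∘ₗ A' ∘ₗ contr (e.coord l) j) -
        ∑ l, valuePairing hij' e (η (actBy X (x k (e l)) y)) (A' ∘ₗ contr (e.coord l) j)) := by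
  rw [cochD_apply, map_sum, LinearMap.sum_apply, ← Finset.sum_neg_distrib,
    ← Finset.sum_sub_distrib, Finset.mul_sum]
  refine Finset.sum_congr rfl fun l _ => ?_
  have h1 := valuePairing_contr hij hij' e (e.coord l) (actBy Y (x k (e l)) ∘ₗ η y) A'
  have h2 := valuePairing_contr hij hij' e (e.coord l) (η (actBy X (x k (e l)) y)) A'
  rw [valuePairing_x] at h1
  rw [map_sub, LinearMap.sub_apply, mul_sub, ← h1, ← h2]
  rfl

lemma valuePairing_cochD_right (hij : i + (j + 1) = n)
    {c : ι → ℂ} (hc : ∀ v : Cplx V₀, (star k (x k v)).unop =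
      - x k v - ∑ γ, (c γ * pair P γ v) • t k (refl P γ))
    (A : ⋀[ℂ]^i (Cplx V₀) →ₗ[ℂ] Y)
    (η' : Coch ((starDual k).obj (.op X)) ((imBulletDual k).obj (.op Y)) j)
    (f : Module.Dual ℂ X) :
    valuePairing hij e A (cochD e η' (toDualLin (star k) X f)) =
      ∑ l, valuePairing hij e A
        (actBy _ (x k (e l)) ∘ₗ η' (toDualLin (star k) X f) ∘ₗ contr (e.coord l) j) +
      ∑ l, valuePairing hij e A
        (η' (toDualLin (star k) X (f ∘ₗ actBy X (x k (e l)))) ∘ₗ contr (e.coord l) j) +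
      ∑ γ, c γ * valuePairing hij e A
        (η' (toDualLin (star k) X (f ∘ₗ actBy X (t k (refl P γ)))) ∘ₗ contr (pair P γ) j) := by
  have h1 (l : Fin n) : η' (x k (e l) • toDualLin (star k) X f) ∘ₗ contr (e.coord l) j =
      - (η' (toDualLin (star k) X (f ∘ₗ actBy X (x k (e l)))) ∘ₗ contr (e.coord l) j) -
      ∑ γ, (c γ * pair P γ (e l)) •
        (η' (toDualLin (star k) X (f ∘ₗ actBy X (t k (refl P γ)))) ∘ₗ contr (e.coord l) j) := by
    rw [toDualLin_x_smul hc, map_sub, map_neg, map_sum]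
    refine LinearMap.ext fun ω => ?_
    simp only [map_smul, LinearMap.comp_apply, LinearMap.sub_apply, LinearMap.neg_apply,
      LinearMap.sum_apply, LinearMap.smul_apply]
  have h2 (γ : ι) : ∑ l, pair P γ (e l) •
      (η' (toDualLin (star k) X (f ∘ₗ actBy X (t k (refl P γ)))) ∘ₗ contr (e.coord l) j) =
      η' (toDualLin (star k) X (f ∘ₗ actBy X (t k (refl P γ)))) ∘ₗ contr (pair P γ) j := by
    refine LinearMap.ext fun ω => ?_
    rw [LinearMap.comp_apply, ← sum_contr_coord e, map_sum, LinearMap.sum_apply]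
    simp only [map_smul, LinearMap.comp_apply, LinearMap.smul_apply]
  rw [cochD_apply, map_sum]
  simp only [h1, map_sub, map_neg, map_sum, map_smul, Finset.sum_sub_distrib, ← h2, smul_eq_mul]
  rw [Finset.sum_neg_distrib, Finset.sum_comm]
  simp only [Finset.mul_sum, mul_assoc]
  ring

/-- The differentials are adjoint to each other up to a sign. -/
lemma cochPairing_cochD [FiniteDimensional ℂ X] {N : ℕ} (hij : i + 1 + j = N + 1)
    (hij' : i + (j + 1) = N + 1)
    (e : Module.Basis (Fin (N + 1)) ℂ (Cplx V₀)) {η : Coch X Y i} (hη : IsEquivariant η)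
    {η' : Coch ((starDual k).obj (.op X)) ((imBulletDual k).obj (.op Y)) j}
    (hη' : IsEquivariant η') :
    cochPairing hij e (cochD e η) η' = - ((-1) ^ i * cochPairing hij' e η (cochD e η')) := by
  obtain ⟨c, hc⟩ := exists_star_x (k := k)
  obtain ⟨r, b⟩ : Σ r, Module.Basis (Fin r) ℂ X := ⟨_, Module.finBasis ℂ X⟩
  rw [cochPairing_eq hij e b, cochPairing_eq hij' e b]
  simp only [traceForm_apply, valuePairing_cochD_left hij hij', valuePairing_cochD_right e hij' hc]
  rw [← Finset.mul_sum, Finset.sum_sub_distrib,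
    Finset.sum_neg_distrib, Finset.sum_add_distrib, Finset.sum_add_distrib]
  have h1 : ∑ s, ∑ γ, c γ * valuePairing hij' e (η (b s))
      (η' (toDualLin (star k) X (b.coord s ∘ₗ actBy X (t k (refl P γ)))) ∘ₗ
        contr (pair P γ) j) = 0 := by
    rw [Finset.sum_comm]
    refine Finset.sum_eq_zero fun γ _ => ?_
    rw [← Finset.mul_sum, sum_valuePairing_refl b hij' e hη hη' γ, mul_zero]
  have h2 : ∑ s, ∑ l, valuePairing hij' e (η (actBy X (x k (e l)) (b s)))
        (η' (toDualLin (star k) X (b.coord s)) ∘ₗ contr (e.coord l) j) =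
      ∑ s, ∑ l, valuePairing hij' e (η (b s))
        (η' (toDualLin (star k) X (b.coord s ∘ₗ actBy X (x k (e l)))) ∘ₗ
          contr (e.coord l) j) := by
    rw [Finset.sum_comm]
    refine Eq.trans ?_ Finset.sum_comm
    refine Finset.sum_congr rfl fun l _ => ?_
    exact sum_valuePairing_comp hij' e b η (η'.compl₂ (contr (e.coord l) j)) (actBy X (x k (e l)))
  rw [h1, h2]
  ring

end Adjointness

/-! ### Orthogonality of cocycles and coboundaries -/

section LinearAlgebra

/-- For a pairing that separates the points of a finite-dimensional space `E₀`, every subspace `W`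
is the orthogonal complement of its orthogonal complement. -/
lemma mem_of_forall_orthogonal {E F : Type*} [AddCommGroup E] [Module ℂ E] [AddCommGroup F]
    [Module ℂ F] [FiniteDimensional ℂ E] (B : F →ₗ[ℂ] E →ₗ[ℂ] ℂ) {E₀ : Submodule ℂ E}
    {F₀ : Submodule ℂ F} (hB : ∀ u ∈ E₀, (∀ u' ∈ F₀, B u' u = 0) → u = 0) {W : Submodule ℂ E}
    (hW : W ≤ E₀) {u : E} (hu : u ∈ E₀)
    (h : ∀ u' ∈ F₀, (∀ w ∈ W, B u' w = 0) → B u' u = 0) : u ∈ W := by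
  by_contra hu'
  obtain ⟨f, hf, hWf⟩ := Submodule.exists_le_ker_of_notMem hu'
  have hinj : Function.Injective (B.domRestrict₁₂ F₀ E₀).flip := by
    rw [injective_iff_map_eq_zero]
    exact fun a ha => Subtype.ext (hB a a.2 fun u' hu' => LinearMap.congr_fun ha ⟨u', hu'⟩)
  obtain ⟨u', h'⟩ := (LinearMap.flip_surjective_iff₁ (B := (B.domRestrict₁₂ F₀ E₀).flip)).mpr hinj
    (f ∘ₗ E₀.subtype)
  have h'' (v : E) (hv : v ∈ E₀) : B u' v = f v := LinearMap.congr_fun h' ⟨v, hv⟩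
  refine hf ((h'' u hu).symm.trans (h u' u'.2 fun w hw => ?_))
  rw [h'' w (hW hw)]
  exact hWf hw

end LinearAlgebra

section Perfect

open ModuleCat

variable {ι V₀ N : Type u} [Fintype ι] [AddCommGroup V₀] [Module ℝ V₀] [FiniteDimensional ℝ V₀]
  [AddCommGroup N] [Module ℝ N] {P : RootPairing ι ℝ V₀ N} [P.IsReduced] {S : SimpleSystem P}
  {k : Parameter S} {n i j : ℕ} (hij : i + j = n) (e : Module.Basis (Fin n) ℂ (Cplx V₀))
  {X Y : ModuleCat.{u} (GradedHeckeAlgebra k)}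

/-- The exterior powers of `V` in degrees above `dim V` vanish. -/
lemma coch_eq_zero (e : Module.Basis (Fin n) ℂ (Cplx V₀)) (hi : n < i) (η : Coch X Y i) :
    η = 0 := by
  refine LinearMap.ext fun y => exteriorPower.linearMap_ext ?_
  refine AlternatingMap.ext fun v => ?_
  have : Module.Finite ℂ (Cplx V₀) := Module.Finite.of_basis e
  have hv : ¬ LinearIndependent ℂ v := fun h => by
    have := h.fintype_card_le_finrank
    rw [Module.finrank_eq_card_basis e, Fintype.card_fin, Fintype.card_fin] at this
    omega
  exact AlternatingMap.map_linearDependent _ v hv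

lemma koszul_hom_eq_zero (e : Module.Basis (Fin n) ℂ (Cplx V₀)) (hi : n < i)
    (f : koszul X i ⟶ Y) : f = 0 :=
  hom_ext_toCoch ((coch_eq_zero e hi _).trans (coch_eq_zero e hi _).symm)

lemma isEquivariant_cochD {η : Coch X Y i} (hη : IsEquivariant η) :
    IsEquivariant (cochD e η) := by
  rw [← toCoch_kdesc η hη, ← toCoch_koszulD_comp]
  exact isEquivariant_toCoch _

variable (X Y i) in
/-- The space of `W`-equivariant cochains. -/
def eqCoch : Submodule ℂ (Coch X Y i) where
  carrier := {η | IsEquivariant η}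
  add_mem' {η η'} hη hη' w y ω := by
    rw [LinearMap.add_apply, LinearMap.add_apply, hη, hη', ← smul_add]
    rfl
  zero_mem' w y ω := (smul_zero _).symm
  smul_mem' c η hη w y ω := by
    change c • η _ _ = t k w • c • η y ω
    rw [hη]
    exact ((actBy Y (t k w)).map_smul c _).symm

section

variable [FiniteDimensional ℂ X]

/-- The pairing remains separating on equivariant cochains, by averaging over `W`. -/
lemma eq_zero_of_equivariant_left {η : Coch X Y i} (hη : IsEquivariant η)
    (h : ∀ η' : Coch ((starDual k).obj (.op X)) ((imBulletDual k).obj (.op Y)) j,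
      IsEquivariant η' → cochPairing hij e η η' = 0) : η = 0 :=
  eq_zero_of_cochPairing_left hij e η fun η' => by
    rw [← cochPairing_avg hij e hη, h _ (isEquivariant_avg η')]

lemma eq_zero_of_equivariant_right
    {η' : Coch ((starDual k).obj (.op X)) ((imBulletDual k).obj (.op Y)) j}
    (hη' : IsEquivariant η')
    (h : ∀ η : Coch X Y i, IsEquivariant η → cochPairing hij e η η' = 0) : η' = 0 :=
  eq_zero_of_cochPairing_right hij e η' fun η => by
    rw [← cochPairing_avg_left hij e η hη', h _ (isEquivariant_avg η)]

/-- In degree zero there are no coboundaries, and in degree `n` all cochains are cocycles. -/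
lemma eq_zero_of_cocycles_left (hij : 0 + j = n) {η : Coch X Y 0} (hη : IsEquivariant η)
    (h : ∀ η' : Coch ((starDual k).obj (.op X)) ((imBulletDual k).obj (.op Y)) j,
      IsEquivariant η' → cochD e η' = 0 → cochPairing hij e η η' = 0) : η = 0 :=
  eq_zero_of_equivariant_left hij e hη fun η' hη' => h η' hη' (coch_eq_zero e (by omega) _)

lemma eq_zero_of_cocycles_right (hij : i + 0 = n)
    {η' : Coch ((starDual k).obj (.op X)) ((imBulletDual k).obj (.op Y)) 0}
    (hη' : IsEquivariant η')
    (h : ∀ η : Coch X Y i, IsEquivariant η → cochD e η = 0 → cochPairing hij e η η' = 0) :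
    η' = 0 :=
  eq_zero_of_equivariant_right hij e hη' fun η hη => h η hη (coch_eq_zero e (by omega) _)

/-- A cochain that is orthogonal to all cocycles is a coboundary. -/
lemma exists_cochD_eq_left [FiniteDimensional ℂ Y] (hij : i + 1 + j = n) {η : Coch X Y (i + 1)}
    (hη : IsEquivariant η)
    (h : ∀ η' : Coch ((starDual k).obj (.op X)) ((imBulletDual k).obj (.op Y)) j,
      IsEquivariant η' → cochD e η' = 0 → cochPairing hij e η η' = 0) :
    ∃ ξ : Coch X Y i, IsEquivariant ξ ∧ cochD e ξ = η := by
  obtain ⟨N, rfl⟩ : ∃ N, n = N + 1 := ⟨i + j, by omega⟩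
  have hfin : FiniteDimensional ℂ (Cplx V₀) := Module.Finite.of_basis e
  refine mem_of_forall_orthogonal (cochPairing hij e).flip (E₀ := eqCoch (i + 1) X Y)
    (F₀ := eqCoch j ((starDual k).obj (.op X)) ((imBulletDual k).obj (.op Y)))
    (W := (eqCoch i X Y).map (cochD e)) (fun u hu hu' => eq_zero_of_equivariant_left hij e hu hu')
    ?_ hη fun η' hη' hd => h η' hη' ?_
  · rintro _ ⟨ξ, hξ, rfl⟩
    exact isEquivariant_cochD e hξ
  · refine eq_zero_of_equivariant_right (X := X) (Y := Y) (i := i) (by omega) e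
      (isEquivariant_cochD e hη') fun ξ hξ => ?_
    have h2 := cochPairing_cochD hij (by omega) e hξ hη'
    have h3 : cochPairing hij e (cochD e ξ) η' = 0 := hd _ ⟨ξ, hξ, rfl⟩
    rw [h3, zero_eq_neg] at h2
    exact (mul_eq_zero.mp h2).resolve_left (pow_ne_zero _ (by norm_num))

lemma exists_cochD_eq_right [FiniteDimensional ℂ Y] (hij : i + (j + 1) = n)
    {η' : Coch ((starDual k).obj (.op X)) ((imBulletDual k).obj (.op Y)) (j + 1)}
    (hη' : IsEquivariant η')
    (h : ∀ η : Coch X Y i, IsEquivariant η → cochD e η = 0 → cochPairing hij e η η' = 0) :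
    ∃ ξ : Coch ((starDual k).obj (.op X)) ((imBulletDual k).obj (.op Y)) j,
      IsEquivariant ξ ∧ cochD e ξ = η' := by
  obtain ⟨N, rfl⟩ : ∃ N, n = N + 1 := ⟨i + j, by omega⟩
  have hfin : FiniteDimensional ℂ (Cplx V₀) := Module.Finite.of_basis e
  have hX : FiniteDimensional ℂ ((starDual k).obj (.op X)) :=
    Module.Finite.equiv (toDualLin (star k) X)
  have hY : FiniteDimensional ℂ ((imBulletDual k).obj (.op Y)) :=
    FiniteDimensional.of_injective (evalIm k Y) fun f g hfg =>
      evalIm_ext fun y => LinearMap.congr_fun hfg y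
  refine mem_of_forall_orthogonal (cochPairing hij e) (F₀ := eqCoch i X Y)
    (E₀ := eqCoch (j + 1) ((starDual k).obj (.op X)) ((imBulletDual k).obj (.op Y)))
    (W := (eqCoch j _ _).map (cochD e)) (fun u hu hu' => eq_zero_of_equivariant_right hij e hu hu')
    ?_ hη' fun η hη hd => h η hη ?_
  · rintro _ ⟨ξ, hξ, rfl⟩
    exact isEquivariant_cochD e hξ
  · refine eq_zero_of_equivariant_left (j := j) (by omega) e
      (isEquivariant_cochD e hη) fun ξ hξ => ?_
    have h2 := cochPairing_cochD (by omega) hij e hη hξ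
    have h3 : cochPairing hij e η (cochD e ξ) = 0 := hd _ ⟨ξ, hξ, rfl⟩
    rw [h2, h3, mul_zero, neg_zero]

end

end Perfect

/-! ### Classes of cocycles in Ext groups -/

section ExtZero

open CochainComplex HomComplex Abelian

/-- In degree zero, a cocycle with vanishing class is zero: there are no coboundaries. -/
lemma extMk_zero_eq_zero {C : Type*} [Category* C] [Abelian C] [HasExt C] {X Y : C}
    (R : ProjectiveResolution X) (f : R.complex.X 0 ⟶ Y) (hf : R.complex.d 1 0 ≫ f = 0)
    (h : R.extMk f 1 rfl hf = 0) : f = 0 := by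
  rw [← R.extEquivCohomologyClass.apply_eq_iff_eq, R.extEquivCohomologyClass_extMk,
    R.extEquivCohomologyClass_zero, CohomologyClass.mk_eq_zero_iff,
    Cocycle.toSingleMk_mem_coboundaries_iff _ _ _ _ _ 1 (by simp)] at h
  obtain ⟨g, hg⟩ := h
  have h0 : g = 0 := (CochainComplex.isZero_of_isStrictlyLE _ 0 1).eq_of_src _ _
  rw [h0, Limits.comp_zero] at hg
  rw [← cancel_epi (R.cochainComplexXIso (-(0 : ℕ)) 0 rfl).hom, Limits.comp_zero]
  exact hg.symm

end ExtZero

section Ext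

open ModuleCat

variable {ι V₀ N : Type u} [Fintype ι] [AddCommGroup V₀] [Module ℝ V₀] [FiniteDimensional ℝ V₀]
  [AddCommGroup N] [Module ℝ N] {P : RootPairing ι ℝ V₀ N} [P.IsReduced] {S : SimpleSystem P}
  {k : Parameter S} {n i j : ℕ} (e : Module.Basis (Fin n) ℂ (Cplx V₀))
  {X Y : ModuleCat.{u} (GradedHeckeAlgebra k)}

lemma koszulRes_d_comp_eq_zero_iff {f : koszul X i ⟶ Y} :
    (koszulRes e X).complex.d (i + 1) i ≫ f = 0 ↔ cochD e (toCoch f) = 0 := by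
  have h1 : (koszulRes e X).complex.d (i + 1) i = koszulD e X i := koszulComplex_d e X i
  rw [h1, ← toCoch_koszulD_comp]
  exact ⟨fun h => congrArg toCoch h, fun h => hom_ext_toCoch h⟩

/-- The class in `Ext^i` of a morphism out of the `i`-th term of the resolution. -/
def koszulExt (f : koszul X i ⟶ Y) (hf : cochD e (toCoch f) = 0) : Abelian.Ext X Y i :=
  (koszulRes e X).extMk f (i + 1) rfl ((koszulRes_d_comp_eq_zero_iff e).mpr hf)

lemma koszulExt_congr {f g : koszul X i ⟶ Y} (h : toCoch f = toCoch g)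
    (hf : cochD e (toCoch f) = 0) :
    koszulExt e f hf = koszulExt e g (h ▸ hf) := by
  obtain rfl := hom_ext_toCoch h
  rfl

lemma koszulExt_add {f g : koszul X i ⟶ Y} (hf : cochD e (toCoch f) = 0)
    (hg : cochD e (toCoch g) = 0) : koszulExt e f hf + koszulExt e g hg =
      koszulExt e (f + g) (by
        change cochD e (toCoch f + toCoch g) = 0
        rw [map_add, hf, hg, add_zero]) :=
  (koszulRes e X).add_extMk f g _ _ _ _

lemma cochD_toCoch_comp {f : koszul X i ⟶ Y} (hf : cochD e (toCoch f) = 0)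
    {Y' : ModuleCat.{u} (GradedHeckeAlgebra k)} (g : Y ⟶ Y') : cochD e (toCoch (f ≫ g)) = 0 := by
  rw [← toCoch_koszulD_comp, ← Category.assoc]
  have h : koszulD e X i ≫ f = 0 := hom_ext_toCoch ((toCoch_koszulD_comp e f).trans hf)
  rw [h, Limits.zero_comp]
  rfl

lemma koszulExt_comp_mk₀ {f : koszul X i ⟶ Y} (hf : cochD e (toCoch f) = 0)
    {Y' : ModuleCat.{u} (GradedHeckeAlgebra k)} (g : Y ⟶ Y') :
    (koszulExt e f hf).comp (Abelian.Ext.mk₀ g) (add_zero i) =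
      koszulExt e (f ≫ g) (cochD_toCoch_comp e hf g) :=
  (koszulRes e X).extMk_comp_mk₀ f _ _ _ g

lemma toCoch_comp (f : koszul X i ⟶ Y)
    {Y' : ModuleCat.{u} (GradedHeckeAlgebra k)} (g : Y ⟶ Y') :
    toCoch (f ≫ g) = (toCoch f).compr₂ (homC g) := rfl

lemma toCoch_comp_smul_id (f : koszul X i ⟶ Y) (c : ℂ) :
    toCoch (f ≫ (c • 𝟙 Y)) = c • toCoch f := rfl

lemma smul_koszulExt {f : koszul X i ⟶ Y} (hf : cochD e (toCoch f) = 0) (c : ℂ) :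
    c • koszulExt e f hf = koszulExt e (f ≫ (c • 𝟙 Y)) (cochD_toCoch_comp e hf _) := by
  rw [Abelian.Ext.smul_eq_comp_mk₀, koszulExt_comp_mk₀]

lemma exists_koszulExt (a : Abelian.Ext X Y i) : ∃ (f : koszul X i ⟶ Y)
    (hf : cochD e (toCoch f) = 0), koszulExt e f hf = a := by
  obtain ⟨f, hf, rfl⟩ := (koszulRes e X).extMk_surjective a (i + 1) rfl
  exact ⟨f, (koszulRes_d_comp_eq_zero_iff e).mp hf, rfl⟩

lemma eq_zero_of_koszulExt_eq_zero {f : koszul X 0 ⟶ Y} (hf : cochD e (toCoch f) = 0)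
    (h : koszulExt e f hf = 0) : toCoch f = 0 := by
  have h1 : f = 0 := extMk_zero_eq_zero (koszulRes e X) f _ h
  rw [h1]
  rfl

lemma koszulExt_eq_zero_iff {f : koszul X (i + 1) ⟶ Y} (hf : cochD e (toCoch f) = 0) :
    koszulExt e f hf = 0 ↔ ∃ ξ : Coch X Y i, IsEquivariant ξ ∧ cochD e ξ = toCoch f := by
  refine ((koszulRes e X).extMk_eq_zero_iff f _ _ _ i rfl).trans ?_
  have h1 : (koszulRes e X).complex.d (i + 1) i = koszulD e X i := koszulComplex_d e X i
  rw [h1]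
  constructor
  · rintro ⟨g, hg⟩
    refine ⟨toCoch g, isEquivariant_toCoch g, ?_⟩
    exact (toCoch_koszulD_comp e _).symm.trans (congrArg toCoch hg)
  · rintro ⟨ξ, hξ, h⟩
    refine ⟨kdesc X i ξ hξ, hom_ext_toCoch ?_⟩
    exact (toCoch_koszulD_comp e _).trans ((congrArg (cochD e) (toCoch_kdesc ξ hξ)).trans h)

/-- The groups `Ext^i` vanish in degrees above the dimension of `V`. -/
lemma subsingleton_ext (e : Module.Basis (Fin n) ℂ (Cplx V₀)) (hi : n < i) :
    Subsingleton (Abelian.Ext X Y i) := by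
  refine subsingleton_of_forall_eq 0 fun a => ?_
  obtain ⟨f, hf, rfl⟩ := exists_koszulExt e a
  obtain rfl := koszul_hom_eq_zero e hi f
  exact (koszulRes e X).extMk_zero _ _

/-- The space of `W`-equivariant cocycles. -/
def cocycles (X Y : ModuleCat.{u} (GradedHeckeAlgebra k)) (i : ℕ) : Submodule ℂ (Coch X Y i) :=
  eqCoch i X Y ⊓ LinearMap.ker (cochD e)

variable {e}

lemma toCoch_mem_cocycles {f : koszul X i ⟶ Y} (hf : cochD e (toCoch f) = 0) :
    toCoch f ∈ cocycles e X Y i := ⟨isEquivariant_toCoch f, hf⟩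

lemma isEquivariant_coe_cocycle (η : cocycles e X Y i) : IsEquivariant η.1 := η.2.1

lemma cochD_coe_cocycle (η : cocycles e X Y i) : cochD e η.1 = 0 := η.2.2

/-- The morphism out of the `i`-th term of the resolution defined by an equivariant cocycle. -/
def cocycleHom (η : cocycles e X Y i) : koszul X i ⟶ Y :=
  kdesc X i η.1 (isEquivariant_coe_cocycle η)

lemma toCoch_cocycleHom (η : cocycles e X Y i) : toCoch (cocycleHom η) = η.1 :=
  toCoch_kdesc η.1 (isEquivariant_coe_cocycle η)

lemma cochD_cocycleHom (η : cocycles e X Y i) : cochD e (toCoch (cocycleHom η)) = 0 :=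
  (congrArg (cochD e) (toCoch_cocycleHom η)).trans (cochD_coe_cocycle η)

variable (e)

/-- The class in `Ext^i` of an equivariant cocycle. -/
def cocycleClass (X Y : ModuleCat.{u} (GradedHeckeAlgebra k)) (i : ℕ) :
    cocycles e X Y i →ₗ[ℂ] Abelian.Ext X Y i where
  toFun η := koszulExt e (cocycleHom η) (cochD_cocycleHom η)
  map_add' η η' := by
    rw [koszulExt_add]
    refine koszulExt_congr e ?_ _
    change _ = toCoch (cocycleHom η) + toCoch (cocycleHom η')
    rw [toCoch_cocycleHom, toCoch_cocycleHom, toCoch_cocycleHom]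
    rfl
  map_smul' c η := by
    refine Eq.trans ?_ (smul_koszulExt e (cochD_cocycleHom η) c).symm
    refine koszulExt_congr e ?_ _
    rw [toCoch_comp_smul_id, toCoch_cocycleHom, toCoch_cocycleHom]
    rfl

lemma cocycleClass_toCoch {f : koszul X i ⟶ Y} (hf : cochD e (toCoch f) = 0) :
    cocycleClass e X Y i ⟨toCoch f, toCoch_mem_cocycles hf⟩ = koszulExt e f hf :=
  koszulExt_congr e (toCoch_cocycleHom _) (cochD_cocycleHom _)

lemma cocycleClass_surjective : Function.Surjective (cocycleClass e X Y i) := fun a => by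
  obtain ⟨f, hf, rfl⟩ := exists_koszulExt e a
  exact ⟨_, cocycleClass_toCoch e hf⟩

lemma cocycleClass_zero_injective {η : cocycles e X Y 0} (h : cocycleClass e X Y 0 η = 0) :
    η.1 = 0 :=
  (toCoch_cocycleHom η).symm.trans (eq_zero_of_koszulExt_eq_zero e (cochD_cocycleHom η) h)

lemma cocycleClass_succ_eq_zero_iff {η : cocycles e X Y (i + 1)} :
    cocycleClass e X Y (i + 1) η = 0 ↔
      ∃ ξ : Coch X Y i, IsEquivariant ξ ∧ cochD e ξ = η.1 := by
  refine (koszulExt_eq_zero_iff e (cochD_cocycleHom η)).trans ?_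
  rw [toCoch_cocycleHom]

end Ext

/-! ### Functoriality and comparison of resolutions -/

section Functoriality

open ModuleCat

variable {ι V₀ N : Type u} [Fintype ι] [AddCommGroup V₀] [Module ℝ V₀] [FiniteDimensional ℝ V₀]
  [AddCommGroup N] [Module ℝ N] {P : RootPairing ι ℝ V₀ N} [P.IsReduced] {S : SimpleSystem P}
  {k : Parameter S} {n i j : ℕ} (e : Module.Basis (Fin n) ℂ (Cplx V₀))
  {X X' Y : ModuleCat.{u} (GradedHeckeAlgebra k)}

lemma toCoch_homC_equivariant (φ : X' ⟶ X) {η : Coch X Y i} (hη : IsEquivariant η) :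
    IsEquivariant (η ∘ₗ homC φ) := fun w y ω => by
  have h : homC φ (t k w • y) = t k w • homC φ y := map_smul φ.hom _ _
  rw [LinearMap.comp_apply, h, hη]
  rfl

/-- The morphism of the `i`-th terms of the resolutions induced by a morphism of modules. -/
def koszulMap (φ : X' ⟶ X) (i : ℕ) : koszul X' i ⟶ koszul X i :=
  kdesc X' i ((toCoch (𝟙 (koszul X i))) ∘ₗ homC φ)
    (toCoch_homC_equivariant φ (isEquivariant_toCoch _))

lemma toCoch_koszulMap_comp (φ : X' ⟶ X) (f : koszul X i ⟶ Y) :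
    toCoch (koszulMap φ i ≫ f) = toCoch f ∘ₗ homC φ := by
  refine LinearMap.ext₂ fun y ω => ?_
  rw [toCoch_apply, ModuleCat.hom_comp, LinearMap.comp_apply, koszulMap, kdesc_kmk, one_smul]
  rfl

lemma cochD_comp_homC (φ : X' ⟶ X) (η : Coch X Y i) :
    cochD e (η ∘ₗ homC φ) = cochD e η ∘ₗ homC φ := by
  refine LinearMap.ext fun y => ?_
  rw [LinearMap.comp_apply, cochD_apply, cochD_apply]
  refine Finset.sum_congr rfl fun l _ => ?_
  have h : homC φ (x k (e l) • y) = x k (e l) • homC φ y := map_smul φ.hom _ _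
  rw [LinearMap.comp_apply, LinearMap.comp_apply, h]

lemma koszulMap_comm (φ : X' ⟶ X) (i : ℕ) :
    koszulMap φ (i + 1) ≫ koszulD e X i = koszulD e X' i ≫ koszulMap φ i := by
  refine hom_ext_toCoch ?_
  rw [toCoch_koszulMap_comp, toCoch_koszulD_comp, ← Category.comp_id (koszulD e X i),
    toCoch_koszulD_comp, ← cochD_comp_homC, ← Category.comp_id (koszulMap φ i),
    toCoch_koszulMap_comp]

lemma koszulMap_zero_aug (φ : X' ⟶ X) : koszulMap φ 0 ≫ koszulAug X = koszulAug X' ≫ φ := by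
  refine koszul_hom_ext fun y v => ?_
  have h1 : (koszulMap φ 0).hom (koszulMk 1 y v) = koszulMk 1 (φ.hom y) v := by
    exact (kdesc_kmk _ _ 1 _ _).trans (one_smul _ _)
  have h2 : (koszulAug X).hom (koszulMk 1 (φ.hom y) v) = (1 : GradedHeckeAlgebra k) • φ.hom y :=
    koszulAug_koszulMk _ _ _
  have h3 : (koszulAug X').hom (koszulMk 1 y v) = (1 : GradedHeckeAlgebra k) • y :=
    koszulAug_koszulMk _ _ _
  rw [ModuleCat.hom_comp, ModuleCat.hom_comp, LinearMap.comp_apply, LinearMap.comp_apply, h1, h2,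
    h3, one_smul, one_smul]

/-- The morphism of resolutions induced by a morphism of modules. -/
def koszulResHom (φ : X' ⟶ X) : (koszulRes e X').Hom (koszulRes e X) φ where
  hom := {
    f := koszulMap φ
    comm' := fun i j hij => by
      obtain rfl : j + 1 = i := hij
      have h1 : (koszulRes e X).complex.d (j + 1) j = koszulD e X j := koszulComplex_d e X j
      have h2 : (koszulRes e X').complex.d (j + 1) j = koszulD e X' j := koszulComplex_d e X' j
      rw [h1, h2]
      exact koszulMap_comm e φ j }
  hom_f_zero_comp_π_f_zero := by
    have h1 : (koszulRes e X).π.f 0 = koszulAug X := koszulPi_f_zero e X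
    have h2 : (koszulRes e X').π.f 0 = koszulAug X' := koszulPi_f_zero e X'
    have h3 : ((ChainComplex.single₀ (ModuleCat.{u} (GradedHeckeAlgebra k))).map φ).f 0 = φ := by
      simp
    rw [h1, h2, h3]
    exact koszulMap_zero_aug φ

lemma cochD_toCoch_koszulMap_comp (φ : X' ⟶ X) {f : koszul X i ⟶ Y}
    (hf : cochD e (toCoch f) = 0) : cochD e (toCoch (koszulMap φ i ≫ f)) = 0 := by
  rw [toCoch_koszulMap_comp, cochD_comp_homC, hf, LinearMap.zero_comp]

lemma mk₀_comp_koszulExt (φ : X' ⟶ X) {f : koszul X i ⟶ Y} (hf : cochD e (toCoch f) = 0) :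
    (Abelian.Ext.mk₀ φ).comp (koszulExt e f hf) (zero_add i) =
      koszulExt e (koszulMap φ i ≫ f) (cochD_toCoch_koszulMap_comp e φ hf) := by
  have h : (koszulRes e X).complex.d (i + 1) i ≫ f = 0 :=
    (koszulRes_d_comp_eq_zero_iff e).mpr hf
  exact ProjectiveResolution.mk₀_comp_extMk (R := koszulRes e X) (Y := Y) f (i + 1) rfl h
    (R' := koszulRes e X') (g := φ) (koszulResHom e φ)

end Functoriality

section Comparison

open ModuleCat

variable {ι V₀ N : Type u} [Fintype ι] [AddCommGroup V₀] [Module ℝ V₀] [FiniteDimensional ℝ V₀]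
  [AddCommGroup N] [Module ℝ N] {P : RootPairing ι ℝ V₀ N} [P.IsReduced] {S : SimpleSystem P}
  {k : Parameter S} {n i j : ℕ} (e : Module.Basis (Fin n) ℂ (Cplx V₀))
  {X Y : ModuleCat.{u} (GradedHeckeAlgebra k)} (K : KoszulResolution X)

lemma koszulD_comp_iso_inv (i : ℕ) : koszulD e X i ≫ (K.iso i).inv =
    (K.iso (i + 1)).inv ≫ K.res.complex.d (i + 1) i := by
  rw [← cancel_mono (K.iso i).hom, Category.assoc, Category.assoc, Iso.inv_hom_id,
    Category.comp_id]
  refine koszul_hom_ext fun y v => ?_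
  refine (koszulD_koszulMk e 1 y v).trans ?_
  exact (K.differential i 1 y v).symm

lemma iso_inv_comp_aug : (K.iso 0).inv ≫ K.res.π.f 0 = koszulAug X ≫ 𝟙 X := by
  refine koszul_hom_ext fun y v => ?_
  refine (K.augmentation 1 y v).trans ?_
  exact (koszulAug_koszulMk _ _ _).symm

/-- The comparison of two resolutions of the form described in `KoszulResolution`. -/
def comparison : (koszulRes e X).Hom K.res (𝟙 X) where
  hom := {
    f := fun i => (K.iso i).inv
    comm' := fun i j hij => by
      obtain rfl : j + 1 = i := hij
      have h1 : (koszulRes e X).complex.d (j + 1) j = koszulD e X j := koszulComplex_d e X j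
      rw [h1]
      exact (koszulD_comp_iso_inv e K j).symm }
  hom_f_zero_comp_π_f_zero := by
    have h1 : (koszulRes e X).π.f 0 = koszulAug X := koszulPi_f_zero e X
    have h3 : ((ChainComplex.single₀ (ModuleCat.{u} (GradedHeckeAlgebra k))).map (𝟙 X)).f 0 =
        𝟙 X := by
      simp
    rw [h1, h3]
    exact iso_inv_comp_aug K

/-- The class of a cocycle does not depend on the choice of the resolution of Koszul type. -/
lemma extMk_eq_koszulExt (ψ : K.res.complex.X i ⟶ Y)
    (hψ : K.res.complex.d (i + 1) i ≫ ψ = 0) :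
    ∃ hf : cochD e (toCoch ((K.iso i).inv ≫ ψ)) = 0,
      K.res.extMk ψ (i + 1) rfl hψ = koszulExt e ((K.iso i).inv ≫ ψ) hf := by
  have h := ProjectiveResolution.mk₀_comp_extMk ψ (i + 1) rfl hψ (comparison e K)
  rw [Abelian.Ext.mk₀_id_comp] at h
  refine ⟨?_, h⟩
  rw [← toCoch_koszulD_comp, ← Category.assoc, koszulD_comp_iso_inv, Category.assoc, hψ,
    Limits.comp_zero]
  rfl

/-- The explicit formula for the pairing of cochains. -/
lemma cochainPairing_eq [FiniteDimensional ℂ X] (hij : i + j = n) {r : ℕ}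
    (b : Module.Basis (Fin r) ℂ X) (η : Coch X Y i)
    (η' : Coch ((starDual k).obj (.op X)) ((imBulletDual k).obj (.op Y)) j) :
    cochainPairing hij e b (fun y v => η y (exteriorPower.ιMulti ℂ i v))
      (fun f v => η' f (exteriorPower.ιMulti ℂ j v)) = cochPairing hij e η η' := by
  rw [cochPairing_eq hij e b, cochainPairing, inv_mul_eq_iff_eq_mul₀ (factorial_mul_ne_zero i j),
    Finset.sum_comm, Finset.mul_sum]
  refine Finset.sum_congr rfl fun s _ => ?_
  exact (factorial_mul_valuePairing hij e (η (b s)) _).symm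

end Comparison

/-! ### The pairing of Ext groups -/

section ExtPairing

open ModuleCat

variable {ι V₀ N : Type u} [Fintype ι] [AddCommGroup V₀] [Module ℝ V₀] [FiniteDimensional ℝ V₀]
  [AddCommGroup N] [Module ℝ N] {P : RootPairing ι ℝ V₀ N} [P.IsReduced] {S : SimpleSystem P}
  {k : Parameter S} {n i j : ℕ} (e : Module.Basis (Fin n) ℂ (Cplx V₀))
  {X Y : ModuleCat.{u} (GradedHeckeAlgebra k)}

/-- A cocycle is orthogonal to all cocycles representing zero. -/
lemma cochPairing_eq_zero_of_class_left [FiniteDimensional ℂ X] (hij : i + j = n)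
    {η : cocycles e X Y i} (h : cocycleClass e X Y i η = 0)
    (η' : cocycles e ((starDual k).obj (.op X)) ((imBulletDual k).obj (.op Y)) j) :
    cochPairing hij e η.1 η'.1 = 0 := by
  cases i with
  | zero => rw [cocycleClass_zero_injective e h, map_zero, LinearMap.zero_apply]
  | succ i =>
    obtain ⟨N, rfl⟩ : ∃ N, n = N + 1 := ⟨i + j, by omega⟩
    obtain ⟨ξ, hξ, h1⟩ := (cocycleClass_succ_eq_zero_iff e).mp h
    rw [← h1, cochPairing_cochD hij (by omega) e hξ (isEquivariant_coe_cocycle η'),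
      cochD_coe_cocycle η', map_zero, mul_zero, neg_zero]

lemma cochPairing_eq_zero_of_class_right [FiniteDimensional ℂ X] (hij : i + j = n)
    (η : cocycles e X Y i)
    {η' : cocycles e ((starDual k).obj (.op X)) ((imBulletDual k).obj (.op Y)) j}
    (h : cocycleClass e _ _ j η' = 0) : cochPairing hij e η.1 η'.1 = 0 := by
  cases j with
  | zero => rw [cocycleClass_zero_injective e h, map_zero]
  | succ j =>
    obtain ⟨N, rfl⟩ : ∃ N, n = N + 1 := ⟨i + j, by omega⟩
    obtain ⟨ξ, hξ, h1⟩ := (cocycleClass_succ_eq_zero_iff e).mp h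
    have h2 := cochPairing_cochD (by omega : i + 1 + j = N + 1) hij e
      (isEquivariant_coe_cocycle η) hξ
    rw [cochD_coe_cocycle η, map_zero, LinearMap.zero_apply, h1, zero_eq_neg] at h2
    exact (mul_eq_zero.mp h2).resolve_left (pow_ne_zero _ (by norm_num))

/-- A linear choice of cocycles representing the classes in `Ext^i`. -/
def cocycleRep (X Y : ModuleCat.{u} (GradedHeckeAlgebra k)) (i : ℕ) :
    Abelian.Ext X Y i →ₗ[ℂ] cocycles e X Y i :=
  ((cocycleClass e X Y i).exists_rightInverse_of_surjective
    (LinearMap.range_eq_top.mpr (cocycleClass_surjective e))).choose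

lemma cocycleClass_cocycleRep (a : Abelian.Ext X Y i) :
    cocycleClass e X Y i (cocycleRep e X Y i a) = a :=
  LinearMap.congr_fun ((cocycleClass e X Y i).exists_rightInverse_of_surjective
    (LinearMap.range_eq_top.mpr (cocycleClass_surjective e))).choose_spec a

open Classical in
/-- The pairing of `Ext^i(X, Y)` and `Ext^j(X^*, ι(Y)^•)` for `i + j = n` and `X` of finite
dimension, induced by the pairing of cocycles; it is set to be zero in all other cases. -/
def extPairing (X Y : ModuleCat.{u} (GradedHeckeAlgebra k)) (i j : ℕ) :
    Abelian.Ext X Y i →ₗ[ℂ]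
      Abelian.Ext ((starDual k).obj (.op X)) ((imBulletDual k).obj (.op Y)) j →ₗ[ℂ] ℂ :=
  if h : FiniteDimensional ℂ X ∧ i + j = n then
    haveI := h.1
    (cochPairing h.2 e).compl₁₂
      ((cocycles e X Y i).subtype ∘ₗ cocycleRep e X Y i)
      ((cocycles e ((starDual k).obj (.op X)) ((imBulletDual k).obj (.op Y)) j).subtype ∘ₗ
        cocycleRep e _ _ j)
  else 0

lemma cocycleClass_sub {η ξ : cocycles e X Y i}
    (h : cocycleClass e X Y i η = cocycleClass e X Y i ξ) : cocycleClass e X Y i (η - ξ) = 0 := by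
  have h1 := (cocycleClass e X Y i).map_add (η - ξ) ξ
  have h0 : η - ξ + ξ = η := Subtype.ext (sub_add_cancel η.1 ξ.1)
  rw [h0, h] at h1
  exact right_eq_add.mp h1

lemma extPairing_apply [hX : FiniteDimensional ℂ X] (hij : i + j = n) (a : Abelian.Ext X Y i)
    (c : Abelian.Ext ((starDual k).obj (.op X)) ((imBulletDual k).obj (.op Y)) j) :
    extPairing e X Y i j a c =
      cochPairing hij e (cocycleRep e X Y i a).1 (cocycleRep e _ _ j c).1 := by
  rw [extPairing, dif_pos ⟨hX, hij⟩]
  rfl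

/-- The pairing does not depend on the choice of the cocycles. -/
lemma extPairing_cocycleClass [FiniteDimensional ℂ X] (hij : i + j = n)
    (η : cocycles e X Y i)
    (η' : cocycles e ((starDual k).obj (.op X)) ((imBulletDual k).obj (.op Y)) j) :
    extPairing e X Y i j (cocycleClass e X Y i η) (cocycleClass e _ _ j η') =
      cochPairing hij e η.1 η'.1 := by
  have h1 := cochPairing_eq_zero_of_class_left e hij
    (cocycleClass_sub e (cocycleClass_cocycleRep e (cocycleClass e X Y i η)))
    (cocycleRep e _ _ j (cocycleClass e _ _ j η'))
  have h2 := cochPairing_eq_zero_of_class_right e hij η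
    (cocycleClass_sub e (cocycleClass_cocycleRep e (cocycleClass e _ _ j η')))
  rw [AddSubgroupClass.coe_sub, map_sub, LinearMap.sub_apply, sub_eq_zero] at h1
  rw [AddSubgroupClass.coe_sub, map_sub, sub_eq_zero] at h2
  exact (extPairing_apply e hij _ _).trans (h1.trans h2)

lemma extPairing_koszulExt [FiniteDimensional ℂ X] (hij : i + j = n) {f : koszul X i ⟶ Y}
    (hf : cochD e (toCoch f) = 0)
    {f' : koszul ((starDual k).obj (.op X)) j ⟶ (imBulletDual k).obj (.op Y)}
    (hf' : cochD e (toCoch f') = 0) :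
    extPairing e X Y i j (koszulExt e f hf) (koszulExt e f' hf') =
      cochPairing hij e (toCoch f) (toCoch f') := by
  rw [← cocycleClass_toCoch e hf, ← cocycleClass_toCoch e hf', extPairing_cocycleClass e hij]

lemma extPairing_nondegenerate [FiniteDimensional ℂ X] [FiniteDimensional ℂ Y]
    (hij : i + j = n) : (extPairing e X Y i j).Nondegenerate := by
  constructor
  · intro a ha
    obtain ⟨η, rfl⟩ := cocycleClass_surjective e a
    have h : ∀ η' : Coch ((starDual k).obj (.op X)) ((imBulletDual k).obj (.op Y)) j,
        IsEquivariant η' → cochD e η' = 0 → cochPairing hij e η.1 η' = 0 := fun η' h1 h2 => by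
      rw [← ha (cocycleClass e _ _ j ⟨η', h1, h2⟩), extPairing_cocycleClass e hij]
    cases i with
    | zero =>
      have h0 : η = 0 :=
        Subtype.ext (eq_zero_of_cocycles_left e hij (isEquivariant_coe_cocycle η) h)
      rw [h0, map_zero]
    | succ i =>
      exact (cocycleClass_succ_eq_zero_iff e).mpr
        (exists_cochD_eq_left e hij (isEquivariant_coe_cocycle η) h)
  · intro a ha
    obtain ⟨η', rfl⟩ := cocycleClass_surjective e a
    have h : ∀ η : Coch X Y i, IsEquivariant η → cochD e η = 0 →
        cochPairing hij e η η'.1 = 0 := fun η h1 h2 => by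
      rw [← ha (cocycleClass e _ _ i ⟨η, h1, h2⟩), extPairing_cocycleClass e hij]
    cases j with
    | zero =>
      have h0 : η' = 0 :=
        Subtype.ext (eq_zero_of_cocycles_right e hij (isEquivariant_coe_cocycle η') h)
      rw [h0, map_zero]
    | succ j =>
      exact (cocycleClass_succ_eq_zero_iff e).mpr
        (exists_cochD_eq_right e hij (isEquivariant_coe_cocycle η') h)

lemma extPairing_mk₀_comp {X' : ModuleCat.{u} (GradedHeckeAlgebra k)} [FiniteDimensional ℂ X]
    [FiniteDimensional ℂ X'] (φ : X' ⟶ X) (hij : i + j = n) (a : Abelian.Ext X Y i)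
    (c : Abelian.Ext ((starDual k).obj (.op X')) ((imBulletDual k).obj (.op Y)) j) :
    extPairing e X' Y i j ((Abelian.Ext.mk₀ φ).comp a (zero_add i)) c =
      extPairing e X Y i j a
        ((Abelian.Ext.mk₀ ((starDual k).map φ.op)).comp c (zero_add j)) := by
  obtain ⟨f, hf, rfl⟩ := exists_koszulExt e a
  obtain ⟨f', hf', rfl⟩ := exists_koszulExt e c
  rw [mk₀_comp_koszulExt, mk₀_comp_koszulExt, extPairing_koszulExt e hij,
    extPairing_koszulExt e hij, toCoch_koszulMap_comp, toCoch_koszulMap_comp, cochPairing_comp]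

lemma extPairing_comp_mk₀ {Y' : ModuleCat.{u} (GradedHeckeAlgebra k)} [FiniteDimensional ℂ X]
    (φ : Y ⟶ Y') (hij : i + j = n) (a : Abelian.Ext X Y i)
    (c : Abelian.Ext ((starDual k).obj (.op X)) ((imBulletDual k).obj (.op Y')) j) :
    extPairing e X Y' i j (a.comp (Abelian.Ext.mk₀ φ) (add_zero i)) c =
      extPairing e X Y i j a
        (c.comp (Abelian.Ext.mk₀ ((imBulletDual k).map φ.op)) (add_zero j)) := by
  obtain ⟨f, hf, rfl⟩ := exists_koszulExt e a
  obtain ⟨f', hf', rfl⟩ := exists_koszulExt e c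
  rw [koszulExt_comp_mk₀, koszulExt_comp_mk₀, extPairing_koszulExt e hij,
    extPairing_koszulExt e hij, toCoch_comp, toCoch_comp, cochPairing_compr₂]

/-- The formula for the pairing in terms of arbitrary resolutions of Koszul type. -/
lemma extPairing_extMk [FiniteDimensional ℂ X] (K : KoszulResolution X)
    (K' : KoszulResolution ((starDual k).obj (.op X))) (hij : i + j = n)
    (ψ : K.res.complex.X i ⟶ Y) (hψ : K.res.complex.d (i + 1) i ≫ ψ = 0)
    (ψ' : K'.res.complex.X j ⟶ (imBulletDual k).obj (.op Y))
    (hψ' : K'.res.complex.d (j + 1) j ≫ ψ' = 0) {r : ℕ} (b : Module.Basis (Fin r) ℂ X) :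
    extPairing e X Y i j (K.res.extMk ψ (i + 1) rfl hψ) (K'.res.extMk ψ' (j + 1) rfl hψ') =
      cochainPairing hij e b (cochain K ψ) (cochain K' ψ') := by
  obtain ⟨hf, h⟩ := extMk_eq_koszulExt e K ψ hψ
  obtain ⟨hf', h'⟩ := extMk_eq_koszulExt e K' ψ' hψ'
  rw [h, h', extPairing_koszulExt e hij, ← cochainPairing_eq e hij b]
  rfl

end ExtPairing

end GradedHecke

end

open GradedHecke ModuleCat in
theorem theorem4 {ι V₀ N : Type u} [Fintype ι] [AddCommGroup V₀] [Module ℝ V₀]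
    [FiniteDimensional ℝ V₀] [AddCommGroup N] [Module ℝ N]
    (P : RootPairing ι ℝ V₀ N) [P.IsReduced] (S : SimpleSystem P) (k : Parameter S)
    (n : ℕ) (hn : n = Module.finrank ℂ (ℂ ⊗[ℝ] V₀)) (e : Module.Basis (Fin n) ℂ (ℂ ⊗[ℝ] V₀)) :
    -- every finite-dimensional module has its Koszul-type resolution
    (∀ (X : ModuleCat.{u} (GradedHeckeAlgebra k)) [FiniteDimensional ℂ X],
      Nonempty (KoszulResolution X)) ∧
    -- the groups `Ext^i` vanish for `i > n`
    (∀ (X Y : ModuleCat.{u} (GradedHeckeAlgebra k)) [FiniteDimensional ℂ X]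
      [FiniteDimensional ℂ Y] (i : ℕ), n < i → Subsingleton (Abelian.Ext X Y i)) ∧
    -- and there are bilinear pairings
    ∃ β : ∀ (X Y : ModuleCat.{u} (GradedHeckeAlgebra k)) (i j : ℕ),
        Abelian.Ext X Y i →ₗ[ℂ]
          Abelian.Ext ((starDual k).obj (.op X)) ((imBulletDual k).obj (.op Y)) j →ₗ[ℂ]
            ℂ,
      -- which are non-degenerate,
      (∀ (X Y : ModuleCat.{u} (GradedHeckeAlgebra k)) [FiniteDimensional ℂ X]
        [FiniteDimensional ℂ Y] (i j : ℕ), i + j = n → (β X Y i j).Nondegenerate) ∧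
      -- natural in the first variable,
      (∀ (X X' Y : ModuleCat.{u} (GradedHeckeAlgebra k)) [FiniteDimensional ℂ X]
        [FiniteDimensional ℂ X'] [FiniteDimensional ℂ Y] (φ : X' ⟶ X) (i j : ℕ), i + j = n →
        ∀ (a : Abelian.Ext X Y i) (c : Abelian.Ext ((starDual k).obj (.op X'))
          ((imBulletDual k).obj (.op Y)) j),
          β X' Y i j ((Abelian.Ext.mk₀ φ).comp a (zero_add i)) c =
            β X Y i j a ((Abelian.Ext.mk₀ ((starDual k).map φ.op)).comp c (zero_add j))) ∧
      -- natural in the second variable,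
      (∀ (X Y Y' : ModuleCat.{u} (GradedHeckeAlgebra k)) [FiniteDimensional ℂ X]
        [FiniteDimensional ℂ Y] [FiniteDimensional ℂ Y'] (φ : Y ⟶ Y') (i j : ℕ), i + j = n →
        ∀ (a : Abelian.Ext X Y i) (c : Abelian.Ext ((starDual k).obj (.op X))
          ((imBulletDual k).obj (.op Y')) j),
          β X Y' i j (a.comp (Abelian.Ext.mk₀ φ) (add_zero i)) c =
            β X Y i j a
              (c.comp (Abelian.Ext.mk₀ ((imBulletDual k).map φ.op)) (add_zero j))) ∧
      -- and induced by the pairing of cochains of the Koszul-type resolutions.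
      (∀ (X Y : ModuleCat.{u} (GradedHeckeAlgebra k)) [FiniteDimensional ℂ X]
        [FiniteDimensional ℂ Y] (K : KoszulResolution X)
        (K' : KoszulResolution ((starDual k).obj (.op X))) (i j : ℕ) (hij : i + j = n)
        (ψ : K.res.complex.X i ⟶ Y) (hψ : K.res.complex.d (i + 1) i ≫ ψ = 0)
        (ψ' : K'.res.complex.X j ⟶ (imBulletDual k).obj (.op Y))
        (hψ' : K'.res.complex.d (j + 1) j ≫ ψ' = 0)
        (r : ℕ) (b : Module.Basis (Fin r) ℂ X),
        β X Y i j (K.res.extMk ψ (i + 1) rfl hψ) (K'.res.extMk ψ' (j + 1) rfl hψ') =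
          cochainPairing hij e b (cochain K ψ) (cochain K' ψ')) := by
  exact ⟨fun X _ => ⟨koszulResolution e X⟩, fun X Y _ _ i hi => subsingleton_ext e hi,
    extPairing e, fun X Y _ _ i j hij => extPairing_nondegenerate e hij,
    fun X X' Y _ _ _ φ i j hij a c => extPairing_mk₀_comp e φ hij a c,
    fun X Y Y' _ _ _ φ i j hij a c => extPairing_comp_mk₀ e φ hij a c,
    fun X Y _ _ K K' i j hij ψ hψ ψ' hψ' r b =>
      extPairing_extMk e K K' hij ψ hψ ψ' hψ' b⟩
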